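/- **Conventions.** Let $\mathbb R_+=[0,\infty)$. For $q\in\mathbb N$ let $\mathcal A_q$ be the set of real $\chi\in C_c^\infty(\mathbb R)$ with $\int\chi=1$ and $\int x^k\chi(x)\,dx=0$ for $1\le k\le q$, and put $\chi_\varepsilon(x)=\varepsilon^{-1}\chi(x/\varepsilon)$. (A product mollifier $\chi\otimes\dots\otimes\chi$ on $\mathbb R^m$ is identified with $\chi$.) Let $\Omega=\mathbb R_+$ or $\Omega=\mathbb R_+^2$. A family $u:\mathcal A_1\to C^\infty(\Omega;\mathbb C)$ (smooth up to the boundary), written $u(\chi,\cdot)$, is *moderate* if for every compact $K\subset\Omega$ and every differential operator $D=\partial^\alpha$ there is $N\in\mathbb N$ such that for all $\chi\in\mathcal A_N$ there are $C,\eta>0$ with $\sup_K|Du(\chi_\varepsilon,\cdot)|\le C\varepsilon^{-N}$ for $0<\varepsilon<\eta$. It is *negligible* if for all $K,D$ there is $N$ such that for all $q\ge N$ and $\chi\in\mathcal A_q$ there are $C,\eta>0$ with $\sup_K|Du(\chi_\varepsilon,\cdot)|\le C\varepsilon^{q-N}$ for $0<\varepsilon<\eta$. The Colombeau algebra $\mathcal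 G(\Omega)$ is the algebra of moderate families modulo the ideal of negligible ones; derivatives and restrictions to $\{t=0\}$ and $\{x=0\}$ are defined on representatives. A generalized function $U\in\mathcal G(\Omega)$ is * *globally bounded* if it has a representative $u$ for which there are $N\in\mathbb N$ and $c>0$ such that for every $\chi\in\mathcal A_N$ there is $\eta>0$ with $\sup_{\Omega}|u(\chi_\varepsilon,\cdot)|\le c$ for $0<\varepsilon<\eta$; * *of locally logarithmic growth* if it has a representative $u$ such that for every compact $K\subset\Omega$ there is $N\in\mathbb N$ such that for every $\chi\in\mathcal A_N$ there are $c,\eta>0$ with $\sup_K|u(\chi_\varepsilon,\cdot)|\le N\log(c/\varepsilon)$ for $0<\varepsilon<\eta$; * *strictly positive*, $U>0$, if it has a representative $u$ such that for every compact $K\subset\Omega$ there is $N\in\mathbb N$ such that for every $\chi\in\mathcal A_N$ there is $\eta>0$ such that $u(\chi_\varepsilon,\cdot)$ is real and $\ge\varepsilon^N$ on $K$ for $0<\varepsilon<\eta$. We write $U>V$ if $U-V>0$. **Theorem 1.** Let $0\le r\le n$, let $\Lambda_i,F_{ik},A_i\in\mathcal G(\mathbb R_+^2)$ and $U_{0,i},\nu_{ik},H_i\in\mathcal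 G(\mathbb R_+)$. Consider the problem of finding $U=(U_1,\dots,U_n)\in\mathcal G(\mathbb R_+^2)^n$ with $$\begin{cases}\partial_tU_i+\Lambda_i\,\partial_xU_i=\sum_{k=1}^nF_{ik}U_k+A_i&\text{in }\mathcal G(\mathbb R_+^2),\ i=1,\dots,n,\\ U_i(x,0)=U_{0,i}(x)&\text{in }\mathcal G(\mathbb R_+),\ i=1,\dots,n,\\ U_i(0,t)=\sum_{k=r+1}^n\nu_{ik}(t)U_k(0,t)+H_i(t)&\text{in }\mathcal G(\mathbb R_+),\ i=1,\dots,r.\end{cases}\tag{1}$$ Assume: 1. $\Lambda_1>\dots>\Lambda_r>0>\Lambda_{r+1}>\dots>\Lambda_n$; 2. every $\Lambda_i$ and every $\nu_{ik}$ ($i\le r<k$) is globally bounded; 3. every $\partial_x\Lambda_i$ and every $F_{ik}$ is of locally logarithmic growth; 4. (compatibility) there are representatives $\lambda_i,f_{ik},a_i,u_{0,i},v_{ik},h_i$ of $\Lambda_i,F_{ik},A_i,U_{0,i},\nu_{ik},H_i$ and $N\in\mathbb N$ such that for every $\chi\in\mathcal A_N$ and all sufficiently small $\varepsilon>0$ the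 functions obtained by inserting $\chi_\varepsilon$, with $\lambda_i$ real-valued, satisfy the classical compatibility conditions of all orders at the corner: if $w^{(0)}_i=u_{0,i}$ and, for $m\ge0$, $$w^{(m+1)}_i(x)=\sum_{j=0}^m\binom mj\Bigl[-\partial_t^j\lambda_i(x,0)\,\partial_xw_i^{(m-j)}(x)+\sum_{k=1}^n\partial_t^jf_{ik}(x,0)\,w_k^{(m-j)}(x)\Bigr]+\partial_t^ma_i(x,0),$$ then $w_i^{(m)}(0)=\sum_{k=r+1}^n\sum_{j=0}^m\binom mj v_{ik}^{(j)}(0)\,w_k^{(m-j)}(0)+h_i^{(m)}(0)$ for all $m\ge0$ and $i=1,\dots,r$. Then problem (1) has exactly one solution $U\in\mathcal G(\mathbb R_+^2)^n$. -/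

import Mathlib

open Set Filter Topology
open scoped ContDiff

noncomputable section

namespace Colombeau

/-! ### Mollifiers -/

/-- The set `A_q(ℝ)` of test functions with integral one and vanishing moments of
orders `1, …, q`. -/
def mollifiers (q : ℕ) : Set (ℝ → ℝ) :=
  {χ | ContDiff ℝ ∞ χ ∧ HasCompactSupport χ ∧ ∫ x, χ x = 1 ∧
    ∀ k : ℕ, 1 ≤ k → k ≤ q → ∫ x, x ^ k * χ x = 0}

/-- The index set `A_1` of the Colombeau algebras. The elements of `A_q(ℝ^m)` are the tensor
powers `χ ⊗ ⋯ ⊗ χ` with `χ ∈ A_q(ℝ)`. As `χ` has integral one it is determined by its tensor power,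
and `(χ ⊗ ⋯ ⊗ χ)_ε = χ_ε ⊗ ⋯ ⊗ χ_ε`. Hence `A_q(ℝ^m)` is identified with `A_q(ℝ)` for every `m`,
and this makes it possible to restrict generalized functions to coordinate axes. -/
abbrev Mollifier : Type := mollifiers 1

theorem mollifiers_anti {p q : ℕ} (h : p ≤ q) : mollifiers q ⊆ mollifiers p :=
  fun _ hχ => ⟨hχ.1, hχ.2.1, hχ.2.2.1, fun k h1 hk => hχ.2.2.2 k h1 (hk.trans h)⟩

/-- Recovering `χ` from its tensor square, for functions of integral one. -/
theorem tensorSquare_injective {χ ψ : ℝ → ℝ} (hχ : ∫ x, χ x = 1) (hψ : ∫ x, ψ x = 1)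
    (h : ∀ x y, χ x * χ y = ψ x * ψ y) : χ = ψ := by
  funext x
  have h1 : ∫ y, χ x * χ y = ∫ y, ψ x * ψ y := by simp_rw [h]
  rw [MeasureTheory.integral_const_mul, MeasureTheory.integral_const_mul, hχ, hψ] at h1
  simpa using h1

/-- `χ_ε(x) = ε⁻¹ χ(x / ε)`. -/
def rescale (ε : ℝ) (χ : ℝ → ℝ) : ℝ → ℝ := fun x => ε⁻¹ * χ (x / ε)

theorem rescale_mem {ε : ℝ} (hε : 0 < ε) {q : ℕ} {χ : ℝ → ℝ} (hχ : χ ∈ mollifiers q) :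
    rescale ε χ ∈ mollifiers q := by
  have hε0 : ε ≠ 0 := hε.ne'
  refine ⟨?_, ?_, ?_, ?_⟩
  · exact contDiff_const.mul (hχ.1.comp (contDiff_id.div_const ε))
  · have h1 : HasCompactSupport (fun x : ℝ => χ (x * ε⁻¹)) :=
      hχ.2.1.comp_homeomorph (Homeomorph.mulRight₀ ε⁻¹ (inv_ne_zero hε0))
    have h2 := h1.mul_left (f := fun _ : ℝ => ε⁻¹)
    have e : rescale ε χ = (fun _ : ℝ => ε⁻¹) * fun x => χ (x * ε⁻¹) := by
      funext x
      simp [rescale, div_eq_mul_inv]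
    rw [e]
    exact h2
  · have h := MeasureTheory.Measure.integral_comp_div χ ε
    simp only [rescale]
    rw [MeasureTheory.integral_const_mul, h, hχ.2.2.1, abs_of_pos hε]
    simp [hε0]
  · intro k h1 hk
    have h := MeasureTheory.Measure.integral_comp_div (fun y => y ^ k * χ y) ε
    have e : (fun x : ℝ => x ^ k * rescale ε χ x)
        = fun x => (ε⁻¹ * ε ^ k) * ((x / ε) ^ k * χ (x / ε)) := by
      funext x
      simp only [rescale, div_pow]
      field_simp
    rw [e, MeasureTheory.integral_const_mul, h, hχ.2.2.2 k h1 hk]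
    simp

/-- The rescaled mollifier `χ_ε` as an element of `A_1`; only `ε > 0` matters. -/
def Mollifier.scale (ε : ℝ) (χ : Mollifier) : Mollifier :=
  if h : 0 < ε then ⟨rescale ε χ, rescale_mem h χ.2⟩ else χ

/-! ### The Colombeau algebra of a domain -/

section Algebra

variable {V W : Type} [NormedAddCommGroup V] [NormedSpace ℝ V]
  [NormedAddCommGroup W] [NormedSpace ℝ W]

/-- `sup_{x ∈ K} |D^k u(χ_ε, x)| ≤ C ε^a` for some `C` and all sufficiently small `ε > 0`.
Here `D^k` is the full derivative of order `k`, that is, all partial derivatives of order `k`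
together; the derivatives are one-sided at boundary points of `Ω`. -/
def DerivBound (Ω : Set V) (u : Mollifier → V → ℂ) (K : Set V) (k : ℕ) (χ : Mollifier)
    (a : ℤ) : Prop :=
  ∃ C : ℝ, ∀ᶠ ε in 𝓝[>] (0 : ℝ), ∀ x ∈ K,
    ‖iteratedFDerivWithin ℝ k (u (χ.scale ε)) Ω x‖ ≤ C * ε ^ a

/-- Moderate families. -/
def IsModerate (Ω : Set V) (u : Mollifier → V → ℂ) : Prop :=
  ∀ K ⊆ Ω, IsCompact K → ∀ k : ℕ, ∃ N : ℕ, ∀ χ : Mollifier, χ.1 ∈ mollifiers N →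
    DerivBound Ω u K k χ (-(N : ℤ))

/-- Negligible families. -/
def IsNegligible (Ω : Set V) (u : Mollifier → V → ℂ) : Prop :=
  ∀ K ⊆ Ω, IsCompact K → ∀ k : ℕ, ∃ N : ℕ, ∀ q : ℕ, N ≤ q →
    ∀ χ : Mollifier, χ.1 ∈ mollifiers q → DerivBound Ω u K k χ ((q : ℤ) - N)

/-- Families of functions that are smooth on `Ω`. If `Ω` has boundary points, this means smooth
up to the boundary. -/
def IsSmooth (Ω : Set V) (u : Mollifier → V → ℂ) : Prop :=
  ∀ χ, ContDiffOn ℝ ∞ (u χ) Ω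

theorem eventually_lt_one : ∀ᶠ ε in 𝓝[>] (0 : ℝ), 0 < ε ∧ ε < 1 :=
  Ioo_mem_nhdsGT one_pos

section Bounds

variable {Ω K : Set V} {u v : Mollifier → V → ℂ} {k : ℕ} {χ : Mollifier} {a b : ℤ}

theorem DerivBound.nonneg (h : DerivBound Ω u K k χ a) :
    ∃ C : ℝ, 0 ≤ C ∧ ∀ᶠ ε in 𝓝[>] (0 : ℝ), ∀ x ∈ K,
      ‖iteratedFDerivWithin ℝ k (u (χ.scale ε)) Ω x‖ ≤ C * ε ^ a := by
  obtain ⟨C, hC⟩ := h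
  refine ⟨|C|, abs_nonneg C, ?_⟩
  filter_upwards [hC, eventually_lt_one] with ε h1 h2 x hx
  refine (h1 x hx).trans ?_
  have : (0 : ℝ) < ε ^ a := zpow_pos h2.1 a
  gcongr
  exact le_abs_self C

theorem DerivBound.mono (h : DerivBound Ω u K k χ a) (hab : b ≤ a) :
    DerivBound Ω u K k χ b := by
  obtain ⟨C, hC0, hC⟩ := h.nonneg
  refine ⟨C, ?_⟩
  filter_upwards [hC, eventually_lt_one] with ε h1 h2 x hx
  refine (h1 x hx).trans ?_
  exact mul_le_mul_of_nonneg_left (zpow_le_zpow_right_of_le_one₀ h2.1 h2.2.le hab) hC0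

theorem DerivBound.add (hΩ : UniqueDiffOn ℝ Ω) (hK : K ⊆ Ω) (hu : IsSmooth Ω u)
    (hv : IsSmooth Ω v) (h : DerivBound Ω u K k χ a) (h' : DerivBound Ω v K k χ a) :
    DerivBound Ω (u + v) K k χ a := by
  obtain ⟨C, hC⟩ := h
  obtain ⟨C', hC'⟩ := h'
  refine ⟨C + C', ?_⟩
  filter_upwards [hC, hC'] with ε h1 h2 x hx
  have e := iteratedFDerivWithin_add_apply (i := k) (x := x)
    (((hu (χ.scale ε)).of_le (by exact_mod_cast le_top)) x (hK hx))
    (((hv (χ.scale ε)).of_le (by exact_mod_cast le_top)) x (hK hx)) hΩ (hK hx)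
  rw [Pi.add_apply, e, add_mul]
  exact (norm_add_le _ _).trans (add_le_add (h1 x hx) (h2 x hx))

theorem DerivBound.neg (hΩ : UniqueDiffOn ℝ Ω) (hK : K ⊆ Ω) (h : DerivBound Ω u K k χ a) :
    DerivBound Ω (-u) K k χ a := by
  obtain ⟨C, hC⟩ := h
  refine ⟨C, ?_⟩
  filter_upwards [hC] with ε h1 x hx
  rw [Pi.neg_apply, iteratedFDerivWithin_neg_apply hΩ (hK hx), norm_neg]
  exact h1 x hx

theorem DerivBound.mul (hΩ : UniqueDiffOn ℝ Ω) (hK : K ⊆ Ω) (hu : IsSmooth Ω u)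
    (hv : IsSmooth Ω v) (h : ∀ i ≤ k, DerivBound Ω u K i χ a)
    (h' : ∀ i ≤ k, DerivBound Ω v K i χ b) : DerivBound Ω (u * v) K k χ (a + b) := by
  choose! C hC0 hC using fun i (hi : i ≤ k) => (h i hi).nonneg
  choose! C' hC'0 hC' using fun i (hi : i ≤ k) => (h' i hi).nonneg
  have e1 : ∀ᶠ ε in 𝓝[>] (0 : ℝ), ∀ i ∈ Finset.range (k + 1), ∀ x ∈ K,
      ‖iteratedFDerivWithin ℝ i (u (χ.scale ε)) Ω x‖ ≤ C i * ε ^ a :=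
    (eventually_all_finset _).2 fun i hi => hC i (Nat.lt_succ_iff.1 (Finset.mem_range.1 hi))
  have e2 : ∀ᶠ ε in 𝓝[>] (0 : ℝ), ∀ i ∈ Finset.range (k + 1), ∀ x ∈ K,
      ‖iteratedFDerivWithin ℝ i (v (χ.scale ε)) Ω x‖ ≤ C' i * ε ^ b :=
    (eventually_all_finset _).2 fun i hi => hC' i (Nat.lt_succ_iff.1 (Finset.mem_range.1 hi))
  refine ⟨∑ i ∈ Finset.range (k + 1), (k.choose i : ℝ) * C i * C' (k - i), ?_⟩
  filter_upwards [e1, e2, eventually_lt_one] with ε h1 h2 h3 x hx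
  have hle := norm_iteratedFDerivWithin_mul_le (hu (χ.scale ε)) (hv (χ.scale ε)) hΩ (hK hx)
    (n := k) (by exact_mod_cast le_top)
  refine hle.trans ?_
  rw [Finset.sum_mul]
  refine Finset.sum_le_sum fun i hi => ?_
  have hik : i ≤ k := Nat.lt_succ_iff.1 (Finset.mem_range.1 hi)
  have b1 := h1 i hi x hx
  have b2 := h2 (k - i) (Finset.mem_range.2 (by omega)) x hx
  have ha : (0 : ℝ) < ε ^ a := zpow_pos h3.1 a
  have hCi := hC0 i hik
  calc (k.choose i : ℝ) * ‖iteratedFDerivWithin ℝ i (u (χ.scale ε)) Ω x‖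
        * ‖iteratedFDerivWithin ℝ (k - i) (v (χ.scale ε)) Ω x‖
      ≤ (k.choose i : ℝ) * (C i * ε ^ a) * (C' (k - i) * ε ^ b) := by gcongr
    _ = (k.choose i : ℝ) * C i * C' (k - i) * ε ^ (a + b) := by
        rw [zpow_add₀ h3.1.ne']; ring

theorem DerivBound.congr (hK : K ⊆ Ω) (h : DerivBound Ω u K k χ a)
    (huv : ∀ ψ, EqOn (u ψ) (v ψ) Ω) : DerivBound Ω v K k χ a := by
  obtain ⟨C, hC⟩ := h
  refine ⟨C, ?_⟩
  filter_upwards [hC] with ε h1 x hx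
  rw [← iteratedFDerivWithin_congr (huv (χ.scale ε)) (hK hx)]
  exact h1 x hx

theorem DerivBound.deriv (hΩ : UniqueDiffOn ℝ Ω) (hK : K ⊆ Ω) (hu : IsSmooth Ω u)
    (h : DerivBound Ω u K (k + 1) χ a) (e : V) :
    DerivBound Ω (fun χ x => fderivWithin ℝ (u χ) Ω x e) K k χ a := by
  obtain ⟨C, hC⟩ := h
  refine ⟨‖e‖ * C, ?_⟩
  filter_upwards [hC] with ε h1 x hx
  have hs : ContDiffOn ℝ ∞ (fderivWithin ℝ (u (χ.scale ε)) Ω) Ω :=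
    (hu (χ.scale ε)).fderivWithin hΩ (by simp)
  have h2 := norm_iteratedFDerivWithin_clm_apply_const (c := e) (n := k)
    (hs x (hK hx)) hΩ (hK hx) (by exact_mod_cast le_top)
  rw [norm_iteratedFDerivWithin_fderivWithin hΩ (hK hx)] at h2
  rw [mul_assoc]
  exact h2.trans (mul_le_mul_of_nonneg_left (h1 x hx) (norm_nonneg e))

theorem DerivBound.pullback {Ω' L : Set W} (hΩ : UniqueDiffOn ℝ Ω) (hΩ' : UniqueDiffOn ℝ Ω')
    (hu : IsSmooth Ω u) (g : W →L[ℝ] V) (hg : g ⁻¹' Ω = Ω') (hL : L ⊆ Ω')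
    (h : DerivBound Ω u (g '' L) k χ a) :
    DerivBound Ω' (fun χ x => u χ (g x)) L k χ a := by
  obtain ⟨C, hC⟩ := h
  subst hg
  refine ⟨C * ‖g‖ ^ k, ?_⟩
  filter_upwards [hC] with ε h1 x hx
  have e := g.iteratedFDerivWithin_comp_right (hu (χ.scale ε)) hΩ hΩ' (x := x) (hL hx)
    (i := k) (by exact_mod_cast le_top)
  change ‖iteratedFDerivWithin ℝ k (u (χ.scale ε) ∘ g) (g ⁻¹' Ω) x‖ ≤ _
  rw [e]
  refine (ContinuousMultilinearMap.norm_compContinuousLinearMap_le _ _).trans ?_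
  rw [Finset.prod_const, Finset.card_univ, Fintype.card_fin, mul_right_comm]
  exact mul_le_mul_of_nonneg_right (h1 _ (mem_image_of_mem g hx)) (by positivity)

end Bounds

/-- In a moderate family the exponent can be chosen uniformly for orders `≤ k`. -/
theorem IsModerate.uniform {Ω K : Set V} {u : Mollifier → V → ℂ} (h : IsModerate Ω u)
    (hK : K ⊆ Ω) (hc : IsCompact K) (k : ℕ) : ∃ N : ℕ, ∀ χ : Mollifier, χ.1 ∈ mollifiers N →
      ∀ i ≤ k, DerivBound Ω u K i χ (-(N : ℤ)) := by
  choose N hN using fun i => h K hK hc i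
  refine ⟨∑ i ∈ Finset.range (k + 1), N i, fun χ hχ i hi => ?_⟩
  have hle : N i ≤ ∑ i ∈ Finset.range (k + 1), N i :=
    Finset.single_le_sum (f := N) (fun _ _ => Nat.zero_le _) (Finset.mem_range.2 (by omega))
  exact (hN i χ (mollifiers_anti hle hχ)).mono (by omega)

theorem IsNegligible.uniform {Ω K : Set V} {u : Mollifier → V → ℂ} (h : IsNegligible Ω u)
    (hK : K ⊆ Ω) (hc : IsCompact K) (k : ℕ) : ∃ N : ℕ, ∀ q : ℕ, N ≤ q → ∀ χ : Mollifier,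
      χ.1 ∈ mollifiers q → ∀ i ≤ k, DerivBound Ω u K i χ ((q : ℤ) - N) := by
  choose N hN using fun i => h K hK hc i
  refine ⟨∑ i ∈ Finset.range (k + 1), N i, fun q hq χ hχ i hi => ?_⟩
  have hle : N i ≤ ∑ i ∈ Finset.range (k + 1), N i :=
    Finset.single_le_sum (f := N) (fun _ _ => Nat.zero_le _) (Finset.mem_range.2 (by omega))
  exact (hN i q (hle.trans hq) χ hχ).mono (by omega)

variable (Ω : Set V) [hΩ : Fact (UniqueDiffOn ℝ Ω)]

/-- The algebra `E_M[Ω]` of moderate families of smooth functions on `Ω`. -/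
def moderate : Subalgebra ℂ (Mollifier → V → ℂ) where
  carrier := {u | IsSmooth Ω u ∧ IsModerate Ω u}
  mul_mem' := by
    rintro u v ⟨hu, hu'⟩ ⟨hv, hv'⟩
    refine ⟨fun χ => (hu χ).mul (hv χ), fun K hK hc k => ?_⟩
    obtain ⟨N, hN⟩ := hu'.uniform hK hc k
    obtain ⟨M, hM⟩ := hv'.uniform hK hc k
    refine ⟨N + M, fun χ hχ => ?_⟩
    exact (DerivBound.mul hΩ.out hK hu hv (hN χ (mollifiers_anti (by omega) hχ))
      (hM χ (mollifiers_anti (by omega) hχ))).mono (by push_cast; omega)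
  add_mem' := by
    rintro u v ⟨hu, hu'⟩ ⟨hv, hv'⟩
    refine ⟨fun χ => (hu χ).add (hv χ), fun K hK hc k => ?_⟩
    obtain ⟨N, hN⟩ := hu' K hK hc k
    obtain ⟨M, hM⟩ := hv' K hK hc k
    refine ⟨N + M, fun χ hχ => ?_⟩
    exact DerivBound.add hΩ.out hK hu hv
      ((hN χ (mollifiers_anti (by omega) hχ)).mono (by push_cast; omega))
      ((hM χ (mollifiers_anti (by omega) hχ)).mono (by push_cast; omega))
  algebraMap_mem' := by
    intro c
    refine ⟨fun χ => contDiffOn_const, fun K hK hc k => ⟨0, fun χ _ => ?_⟩⟩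
    refine ⟨‖c‖, ?_⟩
    filter_upwards with ε x hx
    change ‖iteratedFDerivWithin ℝ k (fun _ : V => c) Ω x‖ ≤ _
    rcases k with _ | k
    · simp
    · simp [iteratedFDerivWithin_succ_const]

/-- The ideal `N[Ω]` of negligible families. -/
def negligible : Ideal (moderate Ω) where
  carrier := {u | IsNegligible Ω u.1}
  zero_mem' := by
    intro K hK hc k
    refine ⟨0, fun q _ χ _ => ⟨0, ?_⟩⟩
    filter_upwards with ε x hx
    change ‖iteratedFDerivWithin ℝ k (fun _ : V => (0 : ℂ)) Ω x‖ ≤ _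
    simp
  add_mem' := by
    rintro u v hu hv K hK hc k
    obtain ⟨N, hN⟩ := hu K hK hc k
    obtain ⟨M, hM⟩ := hv K hK hc k
    refine ⟨N + M, fun q hq χ hχ => ?_⟩
    exact DerivBound.add hΩ.out hK u.2.1 v.2.1
      ((hN q (by omega) χ hχ).mono (by push_cast; omega))
      ((hM q (by omega) χ hχ).mono (by push_cast; omega))
  smul_mem' := by
    rintro u v hv K hK hc k
    obtain ⟨N, hN⟩ := u.2.2.uniform hK hc k
    obtain ⟨M, hM⟩ := IsNegligible.uniform hv hK hc k
    refine ⟨N + M, fun q hq χ hχ => ?_⟩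
    exact (DerivBound.mul hΩ.out hK u.2.1 v.2.1 (hN χ (mollifiers_anti (by omega) hχ))
      (hM q (by omega) χ hχ)).mono (by push_cast; omega)

/-- The Colombeau algebra `G(Ω) = E_M[Ω] / N[Ω]`. -/
def GenFun : Type := moderate Ω ⧸ negligible Ω

instance : CommRing (GenFun Ω) := inferInstanceAs (CommRing (moderate Ω ⧸ negligible Ω))

/-- The generalized function with a given representative. -/
def toGenFun : moderate Ω →+* GenFun Ω := Ideal.Quotient.mk (negligible Ω)

variable {Ω}

/-- Differentiation of moderate families in the direction `e`. -/
def moderateDeriv (e : V) (u : moderate Ω) : moderate Ω :=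
  ⟨fun χ x => fderivWithin ℝ (u.1 χ) Ω x e,
    fun χ => ((u.2.1 χ).fderivWithin hΩ.out (by simp)).clm_apply contDiffOn_const,
    fun K hK hc k => by
      obtain ⟨N, hN⟩ := u.2.2 K hK hc (k + 1)
      exact ⟨N, fun χ hχ => (hN χ hχ).deriv hΩ.out hK u.2.1 e⟩⟩

/-- The derivative of a generalized function in the direction `e`. -/
def GenFun.deriv (e : V) : GenFun Ω → GenFun Ω :=
  Quotient.map' (moderateDeriv e) fun u v huv => by
    rw [Submodule.quotientRel_def] at huv ⊢
    intro K hK hc k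
    obtain ⟨N, hN⟩ := huv K hK hc (k + 1)
    refine ⟨N, fun q hq χ hχ => ?_⟩
    have h := (hN q hq χ hχ).deriv hΩ.out hK (u - v).2.1 e
    refine h.congr hK fun ψ x hx => ?_
    change fderivWithin ℝ (u.1 ψ - v.1 ψ) Ω x e
      = fderivWithin ℝ (u.1 ψ) Ω x e - fderivWithin ℝ (v.1 ψ) Ω x e
    rw [fderivWithin_sub (hΩ.out x hx)
      ((u.2.1 ψ).differentiableOn (by simp) x hx) ((v.2.1 ψ).differentiableOn (by simp) x hx)]
    rfl

theorem GenFun.deriv_mk (e : V) (u : moderate Ω) :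
    GenFun.deriv e (toGenFun Ω u) = toGenFun Ω (moderateDeriv e u) := rfl

variable {Ω' : Set W} [hΩ' : Fact (UniqueDiffOn ℝ Ω')]

/-- Pull-back of moderate families along a linear map `g` with `g⁻¹(Ω) = Ω'`. -/
def moderatePullback (g : W →L[ℝ] V) (hg : g ⁻¹' Ω = Ω') : moderate Ω →+* moderate Ω' where
  toFun u := ⟨fun χ x => u.1 χ (g x),
    fun χ => (u.2.1 χ).comp g.contDiff.contDiffOn (fun x hx => by rw [← hg] at hx; exact hx),
    fun K hK hc k => by
      obtain ⟨N, hN⟩ := u.2.2 (g '' K) (by rw [image_subset_iff, hg]; exact hK)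
        (hc.image g.continuous) k
      exact ⟨N, fun χ hχ => (hN χ hχ).pullback hΩ.out hΩ'.out u.2.1 g hg hK⟩⟩
  map_one' := rfl
  map_zero' := rfl
  map_mul' _ _ := rfl
  map_add' _ _ := rfl

/-- Pull-back of generalized functions. -/
def GenFun.pullback (g : W →L[ℝ] V) (hg : g ⁻¹' Ω = Ω') : GenFun Ω →+* GenFun Ω' :=
  Ideal.quotientMap (negligible Ω') (moderatePullback g hg) fun u hu K hK hc k => by
    obtain ⟨N, hN⟩ := hu (g '' K) (by rw [image_subset_iff, hg]; exact hK)
      (hc.image g.continuous) k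
    exact ⟨N, fun q hq χ hχ => (hN q hq χ hχ).pullback hΩ.out hΩ'.out u.2.1 g hg hK⟩

theorem GenFun.pullback_mk (g : W →L[ℝ] V) (hg : g ⁻¹' Ω = Ω') (u : moderate Ω) :
    GenFun.pullback g hg (toGenFun Ω u) = toGenFun Ω' (moderatePullback g hg u) := rfl

/-! ### Order, boundedness and growth -/

/-- `U` is strictly positive: it has a representative that on every compact set is real and
bounded below by a power of `ε`. -/
def GenFun.IsStrictlyPositive (U : GenFun Ω) : Prop :=
  ∃ u : moderate Ω, toGenFun Ω u = U ∧ ∀ K ⊆ Ω, IsCompact K → ∃ N : ℕ,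
    ∀ χ : Mollifier, χ.1 ∈ mollifiers N → ∀ᶠ ε in 𝓝[>] (0 : ℝ), ∀ x ∈ K,
      (u.1 (χ.scale ε) x).im = 0 ∧ ε ^ N ≤ (u.1 (χ.scale ε) x).re

/-- The strict order of generalized functions: `U < U'` if `U' - U` is strictly positive
(in particular invertible). -/
instance : LT (GenFun Ω) := ⟨fun U U' => (U' - U).IsStrictlyPositive⟩

/-- `U` is globally bounded: some representative is bounded on all of `Ω`, for all sufficiently
small `ε`, by a constant that does not depend on the mollifier. -/
def GenFun.IsGloballyBounded (U : GenFun Ω) : Prop :=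
  ∃ u : moderate Ω, toGenFun Ω u = U ∧ ∃ N : ℕ, ∃ c : ℝ, 0 < c ∧
    ∀ χ : Mollifier, χ.1 ∈ mollifiers N → ∀ᶠ ε in 𝓝[>] (0 : ℝ), ∀ x ∈ Ω,
      ‖u.1 (χ.scale ε) x‖ ≤ c

/-- `U` is of locally logarithmic growth. -/
def GenFun.IsLocallyLogGrowth (U : GenFun Ω) : Prop :=
  ∃ u : moderate Ω, toGenFun Ω u = U ∧ ∀ K ⊆ Ω, IsCompact K → ∃ N : ℕ,
    ∀ χ : Mollifier, χ.1 ∈ mollifiers N → ∃ c : ℝ, 0 < c ∧ ∀ᶠ ε in 𝓝[>] (0 : ℝ), ∀ x ∈ K,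
      ‖u.1 (χ.scale ε) x‖ ≤ N * Real.log (c / ε)

end Algebra

/-! ### The half line and the quarter plane -/

/-- The half line `[0, ∞)`. -/
def halfLine : Set ℝ := Ici 0

/-- The quarter plane `[0, ∞) × [0, ∞)`, with points `(x, t)`. -/
def quarterPlane : Set (ℝ × ℝ) := Ici 0 ×ˢ Ici 0

instance : Fact (UniqueDiffOn ℝ halfLine) := ⟨uniqueDiffOn_Ici 0⟩

instance : Fact (UniqueDiffOn ℝ quarterPlane) :=
  ⟨(uniqueDiffOn_Ici 0).prod (uniqueDiffOn_Ici 0)⟩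

/-- `∂_x`. -/
def dx : GenFun quarterPlane → GenFun quarterPlane := GenFun.deriv ((1, 0) : ℝ × ℝ)

/-- `∂_t`. -/
def dt : GenFun quarterPlane → GenFun quarterPlane := GenFun.deriv ((0, 1) : ℝ × ℝ)

/-- The restriction `U(x, 0)`. -/
def atTimeZero : GenFun quarterPlane →+* GenFun halfLine :=
  GenFun.pullback (ContinuousLinearMap.inl ℝ ℝ ℝ) (by ext x; simp [quarterPlane, halfLine])

/-- The restriction `U(0, t)`. -/
def atBoundary : GenFun quarterPlane →+* GenFun halfLine :=
  GenFun.pullback (ContinuousLinearMap.inr ℝ ℝ ℝ) (by ext x; simp [quarterPlane, halfLine])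

/-! ### The mixed problem -/

section Problem

variable {n : ℕ}

/-- `U` solves the mixed problem with coefficients `Λ`, `F`, `A`, initial data `U₀` and
boundary conditions given by `ν`, `H`. The indices `i : Fin n` with `i < r` are those of the
first `r` components. -/
structure IsSolution (r : ℕ) (Λ : Fin n → GenFun quarterPlane)
    (F : Fin n → Fin n → GenFun quarterPlane) (A : Fin n → GenFun quarterPlane)
    (U₀ : Fin n → GenFun halfLine) (ν : Fin n → Fin n → GenFun halfLine)
    (H : Fin n → GenFun halfLine) (U : Fin n → GenFun quarterPlane) : Prop where
  equation : ∀ i, dt (U i) + Λ i * dx (U i) = ∑ k, F i k * U k + A i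
  initial : ∀ i, atTimeZero (U i) = U₀ i
  boundary : ∀ i : Fin n, i.val < r →
    atBoundary (U i) = ∑ k with r ≤ k.val, ν i k * atBoundary (U k) + H i

/-- `∂_t^j g (x, 0)` for a function `g` on the quarter plane. -/
def timeDerivAtZero (j : ℕ) (g : ℝ × ℝ → ℂ) (x : ℝ) : ℂ :=
  iteratedDerivWithin j (fun t => g (x, t)) (Ici 0) 0

/-- The functions `x ↦ ∂_t^m u_i (x, 0)`, computed from the initial data and from the time
derivatives of the system
`∂_t u_i = - l_i ∂_x u_i + ∑ k, f_ik u_k + a_i` at `t = 0`. -/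
def formalTimeDeriv (l : Fin n → ℝ × ℝ → ℂ) (f : Fin n → Fin n → ℝ × ℝ → ℂ)
    (a : Fin n → ℝ × ℝ → ℂ) (u₀ : Fin n → ℝ → ℂ) : ℕ → Fin n → ℝ → ℂ
  | 0 => u₀
  | m + 1 => fun i x =>
      ∑ j : Fin (m + 1), (m.choose j : ℂ) *
        (-(timeDerivAtZero j (l i) x *
            derivWithin (formalTimeDeriv l f a u₀ (m - j) i) (Ici 0) x)
          + ∑ k, timeDerivAtZero j (f i k) x * formalTimeDeriv l f a u₀ (m - j) k x)
      + timeDerivAtZero m (a i) x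
  decreasing_by all_goals omega

/-- The classical compatibility conditions of all orders at the corner `(0, 0)`: for every `m`,
the `m`-th time derivatives at the corner given by the system and the initial data satisfy the
`m`-th time derivative of the boundary conditions. -/
def ClassicallyCompatible (r : ℕ) (l : Fin n → ℝ × ℝ → ℂ) (f : Fin n → Fin n → ℝ × ℝ → ℂ)
    (a : Fin n → ℝ × ℝ → ℂ) (u₀ : Fin n → ℝ → ℂ) (v : Fin n → Fin n → ℝ → ℂ)
    (h : Fin n → ℝ → ℂ) : Prop :=
  ∀ m : ℕ, ∀ i : Fin n, i.val < r →
    formalTimeDeriv l f a u₀ m i 0 =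
      ∑ k with r ≤ k.val, ∑ j ∈ Finset.range (m + 1), (m.choose j : ℂ) *
        iteratedDerivWithin j (v i k) (Ici 0) 0 * formalTimeDeriv l f a u₀ (m - j) k 0
      + iteratedDerivWithin m (h i) (Ici 0) 0

/-- The compatibility conditions in the Colombeau algebra: there are representatives, with `Λ`
represented by real-valued functions, that satisfy the classical compatibility conditions. -/
def IsCompatible (r : ℕ) (Λ : Fin n → GenFun quarterPlane)
    (F : Fin n → Fin n → GenFun quarterPlane) (A : Fin n → GenFun quarterPlane)
    (U₀ : Fin n → GenFun halfLine) (ν : Fin n → Fin n → GenFun halfLine)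
    (H : Fin n → GenFun halfLine) : Prop :=
  ∃ (l : Fin n → moderate quarterPlane) (f : Fin n → Fin n → moderate quarterPlane)
    (a : Fin n → moderate quarterPlane) (u₀ : Fin n → moderate halfLine)
    (v : Fin n → Fin n → moderate halfLine) (h : Fin n → moderate halfLine),
    (∀ i, toGenFun _ (l i) = Λ i) ∧ (∀ i k, toGenFun _ (f i k) = F i k) ∧
    (∀ i, toGenFun _ (a i) = A i) ∧ (∀ i, toGenFun _ (u₀ i) = U₀ i) ∧
    (∀ i k, toGenFun _ (v i k) = ν i k) ∧ (∀ i, toGenFun _ (h i) = H i) ∧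
    ∃ N : ℕ, ∀ χ : Mollifier, χ.1 ∈ mollifiers N → ∀ᶠ ε in 𝓝[>] (0 : ℝ),
      (∀ i, ∀ p ∈ quarterPlane, ((l i).1 (χ.scale ε) p).im = 0) ∧
      ClassicallyCompatible r (fun i => (l i).1 (χ.scale ε))
        (fun i k => (f i k).1 (χ.scale ε)) (fun i => (a i).1 (χ.scale ε))
        (fun i => (u₀ i).1 (χ.scale ε)) (fun i k => (v i k).1 (χ.scale ε))
        (fun i => (h i).1 (χ.scale ε))

end Problem

end Colombeau

end

/-!
For `χ` with many vanishing moments and small `ε`, inserting `χ_ε` into the representatives of the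
compatibility assumption gives, on each bounded region, a classical smooth strictly hyperbolic mixed
problem with compatible data. The generalized solution consists of the classical solutions of these
problems, and the theorem rests on two facts: each classical problem has a smooth solution, and the
solution and all its derivatives are bounded by the data up to powers of `ε`.

*The classical problem* (`exists_smooth_solution`). Subtracting the formal Taylor polynomial in `t`
of the solution, which by compatibility satisfies the boundary condition to high order, leaves data
that vanish to high order at `t = 0` and can be extended by zero to `t < 0`. As the speeds do not
vanish, `x` can serve as the evolution variable on a rectangle: the system is integrated along the
characteristics, and a contraction for the time derivative of the solution
(`exists_causal_solution`) gives a solution of class `C¹`. The derivative in `t` solves a system of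
the same kind, if Volterra terms `∑ c_j I^j u` with the primitive `I` in `t` are admitted on the
right-hand side, and therefore the solutions have any finite regularity (`exists_isRectSolution`).
Uniqueness on trapezoids of determinacy makes the solutions of different regularity agree.

*The estimates* (`isControlled_of_system`). The estimate of order zero, `mixed_problem_estimate`,
comes from a maximum principle: at a maximum of `e^{-Bt} |u_i|` the derivative along the backward
characteristic has a sign. Its exponential factor contains only the bounds of the `f_ik` and of the
boundary coefficients, so that logarithmic growth of the `f_ik` costs a power of `ε`. For the
derivatives this does not suffice immediately: the coefficients of the system for `∂_x u` have
logarithmic growth too, but its boundary conditions contain the quotients of the speeds, which are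
not bounded uniformly in `ε`. Instead, the functions `z_i = ∂_x u_i - ∑ f_ij / (l_i - l_j) u_j`
satisfy decoupled scalar transport equations with the coefficients `f_ii - ∂_x l_i`, up to terms
without derivatives of `u` (`transport_diagonalized`). They can be estimated one after the other,
first for the components that leave through `x = 0`, then for those that enter there, whose boundary
values of `∂_x u_i` follow from the equation because `l_i` is invertible. Strict positivity of the
generalized functions makes `1 / l_i` and `1 / (l_i - l_j)` moderate (`exists_inverse`).

The estimates are proved for a general `Scale`, which covers moderate bounds `O(ε^(-N))` and
negligible bounds `O(ε^(q-N))` at the same time: the former show that the family of classical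
solutions is moderate, the latter that the difference of two generalized solutions is negligible.
The classical solutions are only available on bounded regions and for small `ε`, depending on `χ`.
They are glued to one family (`exists_glued_family`) by choosing for each mollifier the largest
admissible box, up to a bound which is read off from the supremum of the mollifier. Equations
between glued families hold up to families that vanish on each compact set for small `ε` (`IsNull`).
-/

namespace Colombeau

/-! ### The maximum principle for transport systems -/

/-- A system of functions on a compact set of points `(x, t)` is bounded by `2 D e^{Bt}` if at each
point each component is either controlled by half of the other components, or is differentiable
along a backward direction `(-c, -1)` that stays in the set, with derivative at most
`L M + D e^{Bt}` where `M` bounds all components at that point.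
The reason is that `e^{-Bt} |v_i|` cannot have its maximum at a point of the second kind, unless
it is small there. -/
theorem maximum_principle {ι : Type*} [Finite ι] {K : Set (ℝ × ℝ)} (hK : IsCompact K)
    {v : ι → ℝ × ℝ → ℂ} (hv : ∀ i, ContinuousOn (v i) K) {L D B : ℝ} (hB : L + 1 ≤ B)
    (h : ∀ i, ∀ p ∈ K,
      (∀ M, (∀ k, ‖v k p‖ ≤ M) → ‖v i p‖ ≤ M / 2 + D * Real.exp (B * p.2)) ∨
      ∃ (c δ : ℝ) (d : ℂ), 0 < δ ∧ (∀ s ∈ Icc (0 : ℝ) δ, (p.1 - c * s, p.2 - s) ∈ K) ∧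
        HasDerivWithinAt (fun s : ℝ => v i (p.1 - c * s, p.2 - s)) (-d) (Icc 0 δ) 0 ∧
        ∀ M, (∀ k, ‖v k p‖ ≤ M) → ‖d‖ ≤ L * M + D * Real.exp (B * p.2)) :
    ∀ i, ∀ p ∈ K, ‖v i p‖ ≤ 2 * D * Real.exp (B * p.2) := by
  intro i₁ p₁ hp₁
  have hmax : ∀ i, ∃ q ∈ K, ∀ p ∈ K,
      Real.exp (-(B * p.2)) * ‖v i p‖ ≤ Real.exp (-(B * q.2)) * ‖v i q‖ := fun i => by
    obtain ⟨q, hq, hq'⟩ := hK.exists_isMaxOn (f := fun p : ℝ × ℝ =>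
      Real.exp (-(B * p.2)) * ‖v i p‖) ⟨p₁, hp₁⟩
      ((Continuous.continuousOn (by fun_prop)).mul (hv i).norm)
    exact ⟨q, hq, fun p hp => hq' hp⟩
  choose q hq hq' using hmax
  have : Nonempty ι := ⟨i₁⟩
  obtain ⟨i, hi⟩ := Finite.exists_max fun i => Real.exp (-(B * (q i).2)) * ‖v i (q i)‖
  have hall : ∀ k, ∀ p ∈ K, Real.exp (-(B * p.2)) * ‖v k p‖
      ≤ Real.exp (-(B * (q i).2)) * ‖v i (q i)‖ := fun k p hp => (hq' k p hp).trans (hi k)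
  set p := q i with hpdef
  have hp : p ∈ K := hq i
  have hM : ∀ k, ‖v k p‖ ≤ ‖v i p‖ := fun k =>
    le_of_mul_le_mul_left (hall k p hp) (Real.exp_pos _)
  have hkey : ‖v i p‖ ≤ 2 * D * Real.exp (B * p.2) := by
    rcases h i p hp with h1 | ⟨c, δ, d, hδ, hs, hd, hdM⟩
    · linarith [h1 _ hM]
    · have hdM := hdM _ hM
      have h0 : (0 : ℝ) ∈ Icc 0 δ := ⟨le_rfl, hδ.le⟩
      set g : ℝ → ℝ := fun s => Real.exp (-(2 * B * (p.2 - s))) *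
        ‖v i (p.1 - c * s, p.2 - s)‖ ^ 2 with hg
      have hgmax : IsMaxOn g (Icc 0 δ) 0 := by
        intro s hsm
        have h1 := hall i _ (hs s hsm)
        have h2 := pow_le_pow_left₀ (by positivity) h1 2
        simp only [mul_pow, ← Real.exp_nat_mul] at h2
        simp only [hg, mem_ofPred_eq, sub_zero, mul_zero]
        convert h2 using 3
        · push_cast; ring_nf
        · push_cast; ring_nf
      have hgd : HasDerivWithinAt g
          (2 * B * Real.exp (-(2 * B * p.2)) * ‖v i p‖ ^ 2
            + Real.exp (-(2 * B * p.2)) * (2 * inner ℝ (v i p) (-d))) (Icc 0 δ) 0 := by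
        have e1 : HasDerivWithinAt (fun s : ℝ => Real.exp (-(2 * B * (p.2 - s))))
            (Real.exp (-(2 * B * (p.2 - 0))) * -(2 * B * (0 - 1))) (Icc 0 δ) 0 :=
          ((((hasDerivAt_const (0 : ℝ) p.2).sub (hasDerivAt_id (0 : ℝ))).const_mul
            (2 * B)).neg.exp).hasDerivWithinAt
        have e2 := hd.norm_sq
        refine (e1.mul e2).congr_deriv ?_
        simp only [sub_zero, mul_zero]
        ring
      have hle := (hgmax.localize).hasFDerivWithinAt_nonpos hgd.hasFDerivWithinAt
        (y := δ) (mem_posTangentConeAt_of_segment_subset (by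
          rw [zero_add, segment_eq_Icc hδ.le]))
      change δ * _ ≤ 0 at hle
      have hin : inner ℝ (v i p) (-d) ≥ -(‖v i p‖ * ‖d‖) := by
        rw [inner_neg_right]
        exact neg_le_neg (real_inner_le_norm _ _)
      have hE := Real.exp_pos (-(2 * B * p.2))
      have hle2 : B * ‖v i p‖ ^ 2 ≤ ‖v i p‖ * ‖d‖ := by
        have h3 : 2 * B * Real.exp (-(2 * B * p.2)) * ‖v i p‖ ^ 2
            + Real.exp (-(2 * B * p.2)) * (2 * inner ℝ (v i p) (-d)) ≤ 0 := by
          by_contra hcon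
          push Not at hcon
          exact absurd hle (not_le.2 (mul_pos hδ hcon))
        have h4 : Real.exp (-(2 * B * p.2)) *
            (2 * (B * ‖v i p‖ ^ 2 + inner ℝ (v i p) (-d))) ≤ 0 := by linarith
        have h5 := nonpos_of_mul_nonpos_right h4 hE
        linarith
      have hE2 := Real.exp_pos (B * p.2)
      rcases (norm_nonneg (v i p)).eq_or_lt with h6 | h6
      · rw [← h6] at hdM ⊢
        have := (norm_nonneg d).trans hdM
        linarith
      · have h7 : B * ‖v i p‖ ≤ ‖d‖ := by
          refine le_of_mul_le_mul_left ?_ h6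
          linarith [hle2, show B * ‖v i p‖ ^ 2 = ‖v i p‖ * (B * ‖v i p‖) by ring]
        have h8 : ‖v i p‖ ≤ D * Real.exp (B * p.2) := by nlinarith
        linarith
  have h1 := (hall i₁ p₁ hp₁).trans (mul_le_mul_of_nonneg_left hkey (Real.exp_pos _).le)
  rw [Real.exp_neg, Real.exp_neg, mul_comm (2 * D), inv_mul_cancel_left₀ (Real.exp_pos _).ne',
    inv_mul_le_iff₀ (Real.exp_pos _), mul_comm] at h1
  exact h1

/-- The points `(x, t)` with `0 ≤ t ≤ T` and `0 ≤ x ≤ R + c (T - t)`. A curve that enters this set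
backwards in time with speed at most `c` leaves it only through `x = 0` or `t = 0`. -/
def trapezoid (R c T : ℝ) : Set (ℝ × ℝ) :=
  {p | 0 ≤ p.1 ∧ 0 ≤ p.2 ∧ p.2 ≤ T ∧ p.1 ≤ R + c * (T - p.2)}

theorem trapezoid_subset (R c T : ℝ) : trapezoid R c T ⊆ quarterPlane :=
  fun _ hp => ⟨hp.1, hp.2.1⟩

theorem isCompact_trapezoid {R c T : ℝ} (hc : 0 ≤ c) : IsCompact (trapezoid R c T) := by
  refine IsCompact.of_isClosed_subset (isCompact_Icc (a := ((0 : ℝ), (0 : ℝ)))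
    (b := (R + c * T, T))) ?_ fun p hp => ⟨⟨hp.1, hp.2.1⟩, ⟨hp.2.2.2.trans ?_, hp.2.2.1⟩⟩
  · have : trapezoid R c T = {p | 0 ≤ p.1} ∩ ({p | 0 ≤ p.2} ∩ ({p | p.2 ≤ T}
        ∩ {p | p.1 ≤ R + c * (T - p.2)})) := rfl
    rw [this]
    exact (isClosed_le (by fun_prop) (by fun_prop)).inter
      ((isClosed_le (by fun_prop) (by fun_prop)).inter
      ((isClosed_le (by fun_prop) (by fun_prop)).inter
      (isClosed_le (by fun_prop) (by fun_prop))))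
  · have := mul_nonneg hc hp.2.1
    linarith [mul_sub c T p.2]

theorem box_subset_trapezoid {R c T : ℝ} (hc : 0 ≤ c) :
    Icc 0 R ×ˢ Icc 0 T ⊆ trapezoid R c T := by
  rintro ⟨x, t⟩ ⟨⟨h1, h2⟩, h3, h4⟩
  exact ⟨h1, h3, h4, by nlinarith [mul_nonneg hc (sub_nonneg.2 h4)]⟩

/-- The a priori estimate for the mixed problem on a trapezoid. The components with `pos i` are
prescribed at `x = 0`, the others have nonpositive speed there. The bound `L` for the coefficients
of the system enters the exponent linearly, with a factor that depends only on the bound `N` for the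
boundary coefficients and on `T`. So a logarithmic growth of `L` causes a power growth of `u`. -/
theorem mixed_problem_estimate {ι : Type*} [Finite ι] {pos : ι → Prop} {R c T L N D : ℝ}
    (hc : 0 ≤ c) (hL : 0 ≤ L) (hN : 1 ≤ N) (hD : 0 ≤ D) {u : ι → ℝ × ℝ → ℂ}
    {u' : ι → ℝ × ℝ → ℝ × ℝ →L[ℝ] ℂ} {l : ι → ℝ × ℝ → ℝ}
    (hu : ∀ i, ∀ p ∈ trapezoid R c T, HasFDerivWithinAt (u i) (u' i p) (trapezoid R c T) p)
    (hl : ∀ i, ∀ p ∈ trapezoid R c T, |l i p| ≤ c)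
    (hneg : ∀ i, ¬ pos i → ∀ p ∈ trapezoid R c T, p.1 = 0 → l i p ≤ 0)
    (heq : ∀ i, ∀ p ∈ trapezoid R c T, ∀ M, (∀ k, ‖u k p‖ ≤ M) →
      ‖u' i p (l i p, 1)‖ ≤ L * M + D)
    (hinit : ∀ i, ∀ p ∈ trapezoid R c T, p.2 = 0 → ‖u i p‖ ≤ D)
    (hbd : ∀ i, pos i → ∀ p ∈ trapezoid R c T, p.1 = 0 → ∀ M, 0 ≤ M →
      (∀ k, ¬ pos k → ‖u k p‖ ≤ M) → ‖u i p‖ ≤ N * M + D) :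
    ∀ i, ∀ p ∈ trapezoid R c T, ‖u i p‖ ≤ 4 * N * D * Real.exp ((2 * N * L + 1) * T) := by
  classical
  -- Dividing the components prescribed at the boundary by `2 N` makes the boundary map small.
  set w : ι → ℝ := fun i => if pos i then (2 * N)⁻¹ else 1 with hw
  have hw0 : ∀ i, 0 < w i := fun i => by
    simp only [hw]; split_ifs <;> positivity
  have hw1 : ∀ i, w i ≤ 1 := fun i => by
    simp only [hw]; split_ifs
    · exact inv_le_one_of_one_le₀ (by linarith)
    · exact le_rfl
  have hw2 : ∀ i, 1 ≤ 2 * N * w i := fun i => by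
    simp only [hw]; split_ifs
    · rw [mul_inv_cancel₀ (by positivity)]
    · linarith
  have hn : ∀ i p, ‖(w i : ℂ) * u i p‖ = w i * ‖u i p‖ := fun i p => by
    rw [norm_mul, Complex.norm_real, Real.norm_of_nonneg (hw0 i).le]
  have hback : ∀ k p M, ‖(w k : ℂ) * u k p‖ ≤ M → ‖u k p‖ ≤ 2 * N * M := fun k p M h => by
    rw [hn] at h
    calc ‖u k p‖ ≤ 2 * N * w k * ‖u k p‖ := le_mul_of_one_le_left (norm_nonneg _) (hw2 k)
      _ = 2 * N * (w k * ‖u k p‖) := by ring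
      _ ≤ 2 * N * M := by gcongr
  have hexp : ∀ p ∈ trapezoid R c T, 1 ≤ Real.exp ((2 * N * L + 1) * p.2) := fun p hp =>
    Real.one_le_exp (mul_nonneg (by positivity) hp.2.1)
  have main := maximum_principle (isCompact_trapezoid (R := R) (T := T) hc)
    (v := fun i p => (w i : ℂ) * u i p)
    (fun i => continuousOn_const.mul fun p hp => (hu i p hp).continuousWithinAt)
    (L := 2 * N * L) (D := D) (B := 2 * N * L + 1) le_rfl (fun i p hp => by
      have hDe : D ≤ D * Real.exp ((2 * N * L + 1) * p.2) :=
        le_mul_of_one_le_right hD (hexp p hp)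
      have hd0 : ∀ M, (∀ k, ‖(w k : ℂ) * u k p‖ ≤ M) → 0 ≤ M := fun M hM =>
        (norm_nonneg _).trans (hM i)
      by_cases ht : p.2 = 0
      · left
        intro M hM
        rw [hn]
        have := hinit i p hp ht
        have h2 : w i * ‖u i p‖ ≤ 1 * D :=
          mul_le_mul (hw1 i) this (norm_nonneg _) zero_le_one
        linarith [hd0 M hM]
      by_cases hx : p.1 = 0 ∧ pos i
      · left
        intro M hM
        have h1 := hbd i hx.2 p hp hx.1 M (hd0 M hM) fun k hk => by
          have := hM k
          simpa [hw, hk] using this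
        rw [hn]
        have h3 : w i = (2 * N)⁻¹ := by simp [hw, hx.2]
        rw [h3, inv_mul_le_iff₀ (by positivity)]
        have : D ≤ 2 * N * (D * Real.exp ((2 * N * L + 1) * p.2)) := by nlinarith
        linarith [show 2 * N * (M / 2 + D * Real.exp ((2 * N * L + 1) * p.2))
          = N * M + 2 * N * (D * Real.exp ((2 * N * L + 1) * p.2)) by ring]
      -- At the other points the backward characteristic stays in the trapezoid for a while: its
      -- speed is at most `c`, and at `x = 0` it points into the quarter plane.
      right
      have ht' : 0 < p.2 := lt_of_le_of_ne hp.2.1 (Ne.symm ht)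
      have hin : ∃ δ > 0, δ ≤ p.2 ∧ ∀ s ∈ Icc 0 δ, 0 ≤ p.1 - l i p * s := by
        rcases hp.1.eq_or_lt with h0 | h0
        · refine ⟨p.2, ht', le_rfl, fun s hs => ?_⟩
          have h1 : ¬ pos i := fun h => hx ⟨h0.symm, h⟩
          have h2 := hneg i h1 p hp h0.symm
          rw [← h0]
          nlinarith [hs.1]
        · refine ⟨min p.2 (p.1 / (c + 1)), lt_min ht' (by positivity), min_le_left _ _,
            fun s hs => ?_⟩
          have h1 : s ≤ p.1 / (c + 1) := hs.2.trans (min_le_right _ _)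
          rw [le_div_iff₀ (by positivity)] at h1
          have h2 := (abs_le.1 (hl i p hp)).2
          nlinarith [hs.1]
      obtain ⟨δ, hδ, hδp, hδx⟩ := hin
      have hmem : ∀ s ∈ Icc (0 : ℝ) δ, (p.1 - l i p * s, p.2 - s) ∈ trapezoid R c T := by
        intro s hs
        refine ⟨hδx s hs, by simp only; linarith [hs.2], by simp only; linarith [hs.1, hp.2.2.1],
          ?_⟩
        have h2 := (abs_le.1 (hl i p hp)).1
        have h3 := hp.2.2.2
        simp only
        nlinarith [hs.1]
      refine ⟨l i p, δ, (w i : ℂ) * u' i p (l i p, 1), hδ, hmem, ?_, fun M hM => ?_⟩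
      · have hcurve : HasDerivWithinAt (fun s : ℝ => (p.1 - l i p * s, p.2 - s))
            (-(l i p, (1 : ℝ))) (Icc 0 δ) 0 := by
          have h1 : HasDerivAt (fun s : ℝ => p.1 - l i p * s) (-(l i p)) 0 := by
            simpa using ((hasDerivAt_id (0 : ℝ)).const_mul (l i p)).const_sub p.1
          have h2 : HasDerivAt (fun s : ℝ => p.2 - s) (-1) 0 := by
            simpa using (hasDerivAt_id (0 : ℝ)).const_sub p.2
          exact (h1.prodMk h2).hasDerivWithinAt
        have h3 : HasFDerivWithinAt (u i) (u' i p) (trapezoid R c T)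
            ((fun s : ℝ => (p.1 - l i p * s, p.2 - s)) 0) := by simpa using hu i p hp
        have h4 : HasFDerivWithinAt (u i) (u' i p) (trapezoid R c T)
            (p.1 - l i p * 0, p.2 - 0) := by simpa using hu i p hp
        have h5 := h4.comp_hasDerivWithinAt (0 : ℝ) hcurve hmem
        have h6 := h5.const_mul (w i : ℂ)
        rw [map_neg, mul_neg] at h6
        exact h6
      · have h1 := heq i p hp (2 * N * M) fun k => hback k p M (hM k)
        rw [norm_mul, Complex.norm_real, Real.norm_of_nonneg (hw0 i).le]
        calc w i * ‖u' i p (l i p, 1)‖ ≤ 1 * ‖u' i p (l i p, 1)‖ := by gcongr; exact hw1 i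
          _ ≤ L * (2 * N * M) + D := by rw [one_mul]; exact h1
          _ ≤ 2 * N * L * M + D * Real.exp ((2 * N * L + 1) * p.2) := by linarith)
  intro i p hp
  have h1 := hback i p _ (main i p hp)
  have h2 : Real.exp ((2 * N * L + 1) * p.2) ≤ Real.exp ((2 * N * L + 1) * T) := by
    have := hp.2.2.1
    gcongr
  calc ‖u i p‖ ≤ 2 * N * (2 * D * Real.exp ((2 * N * L + 1) * p.2)) := h1
    _ ≤ 2 * N * (2 * D * Real.exp ((2 * N * L + 1) * T)) := by gcongr
    _ = _ := by ring

/-! ### The flow of a time-dependent scalar field -/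

/-- Differentiation under the integral sign, for continuous derivatives. -/
theorem hasDerivAt_intervalIntegral {E : Type*} [NormedAddCommGroup E] [NormedSpace ℝ E]
    {f f' : ℝ → ℝ → E} (hf : Continuous fun p : ℝ × ℝ => f p.1 p.2)
    (hf' : Continuous fun p : ℝ × ℝ => f' p.1 p.2)
    (h : ∀ s z, HasDerivAt (fun s => f s z) (f' s z) s) (a b s : ℝ) :
    HasDerivAt (fun s => ∫ z in a..b, f s z) (∫ z in a..b, f' s z) s := by
  have hc : IsCompact (Icc (s - 1) (s + 1) ×ˢ uIcc a b) := isCompact_Icc.prod isCompact_uIcc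
  obtain ⟨C, hC⟩ := hc.exists_bound_of_continuousOn hf'.continuousOn
  refine (intervalIntegral.hasDerivAt_integral_of_dominated_loc_of_deriv_le
    (bound := fun _ => C) (Icc_mem_nhds (by linarith : s - 1 < s) (by linarith : s < s + 1))
    ?_ ?_ ?_ ?_ ?_ ?_).2
  · exact Eventually.of_forall fun x => (Continuous.aestronglyMeasurable (by fun_prop))
  · exact Continuous.intervalIntegrable (by fun_prop) _ _
  · exact Continuous.aestronglyMeasurable (by fun_prop)
  · exact Eventually.of_forall fun z hz x hx => hC (x, z) ⟨hx, uIoc_subset_uIcc hz⟩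
  · exact intervalIntegrable_const
  · exact Eventually.of_forall fun z _ x _ => h x z

/-- The nearest point of `[0, X]`. -/
noncomputable def clamp (X z : ℝ) : ℝ := max 0 (min z X)

theorem continuous_clamp (X : ℝ) : Continuous (clamp X) := by
  unfold clamp; fun_prop

theorem clamp_mem {X : ℝ} (hX : 0 ≤ X) (z : ℝ) : clamp X z ∈ Icc 0 X :=
  ⟨le_max_left _ _, max_le hX (min_le_right _ _)⟩

theorem clamp_eq {X z : ℝ} (hz : z ∈ Icc 0 X) : clamp X z = z := by
  rw [clamp, min_eq_left hz.2, max_eq_right hz.1]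

/-- A smooth flow box over `[0, X]` for the field `μ`: `Φ (z, s)` is the value at `z` of the
integral curve of `dτ/dz = μ (z, τ)` with `τ(0) = s`, `J` is its derivative in `s`, and `σ (z, ·)`
is the inverse of `Φ (z, ·)`. Outside `[0, X]` the first argument is replaced by the nearest point
of `[0, X]`. -/
structure Flow (X : ℝ) (μ : ℝ × ℝ → ℝ) where
  Φ : ℝ × ℝ → ℝ
  J : ℝ × ℝ → ℝ
  σ : ℝ × ℝ → ℝ
  /-- A bound for the derivatives of `Φ` and `σ`. -/
  C : ℝ
  continuous_Φ : Continuous Φ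
  continuous_J : Continuous J
  continuous_σ : Continuous σ
  Φ_clamp : ∀ z s, Φ (clamp X z, s) = Φ (z, s)
  Φ_zero : ∀ s, Φ (0, s) = s
  hasDeriv_Φ : ∀ z ∈ Icc 0 X, ∀ s,
    HasDerivWithinAt (fun y => Φ (y, s)) (μ (z, Φ (z, s))) (Icc 0 X) z
  hasDeriv_Φ_J : ∀ z s, HasDerivAt (fun s => Φ (z, s)) (J (z, s)) s
  J_pos : ∀ p, 0 < J p
  J_le : ∀ p, J p ≤ C
  J_inv_le : ∀ p, (J p)⁻¹ ≤ C
  Φ_σ : ∀ z t, Φ (z, σ (z, t)) = t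
  σ_Φ : ∀ z s, σ (z, Φ (z, s)) = s

theorem sub_eq_integral_deriv {f f' : ℝ → ℝ} (hf' : Continuous f')
    (h : ∀ t, HasDerivAt f (f' t) t) (a b : ℝ) :
    f b - f a = (b - a) * ∫ θ in (0 : ℝ)..1, f' (a + θ * (b - a)) := by
  have h1 : ∀ θ : ℝ, HasDerivAt (fun θ : ℝ => f (a + θ * (b - a)))
      (f' (a + θ * (b - a)) * (b - a)) θ := fun θ =>
    (h _).comp θ (by simpa using ((hasDerivAt_id θ).mul_const (b - a)).const_add a)
  have h2 := intervalIntegral.integral_eq_sub_of_hasDerivAt (a := 0) (b := 1)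
    (fun θ _ => h1 θ) (Continuous.intervalIntegrable (by fun_prop) _ _)
  rw [intervalIntegral.integral_mul_const] at h2
  rw [mul_comm, h2]
  simp

theorem exists_flow {X M K : ℝ} (hX : 0 < X) {μ μ' : ℝ × ℝ → ℝ} (hμ : Continuous μ)
    (hμ' : Continuous μ') (hM : ∀ p, |μ p| ≤ M) (hK : ∀ p, |μ' p| ≤ K)
    (hd : ∀ x t, HasDerivAt (fun s => μ (x, s)) (μ' (x, t)) t) : Nonempty (Flow X μ) := by
  have hM0 : 0 ≤ M := (abs_nonneg _).trans (hM 0)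
  have hK0 : 0 ≤ K := (abs_nonneg _).trans (hK 0)
  have hlip : ∀ x, LipschitzWith K.toNNReal fun s => μ (x, s) := fun x => by
    refine lipschitzWith_of_nnnorm_deriv_le (fun t => (hd x t).differentiableAt) fun t => ?_
    rw [(hd x t).deriv, ← NNReal.coe_le_coe, coe_nnnorm, Real.coe_toNNReal _ hK0]
    exact hK _
  have hsol : ∀ s : ℝ, ∃ γ : ℝ → ℝ, γ 0 = s ∧
      ∀ z ∈ Icc 0 X, HasDerivWithinAt γ (μ (z, γ z)) (Icc 0 X) z := fun s => by
    have hpl : IsPicardLindelof (fun z τ => μ (z, τ)) (tmin := 0) (tmax := X) ⟨0, le_rfl, hX.le⟩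
        s (M.toNNReal * X.toNNReal) 0 M.toNNReal K.toNNReal := by
      refine ⟨fun t _ => (hlip t).lipschitzOnWith, fun x _ => Continuous.continuousOn
        (by fun_prop), fun t _ x _ => ?_, ?_⟩
      · rw [Real.coe_toNNReal _ hM0]; exact hM _
      · simp [Real.coe_toNNReal _ hX.le, hX.le]
    exact hpl.exists_eq_forall_mem_Icc_hasDerivWithinAt₀
  choose γ hγ0 hγ using hsol
  set Φ : ℝ × ℝ → ℝ := fun p => γ p.2 (clamp X p.1) with hΦ
  have hcl := clamp_mem hX.le
  have hΦz : ∀ s, Continuous fun z => Φ (z, s) := fun s =>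
    ContinuousOn.comp_continuous (fun z hz => (hγ s z hz).continuousWithinAt)
      (continuous_clamp X) hcl
  have hΦd : ∀ z ∈ Icc 0 X, ∀ s,
      HasDerivWithinAt (fun y => Φ (y, s)) (μ (z, Φ (z, s))) (Icc 0 X) z := fun z hz s => by
    have h1 := hγ s z hz
    have h2 : μ (z, γ s z) = μ (z, Φ (z, s)) := by simp only [hΦ, clamp_eq hz]
    rw [h2] at h1
    exact h1.congr (fun y hy => by simp only [hΦ, clamp_eq hy]) (by simp only [hΦ, clamp_eq hz])
  have hΦ0 : ∀ s, Φ (0, s) = s := fun s => by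
    simp only [hΦ, clamp_eq (show (0 : ℝ) ∈ Icc 0 X from ⟨le_rfl, hX.le⟩), hγ0]
  have hΦcl : ∀ z s, Φ (clamp X z, s) = Φ (z, s) := fun z s => by simp only [hΦ, clamp_eq (hcl z)]
  clear_value Φ
  -- The divided difference of `Φ` in `s` is an exponential.
  set q : ℝ → ℝ → ℝ → ℝ := fun z s s' =>
    ∫ θ in (0 : ℝ)..1, μ' (z, Φ (z, s) + θ * (Φ (z, s') - Φ (z, s))) with hq
  have hqK : ∀ z s s', |q z s s'| ≤ K := fun z s s' => by
    have := intervalIntegral.norm_integral_le_of_norm_le_const (a := 0) (b := 1)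
      (f := fun θ => μ' (z, Φ (z, s) + θ * (Φ (z, s') - Φ (z, s)))) (C := K) fun θ _ => hK _
    simpa using this
  set Q : ℝ → ℝ → ℝ → ℝ := fun z s s' => ∫ y in (0 : ℝ)..clamp X z, q y s s' with hQ
  have hQK : ∀ z s s', |Q z s s'| ≤ K * X := fun z s s' => by
    have := intervalIntegral.norm_integral_le_of_norm_le_const (a := 0) (b := clamp X z)
      (f := fun y => q y s s') (C := K) fun y _ => hqK _ _ _
    rw [sub_zero, abs_of_nonneg (hcl z).1] at this
    exact this.trans (by gcongr; exact (hcl z).2)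
  have hslope : ∀ z s s', Φ (z, s') - Φ (z, s) = (s' - s) * Real.exp (Q z s s') := by
    intro z s s'
    have hqc : Continuous fun z => q z s s' := by
      have h1 := (hΦz s).comp (continuous_fst : Continuous fun p : ℝ × ℝ => p.1)
      have h2 := (hΦz s').comp (continuous_fst : Continuous fun p : ℝ × ℝ => p.1)
      exact intervalIntegral.continuous_parametric_intervalIntegral_of_continuous'
        (f := fun z θ => μ' (z, Φ (z, s) + θ * (Φ (z, s') - Φ (z, s))))
        (hμ'.comp (continuous_fst.prodMk (h1.add (continuous_snd.mul (h2.sub h1))))) 0 1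
    have hder : ∀ y ∈ Icc 0 X, HasDerivWithinAt
        (fun y => (Φ (y, s') - Φ (y, s)) * Real.exp (-∫ w in (0 : ℝ)..y, q w s s')) 0
        (Icc 0 X) y := fun y hy => by
      have e1 := (hΦd y hy s').sub (hΦd y hy s)
      have e2 : HasDerivAt (fun y => ∫ w in (0 : ℝ)..y, q w s s') (q y s s') y :=
        hqc.integral_hasStrictDerivAt 0 y |>.hasDerivAt
      have e3 := e1.mul e2.neg.exp.hasDerivWithinAt
      refine e3.congr_deriv ?_
      have e4 := sub_eq_integral_deriv (f := fun t => μ (y, t)) (f' := fun t => μ' (y, t))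
        (by fun_prop) (hd y) (Φ (y, s)) (Φ (y, s'))
      rw [e4]
      simp only [Pi.sub_apply, Pi.neg_apply, hq]
      ring
    have hconst := constant_of_derivWithin_zero
      (fun y hy => (hder y hy).differentiableWithinAt)
      (fun y hy => (hder y (Ico_subset_Icc_self hy)).derivWithin
        (uniqueDiffOn_Icc hX y (Ico_subset_Icc_self hy))) (clamp X z) (hcl z)
    simp only [hΦ0, intervalIntegral.integral_same, neg_zero, Real.exp_zero, mul_one] at hconst
    rw [Real.exp_neg, ← div_eq_mul_inv, div_eq_iff (Real.exp_pos _).ne'] at hconst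
    rw [hΦcl, hΦcl] at hconst
    exact hconst
  have hexp1 : ∀ z s s', Real.exp (Q z s s') ≤ Real.exp (K * X) := fun z s s' =>
    Real.exp_le_exp.2 (abs_le.1 (hQK z s s')).2
  have hexp2 : ∀ z s s', Real.exp (-(K * X)) ≤ Real.exp (Q z s s') := fun z s s' =>
    Real.exp_le_exp.2 (abs_le.1 (hQK z s s')).1
  have hΦc : Continuous Φ := by
    refine continuous_prod_of_continuous_lipschitzWith' Φ (Real.exp (K * X)).toNNReal
      (fun z => LipschitzWith.of_dist_le_mul fun s s' => ?_) hΦz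
    rw [Real.coe_toNNReal _ (Real.exp_pos _).le, Real.dist_eq, Real.dist_eq, hslope z s' s,
      abs_mul, abs_of_pos (Real.exp_pos _), mul_comm]
    exact mul_le_mul_of_nonneg_right (hexp1 _ _ _) (abs_nonneg _)
  have hqc : Continuous fun p : ℝ × ℝ × ℝ => q p.1 p.2.1 p.2.2 := by
    simp only [hq]; fun_prop
  have hQc : Continuous fun p : ℝ × ℝ × ℝ => Q p.1 p.2.1 p.2.2 := by
    simp only [hQ]
    refine intervalIntegral.continuous_parametric_intervalIntegral_of_continuous
      (f := fun (p : ℝ × ℝ × ℝ) y => q y p.2.1 p.2.2) ?_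
      ((continuous_clamp X).comp continuous_fst)
    exact hqc.comp (by fun_prop : Continuous fun r : (ℝ × ℝ × ℝ) × ℝ => (r.2, r.1.2.1, r.1.2.2))
  have hmono : ∀ z, StrictMono fun s => Φ (z, s) := fun z s s' hs => by
    have := hslope z s s'
    have h2 : 0 < (s' - s) * Real.exp (Q z s s') := mul_pos (sub_pos.2 hs) (Real.exp_pos _)
    simp only
    linarith
  have hsurj : ∀ z, Function.Surjective fun s => Φ (z, s) := fun z => by
    have hz : ∀ s, Φ (z, s) = Φ (z, 0) + s * Real.exp (Q z 0 s) := fun s => by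
      have := hslope z 0 s
      rw [sub_zero] at this
      linarith
    refine Continuous.surjective (by fun_prop) ?_ ?_
    · refine tendsto_atTop_mono' _ (f₁ := fun s => Φ (z, 0) + s * Real.exp (-(K * X))) ?_
        (tendsto_atTop_add_const_left _ _ (tendsto_id.atTop_mul_const (Real.exp_pos _)))
      filter_upwards [eventually_ge_atTop 0] with s hs
      rw [hz s]
      have := hexp2 z 0 s
      gcongr
    · refine tendsto_atBot_mono' _ ?_ (f₁ := fun s => Φ (z, 0) + s * Real.exp (-(K * X)))
        (tendsto_atBot_add_const_left _ _ (tendsto_id.atBot_mul_const (Real.exp_pos _)))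
      filter_upwards [eventually_le_atBot 0] with s hs
      rw [hz s]
      have := mul_le_mul_of_nonpos_left (hexp2 z 0 s) hs
      linarith
  choose σ' hσ' using hsurj
  set σ : ℝ × ℝ → ℝ := fun p => σ' p.1 p.2 with hσ
  have hΦσ : ∀ z t, Φ (z, σ (z, t)) = t := fun z t => hσ' z t
  have hσc : Continuous σ := by
    refine continuous_iff_continuousAt.2 fun p => ?_
    have h1 : Tendsto (fun p' : ℝ × ℝ => Real.exp (K * X) * |Φ (p'.1, σ p) - p'.2|) (𝓝 p)
        (𝓝 0) := by
      have : Continuous fun p' : ℝ × ℝ => Real.exp (K * X) * |Φ (p'.1, σ p) - p'.2| := by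
        fun_prop
      have h2 := this.tendsto p
      have h3 : Φ (p.1, σ p) = p.2 := hΦσ p.1 p.2
      rwa [h3, sub_self, abs_zero, mul_zero] at h2
    refine tendsto_iff_dist_tendsto_zero.2 (squeeze_zero (fun _ => dist_nonneg) (fun p' => ?_) h1)
    have h2 := hslope p'.1 (σ p) (σ p')
    have h3 : Φ (p'.1, σ p') = p'.2 := hΦσ p'.1 p'.2
    rw [h3] at h2
    have h4 : |Φ (p'.1, σ p) - p'.2| = |σ p' - σ p| * Real.exp (Q p'.1 (σ p) (σ p')) := by
      rw [abs_sub_comm, h2, abs_mul, abs_of_pos (Real.exp_pos _)]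
    rw [h4, Real.dist_eq]
    have h5 := hexp2 p'.1 (σ p) (σ p')
    have h6 : 1 ≤ Real.exp (K * X) * Real.exp (Q p'.1 (σ p) (σ p')) := by
      calc (1 : ℝ) = Real.exp (K * X) * Real.exp (-(K * X)) := by rw [← Real.exp_add]; simp
        _ ≤ _ := by gcongr
    calc |σ p' - σ p| ≤ (Real.exp (K * X) * Real.exp (Q p'.1 (σ p) (σ p'))) * |σ p' - σ p| :=
          le_mul_of_one_le_left (abs_nonneg _) h6
      _ = _ := by ring
  exact ⟨{
    Φ := Φ
    J := fun p => Real.exp (Q p.1 p.2 p.2)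
    σ := σ
    C := Real.exp (K * X)
    continuous_Φ := hΦc
    continuous_J := Real.continuous_exp.comp
      (hQc.comp (by fun_prop : Continuous fun p : ℝ × ℝ => (p.1, p.2, p.2)))
    continuous_σ := hσc
    Φ_clamp := hΦcl
    Φ_zero := hΦ0
    hasDeriv_Φ := hΦd
    hasDeriv_Φ_J := fun z s => by
      rw [hasDerivAt_iff_tendsto_slope]
      have h1 : Continuous fun s' => Real.exp (Q z s s') :=
        Real.continuous_exp.comp
          (hQc.comp (by fun_prop : Continuous fun s' : ℝ => (z, s, s')))
      refine ((h1.tendsto s).mono_left nhdsWithin_le_nhds).congr' ?_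
      filter_upwards [self_mem_nhdsWithin] with s' hs'
      rw [slope_def_field, hslope z s s', mul_div_cancel_left₀ _ (sub_ne_zero.2 hs')]
    J_pos := fun p => Real.exp_pos _
    J_le := fun p => hexp1 _ _ _
    J_inv_le := fun p => by
      rw [← Real.exp_neg]
      exact Real.exp_le_exp.2 (by linarith [(abs_le.1 (hQK p.1 p.2 p.2)).1])
    Φ_σ := hΦσ
    σ_Φ := fun z s => (hmono z).injective (hΦσ z _) }⟩

/-! ### Integration along characteristics -/

theorem hasDerivWithinAt_mul_of_eq_zero {A f : ℝ → ℂ} {f' : ℂ} {s : Set ℝ} {x : ℝ}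
    (hA : ContinuousWithinAt A s x) (hf : HasDerivWithinAt f f' s x) (h0 : f x = 0) :
    HasDerivWithinAt (fun y => A y * f y) (A x * f') s x := by
  rw [hasDerivWithinAt_iff_tendsto_slope] at hf ⊢
  refine ((hA.mono sdiff_subset).tendsto.mul hf).congr' ?_
  filter_upwards with y
  simp only [slope_def_module, h0, mul_zero, sub_zero, Complex.real_smul]
  ring

theorem abs_integral_exp_neg_le {k : ℝ} (hk : 0 < k) (a b : ℝ) :
    |∫ z in a..b, Real.exp (-(k * |b - z|))| ≤ 1 / k := by
  rcases le_total a b with h | h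
  · have e : ∫ z in a..b, Real.exp (-(k * |b - z|)) = ∫ z in a..b, Real.exp (-(k * (b - z))) :=
      intervalIntegral.integral_congr fun z hz => by
        rw [uIcc_of_le h] at hz
        simp only [abs_of_nonneg (sub_nonneg.2 hz.2)]
    have h1 := intervalIntegral.integral_eq_sub_of_hasDerivAt (a := a) (b := b)
      (f := fun z => Real.exp (-(k * (b - z))) / k) (f' := fun z => Real.exp (-(k * (b - z))))
      (fun z _ => by
        have := ((((hasDerivAt_id z).const_sub b).const_mul k).neg.exp).div_const k
        refine this.congr_deriv ?_
        field_simp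
        simp) (Continuous.intervalIntegrable (by fun_prop) _ _)
    have h2 := Real.exp_pos (-(k * (b - a)))
    have h3 : Real.exp (-(k * (b - a))) ≤ 1 := Real.exp_le_one_iff.2 (by nlinarith)
    rw [e, h1, sub_self, mul_zero, neg_zero, Real.exp_zero, ← sub_div,
      abs_of_nonneg (div_nonneg (by linarith) hk.le)]
    gcongr
    linarith
  · have e : ∫ z in a..b, Real.exp (-(k * |b - z|)) = ∫ z in a..b, Real.exp (-(k * (z - b))) :=
      intervalIntegral.integral_congr fun z hz => by
        rw [uIcc_of_ge h] at hz
        simp only [abs_sub_comm b z, abs_of_nonneg (sub_nonneg.2 hz.1)]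
    have h1 := intervalIntegral.integral_eq_sub_of_hasDerivAt (a := a) (b := b)
      (f := fun z => -Real.exp (-(k * (z - b))) / k) (f' := fun z => Real.exp (-(k * (z - b))))
      (fun z _ => by
        have := ((((hasDerivAt_id z).sub_const b).const_mul k).neg.exp).neg.div_const k
        refine this.congr_deriv ?_
        field_simp
        simp) (Continuous.intervalIntegrable (by fun_prop) _ _)
    have h2 := Real.exp_pos (-(k * (a - b)))
    have h3 : Real.exp (-(k * (a - b))) ≤ 1 := Real.exp_le_one_iff.2 (by nlinarith)
    rw [e, h1, sub_self, mul_zero, neg_zero, Real.exp_zero, ← sub_div, abs_div, abs_of_pos hk]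
    gcongr
    rw [abs_le]
    constructor <;> linarith

namespace Flow

variable {X : ℝ} {μ : ℝ × ℝ → ℝ} (fl : Flow X μ)

theorem C_pos : 0 < fl.C := (fl.J_pos 0).trans_le (fl.J_le 0)

/-- The solution of `∂_x v + μ ∂_t v = F` with the values `b` on the characteristics,
labelled by their values at `x = 0`, where they pass through `x = o`. -/
noncomputable def solve (o : ℝ) (b : ℝ → ℂ) (F : ℝ × ℝ → ℂ) (p : ℝ × ℝ) : ℂ :=
  b (fl.σ p) + ∫ z in o..clamp X p.1, F (z, fl.Φ (z, fl.σ p))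

/-- The derivative in `t` of `Flow.solve o b F`, where `b'` and `F'` stand for the derivatives of
`b` and `F` in `t`. -/
noncomputable def solveDeriv (o : ℝ) (b' : ℝ → ℂ) (F' : ℝ × ℝ → ℂ) (p : ℝ × ℝ) : ℂ :=
  (b' (fl.σ p) + ∫ z in o..clamp X p.1, F' (z, fl.Φ (z, fl.σ p)) * fl.J (z, fl.σ p))
    * ((fl.J (p.1, fl.σ p))⁻¹ : ℝ)

variable {o : ℝ} {b b' c : ℝ → ℂ} {F F' G : ℝ × ℝ → ℂ}

theorem continuous_solveDeriv (hb' : Continuous b') (hF' : Continuous F') :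
    Continuous (fl.solveDeriv o b' F') := by
  have h1 := fl.continuous_Φ
  have h2 := fl.continuous_J
  have h3 := fl.continuous_σ
  unfold solveDeriv
  refine Continuous.mul ((hb'.comp h3).add ?_) (Complex.continuous_ofReal.comp (Continuous.inv₀
    (h2.comp (continuous_fst.prodMk h3)) fun p => (fl.J_pos _).ne'))
  refine intervalIntegral.continuous_parametric_intervalIntegral_of_continuous
    (f := fun (p : ℝ × ℝ) z => F' (z, fl.Φ (z, fl.σ p)) * fl.J (z, fl.σ p)) ?_
      ((continuous_clamp X).comp continuous_fst)
  have h4 : Continuous fun r : (ℝ × ℝ) × ℝ => (r.2, fl.σ r.1) := by fun_prop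
  exact (hF'.comp (continuous_snd.prodMk (h1.comp h4))).mul
    (Complex.continuous_ofReal.comp (h2.comp h4))

theorem hasDerivAt_σ (x t : ℝ) :
    HasDerivAt (fun t => fl.σ (x, t)) (fl.J (x, fl.σ (x, t)))⁻¹ t := by
  have h3 := fl.continuous_σ
  exact HasDerivAt.of_local_left_inverse (f := fun s => fl.Φ (x, s))
    (Continuous.continuousAt (by fun_prop)) (fl.hasDeriv_Φ_J x _) (fl.J_pos _).ne'
    (Eventually.of_forall fun t => fl.Φ_σ x t)

theorem hasDerivAt_solve (hb' : ∀ t, HasDerivAt b (b' t) t) (hF : Continuous F)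
    (hF'c : Continuous F') (hF' : ∀ x t, HasDerivAt (fun t => F (x, t)) (F' (x, t)) t)
    (x t : ℝ) :
    HasDerivAt (fun t => fl.solve o b F (x, t)) (fl.solveDeriv o b' F' (x, t)) t := by
  have h1 := fl.continuous_Φ
  have h2 := fl.continuous_J
  have hc1 : Continuous fun p : ℝ × ℝ => F (p.2, fl.Φ (p.2, p.1)) := by fun_prop
  have hc2 : Continuous fun p : ℝ × ℝ => F' (p.2, fl.Φ (p.2, p.1)) * (fl.J (p.2, p.1) : ℂ) :=
    (hF'c.comp (by fun_prop : Continuous fun p : ℝ × ℝ => (p.2, fl.Φ (p.2, p.1)))).mul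
      (Complex.continuous_ofReal.comp (h2.comp continuous_swap))
  have hpsi : ∀ s, HasDerivAt (fun s => b s + ∫ z in o..clamp X x, F (z, fl.Φ (z, s)))
      (b' s + ∫ z in o..clamp X x, F' (z, fl.Φ (z, s)) * fl.J (z, s)) s := fun s => by
    refine (hb' s).add (hasDerivAt_intervalIntegral (f := fun s z => F (z, fl.Φ (z, s)))
      (f' := fun s z => F' (z, fl.Φ (z, s)) * fl.J (z, s)) hc1 hc2 (fun s z => ?_) _ _ s)
    have := (hF' z (fl.Φ (z, s))).scomp s (fl.hasDeriv_Φ_J z s)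
    refine this.congr_deriv ?_
    rw [Complex.real_smul, mul_comm]
  have h5 := (hpsi (fl.σ (x, t))).scomp t (fl.hasDerivAt_σ x t)
  refine h5.congr_deriv ?_
  rw [Complex.real_smul, mul_comm]
  rfl

theorem hasDerivWithinAt_solve (hb' : ∀ t, HasDerivAt b (b' t) t) (hF : Continuous F)
    (hb'c : Continuous b') (hF'c : Continuous F')
    (hF' : ∀ x t, HasDerivAt (fun t => F (x, t)) (F' (x, t)) t)
    {x : ℝ} (hx : x ∈ Icc 0 X) (t : ℝ) :
    HasDerivWithinAt (fun x => fl.solve o b F (x, t))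
      (F (x, t) - μ (x, t) * fl.solveDeriv o b' F' (x, t)) (Icc 0 X) x := by
  have h1 := fl.continuous_Φ
  set v := fl.solve o b F with hv
  set w := fl.solveDeriv o b' F' with hw
  have hwc : Continuous w := fl.continuous_solveDeriv hb'c hF'c
  set s := fl.σ (x, t) with hs
  have hΦs : fl.Φ (x, s) = t := fl.Φ_σ x t
  -- Along the characteristic through `(x, t)` the solution is an integral of `F`.
  have hchar : HasDerivWithinAt (fun y => v (y, fl.Φ (y, s))) (F (x, t)) (Icc 0 X) x := by
    have hc : Continuous fun z => F (z, fl.Φ (z, s)) := by fun_prop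
    have h2 : HasDerivAt (fun y => b s + ∫ z in o..y, F (z, fl.Φ (z, s))) (F (x, t)) x := by
      have := ((hc.integral_hasStrictDerivAt o x).hasDerivAt).const_add (b s)
      rwa [hΦs] at this
    refine h2.hasDerivWithinAt.congr (fun y hy => ?_) ?_
    · simp only [hv, solve, fl.σ_Φ, clamp_eq hy]
    · simp only [hv, solve, fl.σ_Φ, clamp_eq hx]
  set A : ℝ → ℂ := fun y => ∫ θ in (0 : ℝ)..1, w (y, t + θ * (fl.Φ (y, s) - t)) with hA
  have hAc : Continuous A := by
    have h2 : Continuous fun q : ℝ × ℝ => (q.1, t + q.2 * (fl.Φ (q.1, s) - t)) := by fun_prop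
    exact intervalIntegral.continuous_parametric_intervalIntegral_of_continuous'
      (f := fun y θ => w (y, t + θ * (fl.Φ (y, s) - t))) (hwc.comp h2) 0 1
  have hdiff : ∀ y, v (y, fl.Φ (y, s)) - v (y, t) = A y * ((fl.Φ (y, s) - t : ℝ) : ℂ) := by
    intro y
    have h2 : ∀ θ : ℝ, HasDerivAt (fun θ : ℝ => v (y, t + θ * (fl.Φ (y, s) - t)))
        ((fl.Φ (y, s) - t) • w (y, t + θ * (fl.Φ (y, s) - t))) θ := fun θ =>
      (fl.hasDerivAt_solve hb' hF hF'c hF' y _).scomp θ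
        (by simpa using ((hasDerivAt_id θ).mul_const (fl.Φ (y, s) - t)).const_add t)
    have h3 := intervalIntegral.integral_eq_sub_of_hasDerivAt (a := 0) (b := 1)
      (fun θ _ => h2 θ) (Continuous.intervalIntegrable (by fun_prop) _ _)
    rw [intervalIntegral.integral_smul, Complex.real_smul, mul_comm] at h3
    simp only [one_mul, zero_mul, add_zero, add_sub_cancel] at h3
    rw [hA, h3]
  have hf : HasDerivWithinAt (fun y => ((fl.Φ (y, s) - t : ℝ) : ℂ)) (μ (x, t) : ℂ) (Icc 0 X) x := by
    have h2 := ((fl.hasDeriv_Φ x hx s).sub_const t).ofReal_comp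
    rwa [hΦs] at h2
  have h2 := hasDerivWithinAt_mul_of_eq_zero hAc.continuousWithinAt hf (by simp [hΦs])
  have hAx : A x = w (x, t) := by simp [hA, hΦs]
  rw [hAx] at h2
  refine ((hchar.sub h2).congr_deriv (by ring)).congr (fun y _ => ?_) ?_
  · simp only [Pi.sub_apply, ← hdiff, sub_sub_cancel]
  · simp only [Pi.sub_apply, ← hdiff, sub_sub_cancel]

theorem solve_boundary (hF : o ∈ Icc 0 X) (t : ℝ) :
    fl.solve o b F (o, t) = b (fl.σ (o, t)) := by
  simp [solve, clamp_eq hF]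

theorem σ_zero (t : ℝ) : fl.σ (0, t) = t := by
  have := fl.σ_Φ 0 t
  rwa [fl.Φ_zero] at this

/-- The characteristics that connect the points of `x = o` with the other points run forward in
time, with inverse speed at least `m`. -/
noncomputable def Causal (o m : ℝ) : Prop :=
  ∀ p, ∀ z ∈ uIcc o (clamp X p.1), fl.Φ (z, fl.σ p) ≤ p.2 - m * |clamp X p.1 - z|

theorem Φ_sub_le {m : ℝ} (hm : ∀ p, m ≤ μ p) {y z s : ℝ} (hy : y ∈ Icc 0 X)
    (hz : z ∈ Icc 0 X) (hyz : y ≤ z) : m * (z - y) ≤ fl.Φ (z, s) - fl.Φ (y, s) := by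
  refine (convex_Icc 0 X).mul_sub_le_image_sub_of_le_deriv
    (f := fun y => fl.Φ (y, s)) (fun z hz => (fl.hasDeriv_Φ z hz s).continuousWithinAt)
    (fun z hz => ((fl.hasDeriv_Φ z (interior_subset hz) s).mono
      interior_subset).differentiableWithinAt) (fun z hz => ?_) y hy z hz hyz
  rw [((fl.hasDeriv_Φ z (interior_subset hz) s).hasDerivAt
    (mem_interior_iff_mem_nhds.1 hz)).deriv]
  exact hm _

theorem Φ_sub_ge {m : ℝ} (hm : ∀ p, μ p ≤ m) {y z s : ℝ} (hy : y ∈ Icc 0 X)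
    (hz : z ∈ Icc 0 X) (hyz : y ≤ z) : fl.Φ (z, s) - fl.Φ (y, s) ≤ m * (z - y) := by
  refine (convex_Icc 0 X).image_sub_le_mul_sub_of_deriv_le
    (f := fun y => fl.Φ (y, s)) (fun z hz => (fl.hasDeriv_Φ z hz s).continuousWithinAt)
    (fun z hz => ((fl.hasDeriv_Φ z (interior_subset hz) s).mono
      interior_subset).differentiableWithinAt) (fun z hz => ?_) y hy z hz hyz
  rw [((fl.hasDeriv_Φ z (interior_subset hz) s).hasDerivAt
    (mem_interior_iff_mem_nhds.1 hz)).deriv]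
  exact hm _

theorem causal_zero (hX : 0 < X) {m : ℝ} (hm : ∀ p, m ≤ μ p) : fl.Causal 0 m := by
  intro p z hz
  have hc := clamp_mem hX.le p.1
  rw [uIcc_of_le hc.1] at hz
  have h1 := fl.Φ_sub_le hm (s := fl.σ p) ⟨hz.1, hz.2.trans hc.2⟩ hc hz.2
  have h2 : fl.Φ (p.1, fl.σ p) = p.2 := fl.Φ_σ p.1 p.2
  rw [fl.Φ_clamp, h2] at h1
  rw [abs_of_nonneg (sub_nonneg.2 hz.2)]
  linarith

theorem causal_right (hX : 0 < X) {m : ℝ} (hm : ∀ p, μ p ≤ -m) : fl.Causal X m := by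
  intro p z hz
  have hc := clamp_mem hX.le p.1
  rw [uIcc_of_ge hc.2] at hz
  have h1 := fl.Φ_sub_ge hm (s := fl.σ p) hc ⟨hc.1.trans hz.1, hz.2⟩ hz.1
  have h2 : fl.Φ (p.1, fl.σ p) = p.2 := fl.Φ_σ p.1 p.2
  rw [fl.Φ_clamp, h2] at h1
  rw [abs_sub_comm, abs_of_nonneg (sub_nonneg.2 hz.1)]
  linarith

theorem Causal.σ_le {m : ℝ} (hm : 0 ≤ m) (h : fl.Causal 0 m) (p : ℝ × ℝ) :
    fl.σ p ≤ p.2 := by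
  have h1 := h p 0 left_mem_uIcc
  rw [fl.Φ_zero] at h1
  have := mul_nonneg hm (abs_nonneg (clamp X p.1 - 0))
  linarith

variable {fl}

theorem Causal.solveDeriv_eq_zero {m : ℝ} (hm : 0 ≤ m) (h : fl.Causal o m)
    (hF' : ∀ p : ℝ × ℝ, p.2 ≤ 0 → F' p = 0) {p : ℝ × ℝ} (hp : p.2 ≤ 0)
    (hb : b' (fl.σ p) = 0) : fl.solveDeriv o b' F' p = 0 := by
  have : ∫ z in o..clamp X p.1, F' (z, fl.Φ (z, fl.σ p)) * fl.J (z, fl.σ p)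
      = ∫ z in o..clamp X p.1, (0 : ℂ) := intervalIntegral.integral_congr fun z hz => by
    have h1 := h p z hz
    have := mul_nonneg hm (abs_nonneg (clamp X p.1 - z))
    simp only [hF' (z, fl.Φ (z, fl.σ p)) (by simp only; linarith), zero_mul]
  rw [solveDeriv, hb, this]
  simp

theorem Causal.solve_eq_zero {m : ℝ} (hm : 0 ≤ m) (h : fl.Causal o m)
    (hF : ∀ p : ℝ × ℝ, p.2 ≤ 0 → F p = 0) {p : ℝ × ℝ} (hp : p.2 ≤ 0)
    (hb : b (fl.σ p) = 0) : fl.solve o b F p = 0 := by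
  have : ∫ z in o..clamp X p.1, F (z, fl.Φ (z, fl.σ p))
      = ∫ z in o..clamp X p.1, (0 : ℂ) := intervalIntegral.integral_congr fun z hz => by
    have h1 := h p z hz
    have := mul_nonneg hm (abs_nonneg (clamp X p.1 - z))
    simp only [hF (z, fl.Φ (z, fl.σ p)) (by simp only; linarith)]
  rw [solve, hb, this]
  simp

/-- Integration along characteristics gains a factor `1 / B` in the norm with weight
`e^{-Bt}`. -/
theorem Causal.norm_solveDeriv_le {m B A β : ℝ} (hm : 0 < m) (hB : 0 < B) (hA : 0 ≤ A)
    (h : fl.Causal o m) (hF' : ∀ p : ℝ × ℝ, ‖F' p‖ ≤ A * Real.exp (B * p.2)) {p : ℝ × ℝ}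
    (hb : ‖b' (fl.σ p)‖ ≤ β * Real.exp (B * p.2)) :
    ‖fl.solveDeriv o b' F' p‖ ≤ fl.C * (β + fl.C * A / (B * m)) * Real.exp (B * p.2) := by
  have hC := fl.C_pos
  have h1 : ‖∫ z in o..clamp X p.1, F' (z, fl.Φ (z, fl.σ p)) * fl.J (z, fl.σ p)‖
      ≤ |∫ z in o..clamp X p.1, fl.C * A * Real.exp (B * p.2) *
        Real.exp (-(B * m * |clamp X p.1 - z|))| := by
    refine intervalIntegral.norm_integral_le_abs_of_norm_le ?_
      (Continuous.intervalIntegrable (by fun_prop) _ _)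
    refine (MeasureTheory.ae_restrict_iff' measurableSet_uIoc).2
      (Eventually.of_forall fun z hz => ?_)
    have h2 := h p z (uIoc_subset_uIcc hz)
    rw [norm_mul, Complex.norm_real, Real.norm_of_nonneg (fl.J_pos _).le]
    calc ‖F' (z, fl.Φ (z, fl.σ p))‖ * fl.J (z, fl.σ p)
        ≤ A * Real.exp (B * fl.Φ (z, fl.σ p)) * fl.C := by
          gcongr
          · exact (fl.J_pos _).le
          · exact hF' _
          · exact fl.J_le _
      _ ≤ A * Real.exp (B * (p.2 - m * |clamp X p.1 - z|)) * fl.C := by gcongr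
      _ = _ := by rw [mul_sub, sub_eq_add_neg, Real.exp_add]; ring_nf
  rw [intervalIntegral.integral_const_mul, abs_mul] at h1
  have h2 := abs_integral_exp_neg_le (mul_pos hB hm) o (clamp X p.1)
  have h3 : |fl.C * A * Real.exp (B * p.2)| = fl.C * A * Real.exp (B * p.2) :=
    abs_of_nonneg (by positivity)
  rw [h3] at h1
  have h4 : ‖∫ z in o..clamp X p.1, F' (z, fl.Φ (z, fl.σ p)) * fl.J (z, fl.σ p)‖
      ≤ fl.C * A / (B * m) * Real.exp (B * p.2) := by
    refine h1.trans ((mul_le_mul_of_nonneg_left h2 (by positivity)).trans (le_of_eq ?_))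
    ring
  rw [solveDeriv, norm_mul, Complex.norm_real,
    Real.norm_of_nonneg (inv_nonneg.2 (fl.J_pos _).le)]
  calc _ ≤ (β * Real.exp (B * p.2) + fl.C * A / (B * m) * Real.exp (B * p.2)) * fl.C := by
        gcongr
        · exact inv_nonneg.2 (fl.J_pos _).le
        · exact (norm_nonneg _).trans ((norm_add_le _ _).trans (add_le_add hb h4))
        · exact (norm_add_le _ _).trans (add_le_add hb h4)
        · exact fl.J_inv_le _
    _ = _ := by ring

theorem solveDeriv_sub (hF' : Continuous F') (hG : Continuous G) (p : ℝ × ℝ) :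
    fl.solveDeriv o b' F' p - fl.solveDeriv o c G p
      = fl.solveDeriv o (b' - c) (F' - G) p := by
  have h1 := fl.continuous_Φ
  have h2 := fl.continuous_J
  have h4 : Continuous fun z : ℝ => (z, fl.σ p) := by fun_prop
  have hc : ∀ H : ℝ × ℝ → ℂ, Continuous H → IntervalIntegrable
      (fun z => H (z, fl.Φ (z, fl.σ p)) * (fl.J (z, fl.σ p) : ℂ)) MeasureTheory.volume o
      (clamp X p.1) := fun H hH =>
    ((hH.comp (continuous_id.prodMk (h1.comp h4))).mul
      (Complex.continuous_ofReal.comp (h2.comp h4))).intervalIntegrable _ _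
  simp only [solveDeriv, Pi.sub_apply, sub_mul]
  rw [intervalIntegral.integral_sub (hc _ hF') (hc _ hG)]
  ring

end Flow

/-! ### The fixed point problem for the time derivative -/

/-- Continuous functions of `(x, t)` that vanish for `t ≤ 0`. -/
def IsCausal {ι : Type*} (w : ι → ℝ × ℝ → ℂ) : Prop :=
  (∀ i, Continuous (w i)) ∧ ∀ i p, p.2 ≤ 0 → w i p = 0

open Classical in
/-- Let `D w` and `N w` stand for the time derivatives of the right-hand side and of the boundary
values, as functions of the time derivative `w` of the unknown. If they depend on
`w` in a causal and Lipschitz way, and the boundary values at `x = 0`, up to a smoothing term, only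
on the components without `pos`, there is `w` such that each `w i` is the time derivative of the
solution of the corresponding transport equation.
This is a contraction in a norm with weight `e^{-Bt}`, in which the components with `pos` are given
a small weight. -/
theorem exists_causal_fixed_point {ι : Type*} [Fintype ι] {pos : ι → Prop} {X m C : ℝ}
    (hX : 0 < X) (hm : 0 < m) {μ : ι → ℝ × ℝ → ℝ} (fl : ∀ i, Flow X (μ i))
    (hpos : ∀ i, pos i → ∀ p, m ≤ μ i p) (hneg : ∀ i, ¬ pos i → ∀ p, μ i p ≤ -m)
    {D : (ι → ℝ × ℝ → ℂ) → ι → ℝ × ℝ → ℂ} {N : (ι → ℝ × ℝ → ℂ) → ι → ℝ → ℂ}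
    (hDc : ∀ w, IsCausal w → IsCausal (D w))
    (hNc : ∀ w, IsCausal w → ∀ i, Continuous (N w i) ∧ ∀ t ≤ 0, N w i t = 0)
    (hC : 0 ≤ C)
    (hD : ∀ B, 1 ≤ B → ∀ w w', IsCausal w → IsCausal w' → ∀ A, 0 ≤ A →
      (∀ i p, ‖w i p - w' i p‖ ≤ A * Real.exp (B * p.2)) →
      ∀ i p, ‖D w i p - D w' i p‖ ≤ C * A * Real.exp (B * p.2))
    (hN : ∀ B, 1 ≤ B → ∀ w w', IsCausal w → IsCausal w' → ∀ A A', 0 ≤ A → 0 ≤ A' →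
      (∀ i p, ‖w i p - w' i p‖ ≤ A * Real.exp (B * p.2)) →
      (∀ i, ¬ pos i → ∀ p, ‖w i p - w' i p‖ ≤ A' * Real.exp (B * p.2)) →
      ∀ i t, ‖N w i t - N w' i t‖ ≤ C * (A' + A / B) * Real.exp (B * t))
    (hD0 : ∀ i p, ‖D 0 i p‖ ≤ C) (hN0 : ∀ i t, ‖N 0 i t‖ ≤ C) :
    ∃ w, IsCausal w ∧ ∀ i, w i = if pos i then (fl i).solveDeriv 0 (N w i) (D w i)
      else (fl i).solveDeriv X 0 (D w i) := by
  set o : ι → ℝ := fun i => if pos i then 0 else X with ho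
  set b : (ι → ℝ × ℝ → ℂ) → ι → ℝ → ℂ := fun w i => if pos i then N w i else 0 with hb
  set S : (ι → ℝ × ℝ → ℂ) → ι → ℝ × ℝ → ℂ := fun w i => (fl i).solveDeriv (o i) (b w i) (D w i)
    with hS
  have hcausal : ∀ i, (fl i).Causal (o i) m := fun i => by
    by_cases h : pos i
    · simp only [ho, h, if_true]; exact (fl i).causal_zero hX (hpos i h)
    · simp only [ho, h, if_false]; exact (fl i).causal_right hX (hneg i h)
  have hbc : ∀ w, IsCausal w → ∀ i, Continuous (b w i) := fun w hw i => by
    by_cases h : pos i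
    · simp only [hb, h, if_true]; exact (hNc w hw i).1
    · simp only [hb, h, if_false]; exact continuous_zero
  have hSc : ∀ w, IsCausal w → IsCausal (S w) := fun w hw =>
    ⟨fun i => (fl i).continuous_solveDeriv (hbc w hw i) ((hDc w hw).1 i), fun i p hp => by
      refine (hcausal i).solveDeriv_eq_zero hm.le ((hDc w hw).2 i) hp ?_
      by_cases h : pos i
      · simp only [hb, h, if_true]
        have h1 := hcausal i
        simp only [ho, h, if_true] at h1
        exact (hNc w hw i).2 _ ((h1.σ_le (fl i) hm.le p).trans hp)
      · simp [hb, h]⟩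
  obtain ⟨c, hc, hcfl⟩ : ∃ c : ℝ, 0 < c ∧ ∀ i, (fl i).C ≤ c :=
    ⟨∑ i, (fl i).C + 1, by
      have := Finset.sum_nonneg fun i (_ : i ∈ Finset.univ) => (fl i).C_pos.le
      linarith, fun i => by
      have := Finset.single_le_sum (f := fun i => (fl i).C) (fun i _ => (fl i).C_pos.le)
        (Finset.mem_univ i)
      linarith⟩
  -- The contribution of the interior gains the factor `1 / B`, that of the boundary does not.
  have hest : ∀ B, 1 ≤ B → ∀ i (β A : ℝ) (f : ℝ → ℂ) (F : ℝ × ℝ → ℂ), 0 ≤ A → 0 ≤ β →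
      (∀ p, ‖F p‖ ≤ A * Real.exp (B * p.2)) →
      (if pos i then ∀ t, ‖f t‖ ≤ β * Real.exp (B * t) else ∀ t, ‖f t‖ ≤ 0) →
      ∀ p, ‖(fl i).solveDeriv (o i) f F p‖
        ≤ (c * (if pos i then β else 0) + c * c * A / (B * m)) * Real.exp (B * p.2) := by
    intro B hB i β A f F hA hβ hF hf p
    have hCi := (fl i).C_pos
    have h1 := (hcausal i).norm_solveDeriv_le hm (zero_lt_one.trans_le hB) hA hF
      (b' := f) (β := if pos i then β else 0) (p := p) (by
        by_cases h : pos i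
        · simp only [h, if_true] at hf ⊢
          refine (hf _).trans ?_
          have h1 := hcausal i
          simp only [ho, h, if_true] at h1
          have := h1.σ_le (fl i) hm.le p
          gcongr
        · simp only [h, if_false] at hf ⊢
          rw [zero_mul]
          exact hf _)
    refine h1.trans (mul_le_mul_of_nonneg_right ?_ (Real.exp_pos _).le)
    have h3 : 0 ≤ (if pos i then β else 0) := by split_ifs <;> simp [hβ]
    have h4 := hcfl i
    calc (fl i).C * ((if pos i then β else 0) + (fl i).C * A / (B * m))
        ≤ c * ((if pos i then β else 0) + c * A / (B * m)) := by gcongr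
      _ = _ := by ring
  have hlip : ∀ B, 1 ≤ B → ∀ w w', IsCausal w → IsCausal w' → ∀ A A', 0 ≤ A → 0 ≤ A' →
      (∀ i p, ‖w i p - w' i p‖ ≤ A * Real.exp (B * p.2)) →
      (∀ i, ¬ pos i → ∀ p, ‖w i p - w' i p‖ ≤ A' * Real.exp (B * p.2)) →
      ∀ i p, ‖S w i p - S w' i p‖ ≤
        (c * (if pos i then C * (A' + A / B) else 0) + c * c * (C * A) / (B * m))
          * Real.exp (B * p.2) := by
    intro B hB w w' hw hw' A A' hA hA' h1 h2 i p
    have hB0 : 0 < B := zero_lt_one.trans_le hB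
    simp only [hS]
    rw [Flow.solveDeriv_sub ((hDc w hw).1 i) ((hDc w' hw').1 i)]
    refine hest B hB i _ _ _ _ (by positivity) (by positivity)
      (fun p => hD B hB w w' hw hw' A hA h1 i p) ?_ p
    by_cases h : pos i
    · simp only [h, if_true, hb]
      exact fun t => hN B hB w w' hw hw' A A' hA hA' h1 h2 i t
    · simp [h, hb]
  have h0c : IsCausal (0 : ι → ℝ × ℝ → ℂ) := ⟨fun _ => continuous_zero, fun _ _ _ => rfl⟩
  -- The components with `pos` are divided by `s`, which makes the boundary map a contraction. Then
  -- `B` is chosen so large that the remaining terms are absorbed by the factor `1 / B`.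
  set s : ℝ := 4 * c * C + 1 with hs
  have hs1 : 1 ≤ s := by
    have : 0 ≤ 4 * c * C := by positivity
    linarith
  set Q : ℝ := c * C + c * c * C / m with hQ
  have hQ0 : 0 ≤ Q := by positivity
  set B : ℝ := 4 * s * Q + 1 with hBdef
  have hB1 : 1 ≤ B := by
    have : 0 ≤ 4 * s * Q := by positivity
    linarith
  have hB0 : 0 < B := zero_lt_one.trans_le hB1
  set θ : ι → ℝ := fun i => if pos i then s else 1 with hθ
  have hθ1 : ∀ i, 1 ≤ θ i := fun i => by simp only [hθ]; split_ifs <;> simp [hs1]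
  have hθs : ∀ i, θ i ≤ s := fun i => by simp only [hθ]; split_ifs <;> simp [hs1]
  have hθ0 : ∀ i, 0 < θ i := fun i => zero_lt_one.trans_le (hθ1 i)
  -- The fixed point problem is posed for the bounded functions `w / (θ e^{Bt})`.
  set Z := {z : BoundedContinuousFunction (ℝ × ℝ) (ι → ℂ) | ∀ p : ℝ × ℝ, p.2 ≤ 0 → z p = 0}
    with hZ
  have hZc : IsClosed Z := by
    have : Z = ⋂ p ∈ {p : ℝ × ℝ | p.2 ≤ 0}, {z | z p = 0} := by ext; simp [hZ]
    rw [this]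
    exact isClosed_biInter fun p _ => isClosed_eq
      ((continuous_apply p).comp BoundedContinuousFunction.continuous_coe) continuous_const
  set toW : Z → ι → ℝ × ℝ → ℂ := fun z i p => ((θ i * Real.exp (B * p.2) : ℝ) : ℂ) * z.1 p i
    with htoW
  have hW : ∀ z, IsCausal (toW z) := fun z =>
    ⟨fun i => by
      have h1 : Continuous fun p => z.1 p i := (continuous_apply i).comp z.1.continuous
      simp only [htoW]
      exact (Complex.continuous_ofReal.comp (by fun_prop)).mul h1,
    fun i p hp => by simp [htoW, z.2 p hp]⟩
  have hWsub : ∀ (z z' : Z) i p, ‖toW z i p - toW z' i p‖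
      ≤ θ i * dist z z' * Real.exp (B * p.2) := fun z z' i p => by
    have h1 : ‖z.1 p i - z'.1 p i‖ ≤ dist z z' := by
      rw [← dist_eq_norm]
      exact (dist_le_pi_dist (z.1 p) (z'.1 p) i).trans
        (BoundedContinuousFunction.dist_coe_le_dist (f := z.1) (g := z'.1) p)
    simp only [htoW]
    rw [← mul_sub, norm_mul, Complex.norm_real, Real.norm_of_nonneg (by
      have := (hθ0 i).le; positivity)]
    have := (hθ0 i).le
    calc θ i * Real.exp (B * p.2) * ‖z.1 p i - z'.1 p i‖
        ≤ θ i * Real.exp (B * p.2) * dist z z' := by gcongr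
      _ = _ := by ring
  have hSsub : ∀ (z z' : Z) i p, ‖S (toW z) i p - S (toW z') i p‖
      ≤ θ i * (1 / 2 * dist z z') * Real.exp (B * p.2) := fun z z' i p => by
    have hd : 0 ≤ dist z z' := dist_nonneg
    have h1 := hlip B hB1 (toW z) (toW z') (hW z) (hW z') (s * dist z z') (dist z z')
      (by positivity) hd (fun i p => (hWsub z z' i p).trans (by gcongr; exact hθs i))
      (fun i hi p => (hWsub z z' i p).trans (by simp [hθ, hi])) i p
    refine h1.trans (mul_le_mul_of_nonneg_right ?_ (Real.exp_pos _).le)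
    have e1 : s * Q / B ≤ 1 / 4 := by
      rw [div_le_iff₀ hB0]; linarith
    have e2 : c * c * (C * (s * dist z z')) / (B * m) ≤ s * Q / B * dist z z' := by
      have : s * Q / B * dist z z' = s * (c * C) / B * dist z z'
          + c * c * (C * (s * dist z z')) / (B * m) := by
        rw [hQ]; field_simp
      rw [this]
      have : 0 ≤ s * (c * C) / B * dist z z' := by positivity
      linarith
    by_cases h : pos i
    · simp only [h, if_true, hθ]
      have e3 : c * (C * (dist z z' + s * dist z z' / B)) + c * c * (C * (s * dist z z')) / (B * m)
          = c * C * dist z z' + s * Q / B * dist z z' := by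
        rw [hQ]; field_simp; ring
      rw [e3]
      have e4 : s * Q / B * dist z z' ≤ 1 / 4 * dist z z' := by gcongr
      have e5 : c * C ≤ s / 4 := by rw [hs]; linarith
      have e6 : c * C * dist z z' ≤ s / 4 * dist z z' := by gcongr
      have e7 : 1 / 4 * dist z z' ≤ s / 4 * dist z z' := by gcongr
      linarith
    · simp only [h, if_false, hθ]
      have e4 : s * Q / B * dist z z' ≤ 1 / 4 * dist z z' := by gcongr
      linarith
  set z0 : Z := ⟨0, fun p _ => rfl⟩ with hz0
  have htoW0 : toW z0 = 0 := by
    funext i p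
    simp [htoW, hz0]
  have hS0 : ∀ i p, ‖S 0 i p‖ ≤ (c * C + c * c * C / (B * m)) * Real.exp (B * p.2) := by
    have hexp : ∀ t : ℝ, 0 < t → C ≤ C * Real.exp (B * t) := fun t ht =>
      le_mul_of_one_le_right hC (Real.one_le_exp (by positivity))
    intro i p
    refine (hest B hB1 i C C _ _ hC hC (fun p => ?_) ?_ p).trans ?_
    · rcases le_or_gt p.2 0 with h | h
      · rw [(hDc 0 h0c).2 i p h, norm_zero]; positivity
      · exact (hD0 i p).trans (hexp _ h)
    · by_cases h : pos i
      · simp only [h, if_true, hb]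
        intro t
        rcases le_or_gt t 0 with h | h
        · rw [(hNc 0 h0c i).2 t h, norm_zero]; positivity
        · exact (hN0 i t).trans (hexp _ h)
      · simp [h, hb]
    · refine mul_le_mul_of_nonneg_right (add_le_add_left ?_ _) (Real.exp_pos _).le
      split_ifs
      · exact le_rfl
      · rw [mul_zero]; positivity
  have hbound : ∀ z : Z, ∃ A : ℝ, 0 ≤ A ∧ ∀ i p, ‖S (toW z) i p‖ ≤ A * Real.exp (B * p.2) :=
    fun z => by
    refine ⟨s * (1 / 2 * dist z z0) + (c * C + c * c * C / (B * m)), by positivity,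
      fun i p => ?_⟩
    have h1 := hSsub z z0 i p
    rw [htoW0] at h1
    have h2 := hS0 i p
    have h3 : ‖S (toW z) i p‖ ≤ ‖S (toW z) i p - S 0 i p‖ + ‖S 0 i p‖ := by
      simpa using norm_add_le (S (toW z) i p - S 0 i p) (S 0 i p)
    have h4 : θ i * (1 / 2 * dist z z0) * Real.exp (B * p.2)
        ≤ s * (1 / 2 * dist z z0) * Real.exp (B * p.2) := by
      gcongr
      exact hθs i
    linarith
  have hTfun : ∀ z : Z, ∃ z' : Z, toW z' = S (toW z) := fun z => by
    obtain ⟨A, hA0, hA⟩ := hbound z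
    have hcont : Continuous fun p : ℝ × ℝ => fun i =>
        (((θ i * Real.exp (B * p.2))⁻¹ : ℝ) : ℂ) * S (toW z) i p := by
      refine continuous_pi fun i => ?_
      have h1 := (hSc _ (hW z)).1 i
      refine (Complex.continuous_ofReal.comp (Continuous.inv₀ (by fun_prop) fun p =>
        (mul_pos (hθ0 i) (Real.exp_pos _)).ne')).mul h1
    refine ⟨⟨BoundedContinuousFunction.ofNormedAddCommGroup _ hcont A fun p => ?_, ?_⟩, ?_⟩
    · refine (pi_norm_le_iff_of_nonneg hA0).2 fun i => ?_
      have hE := Real.exp_pos (B * p.2)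
      rw [norm_mul, Complex.norm_real, Real.norm_of_nonneg (by
        have := (hθ0 i).le; positivity), inv_mul_le_iff₀ (mul_pos (hθ0 i) hE)]
      refine (hA i p).trans ?_
      rw [mul_comm A]
      gcongr
      exact le_mul_of_one_le_left hE.le (hθ1 i)
    · intro p hp
      funext i
      have : S (toW z) i p = 0 := (hSc _ (hW z)).2 i p hp
      simp [this]
    · funext i p
      have := (mul_pos (hθ0 i) (Real.exp_pos (B * p.2))).ne'
      simp only [htoW, BoundedContinuousFunction.coe_ofNormedAddCommGroup]
      rw [← mul_assoc, ← Complex.ofReal_mul, mul_inv_cancel₀ this, Complex.ofReal_one, one_mul]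
  choose T hT using hTfun
  have hTc : ContractingWith (1 / 2) T := by
    refine ⟨by norm_num, LipschitzWith.of_dist_le_mul fun z z' => ?_⟩
    have h2 : dist (T z) (T z') = dist (T z).1 (T z').1 := rfl
    rw [h2]
    refine (BoundedContinuousFunction.dist_le (by positivity)).2 fun p =>
      (dist_pi_le_iff (by positivity)).2 fun i => ?_
    have h3 := hSsub z z' i p
    rw [← hT z, ← hT z'] at h3
    simp only [htoW] at h3
    have hE := Real.exp_pos (B * p.2)
    rw [← mul_sub, norm_mul, Complex.norm_real, Real.norm_of_nonneg (by
      have := (hθ0 i).le; positivity)] at h3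
    rw [dist_eq_norm]
    push_cast
    refine le_of_mul_le_mul_left ?_ (mul_pos (hθ0 i) hE)
    linarith
  have : Nonempty Z := ⟨z0⟩
  have : CompleteSpace Z := hZc.completeSpace_coe
  set z := hTc.fixedPoint T with hz
  have hfix : T z = z := hTc.fixedPoint_isFixedPt
  refine ⟨toW z, hW z, fun i => ?_⟩
  have h1 := hT z
  rw [hfix] at h1
  conv_lhs => rw [h1]
  by_cases h : pos i
  · simp [hS, ho, hb, h]
  · simp [hS, ho, hb, h]

/-! ### Functions on a rectangle and their extension -/

/-- The rectangle `[0, X] × [0, T]`. -/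
def rect (X T : ℝ) : Set (ℝ × ℝ) := Icc 0 X ×ˢ Icc 0 T

/-- The derivative in `t` of a function on a rectangle. -/
noncomputable def rectDt {E : Type*} [NormedAddCommGroup E] [NormedSpace ℝ E] (X T : ℝ)
    (g : ℝ × ℝ → E) (p : ℝ × ℝ) : E := fderivWithin ℝ g (rect X T) p (0, 1)

/-- The derivative in `x` of a function on a rectangle. -/
noncomputable def rectDx {E : Type*} [NormedAddCommGroup E] [NormedSpace ℝ E] (X T : ℝ)
    (g : ℝ × ℝ → E) (p : ℝ × ℝ) : E := fderivWithin ℝ g (rect X T) p (1, 0)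

section Rect

variable {X T : ℝ} {E : Type*} [NormedAddCommGroup E] [NormedSpace ℝ E] {g : ℝ × ℝ → E}

theorem uniqueDiffOn_rect (hX : 0 < X) (hT : 0 < T) : UniqueDiffOn ℝ (rect X T) :=
  (uniqueDiffOn_Icc hX).prod (uniqueDiffOn_Icc hT)

theorem isCompact_rect (X T : ℝ) : IsCompact (rect X T) := isCompact_Icc.prod isCompact_Icc

theorem hasDerivWithinAt_rectDt {x t : ℝ} (hg : DifferentiableWithinAt ℝ g (rect X T) (x, t))
    (hx : x ∈ Icc 0 X) :
    HasDerivWithinAt (fun t => g (x, t)) (rectDt X T g (x, t)) (Icc 0 T) t := by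
  have h1 : HasDerivWithinAt (fun s : ℝ => (x, s)) ((0 : ℝ), (1 : ℝ)) (Icc 0 T) t :=
    ((hasDerivAt_const t x).prodMk (hasDerivAt_id t)).hasDerivWithinAt
  exact hg.hasFDerivWithinAt.comp_hasDerivWithinAt t h1
    fun s (hs : s ∈ Icc 0 T) => (⟨hx, hs⟩ : (x, s) ∈ rect X T)

theorem hasDerivWithinAt_rectDx {x t : ℝ} (hg : DifferentiableWithinAt ℝ g (rect X T) (x, t))
    (ht : t ∈ Icc 0 T) :
    HasDerivWithinAt (fun x => g (x, t)) (rectDx X T g (x, t)) (Icc 0 X) x := by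
  have h1 : HasDerivWithinAt (fun s : ℝ => (s, t)) ((1 : ℝ), (0 : ℝ)) (Icc 0 X) x :=
    ((hasDerivAt_id x).prodMk (hasDerivAt_const x t)).hasDerivWithinAt
  exact hg.hasFDerivWithinAt.comp_hasDerivWithinAt x h1
    fun s (hs : s ∈ Icc 0 X) => (⟨hs, ht⟩ : (s, t) ∈ rect X T)

theorem contDiffOn_rectDt (hX : 0 < X) (hT : 0 < T) {m n : WithTop ℕ∞}
    (hg : ContDiffOn ℝ n g (rect X T))
    (hmn : m + 1 ≤ n) : ContDiffOn ℝ m (rectDt X T g) (rect X T) :=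
  (hg.fderivWithin (uniqueDiffOn_rect hX hT) hmn).clm_apply contDiffOn_const

theorem contDiffOn_rectDx (hX : 0 < X) (hT : 0 < T) {m n : WithTop ℕ∞}
    (hg : ContDiffOn ℝ n g (rect X T))
    (hmn : m + 1 ≤ n) : ContDiffOn ℝ m (rectDx X T g) (rect X T) :=
  (hg.fderivWithin (uniqueDiffOn_rect hX hT) hmn).clm_apply contDiffOn_const

/-- Continuous bounded functions on the plane with continuous bounded derivative in `t`. -/
structure IsTimeDiff (g g' : ℝ × ℝ → E) : Prop where
  cont : Continuous g
  cont' : Continuous g'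
  bdd : ∃ C, ∀ p, ‖g p‖ ≤ C
  bdd' : ∃ C, ∀ p, ‖g' p‖ ≤ C
  deriv : ∀ x t, HasDerivAt (fun t => g (x, t)) (g' (x, t)) t

/-- A `C¹` function on a rectangle has an extension with bounded derivative in `t`. If the function
and its derivative vanish for `t = 0`, then the extension vanishes for `t ≤ 0`. -/
theorem exists_extension [CompleteSpace E] (hX : 0 < X) (hT : 0 < T)
    (hg : ContDiffOn ℝ 1 g (rect X T)) :
    ∃ h h' : ℝ × ℝ → E, IsTimeDiff h h' ∧ EqOn h g (rect X T) ∧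
      ((∀ x ∈ Icc 0 X, g (x, 0) = 0 ∧ rectDt X T g (x, 0) = 0) →
        ∀ p : ℝ × ℝ, p.2 ≤ 0 → h p = 0 ∧ h' p = 0) := by
  set d : ℝ → ℝ := fun s => max 0 (1 - |s - clamp T s|) with hd
  have hcX := continuous_clamp X
  have hcT := continuous_clamp T
  have hd1 : ∀ s, |d s| ≤ 1 := fun s => by
    rw [abs_of_nonneg (le_max_left _ _)]
    exact max_le zero_le_one (by linarith [abs_nonneg (s - clamp T s)])
  set e : ℝ × ℝ → ℝ × ℝ := fun p => (clamp X p.1, clamp T p.2) with he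
  have hec : Continuous e := by fun_prop
  have hem : ∀ p, e p ∈ rect X T := fun p => ⟨clamp_mem hX.le _, clamp_mem hT.le _⟩
  have hdg : ∀ p ∈ rect X T, DifferentiableWithinAt ℝ g (rect X T) p :=
    hg.differentiableOn one_ne_zero
  have hDc : Continuous fun p => rectDt X T g (e p) :=
    (contDiffOn_rectDt hX hT hg (m := 0) (by simp)).continuousOn.comp_continuous hec hem
  have hgc : Continuous fun p => g (e p) := hg.continuousOn.comp_continuous hec hem
  obtain ⟨C, hC⟩ := (isCompact_rect X T).exists_bound_of_continuousOn hg.continuousOn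
  obtain ⟨C', hC'⟩ := (isCompact_rect X T).exists_bound_of_continuousOn
    (contDiffOn_rectDt hX hT hg (m := 0) (by simp)).continuousOn
  have hC'0 : 0 ≤ C' := (norm_nonneg _).trans (hC' _ (hem 0))
  set h' : ℝ × ℝ → E := fun p => d p.2 • rectDt X T g (e p) with hh'
  have hdc : Continuous d := by fun_prop
  have hh'c : Continuous h' := by fun_prop
  have hh'b : ∀ p, ‖h' p‖ ≤ C' := fun p => by
    simp only [hh', norm_smul, Real.norm_eq_abs]
    calc |d p.2| * ‖rectDt X T g (e p)‖ ≤ 1 * C' :=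
          mul_le_mul (hd1 _) (hC' _ (hem p)) (norm_nonneg _) zero_le_one
      _ = C' := one_mul _
  set h : ℝ × ℝ → E := fun p => g (e (p.1, 0)) + ∫ s in (0 : ℝ)..p.2, h' (p.1, s) with hh
  have hhc : Continuous h := by
    refine (hgc.comp (by fun_prop : Continuous fun p : ℝ × ℝ => (p.1, (0 : ℝ)))).add ?_
    refine intervalIntegral.continuous_parametric_intervalIntegral_of_continuous
      (f := fun (p : ℝ × ℝ) s => h' (p.1, s)) ?_ continuous_snd
    exact hh'c.comp (by fun_prop : Continuous fun r : (ℝ × ℝ) × ℝ => (r.1.1, r.2))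
  -- The derivative is supported in `[-1, T + 1]`.
  have hsupp : ∀ x t, ∫ s in (0 : ℝ)..t, h' (x, s)
      = ∫ s in (0 : ℝ)..max (-1) (min t (T + 1)), h' (x, s) := fun x t => by
    have hi : ∀ a b, IntervalIntegrable (fun s => h' (x, s)) MeasureTheory.volume a b :=
      fun a b => Continuous.intervalIntegrable (by fun_prop) _ _
    by_cases hmid : max (-1) (min t (T + 1)) = t
    · rw [hmid]
    rw [← sub_eq_zero, intervalIntegral.integral_interval_sub_left (hi _ _) (hi _ _)]
    rw [intervalIntegral.integral_congr (g := fun _ => (0 : E)) (fun s hs => ?_)]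
    · simp
    · have : d s = 0 := by
        simp only [hd]
        refine max_eq_left ?_
        rcases le_total t (-1) with h1 | h1
        · have h2 : max (-1) (min t (T + 1)) = -1 :=
            max_eq_left ((min_le_left _ _).trans h1)
          rw [h2, uIcc_of_ge h1] at hs
          have h3 : clamp T s = 0 := by
            rw [clamp]
            exact max_eq_left ((min_le_left _ _).trans (by linarith [hs.2]))
          rw [h3, sub_zero, abs_of_nonpos (by linarith [hs.2])]
          linarith [hs.2]
        · rcases le_total t (T + 1) with h2 | h2
          · exact absurd (by rw [min_eq_left h2, max_eq_right h1]) hmid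
          · have h3 : max (-1) (min t (T + 1)) = T + 1 := by
              rw [min_eq_right h2, max_eq_right (by linarith)]
            rw [h3, uIcc_of_le h2] at hs
            have h4 : clamp T s = T := by
              rw [clamp, min_eq_right (by linarith [hs.1]), max_eq_right hT.le]
            rw [h4, abs_of_nonneg (by linarith [hs.1])]
            linarith [hs.1]
      simp only [hh', this, zero_smul]
  refine ⟨h, h', ⟨hhc, hh'c, ⟨C + C' * (T + 2), fun p => ?_⟩, ⟨C', hh'b⟩, fun x t => ?_⟩, ?_, ?_⟩
  · simp only [hh]
    rw [hsupp]
    refine (norm_add_le _ _).trans (add_le_add (hC _ (hem _)) ?_)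
    refine (intervalIntegral.norm_integral_le_of_norm_le_const fun s _ => hh'b _).trans ?_
    gcongr
    rw [sub_zero, abs_le]
    exact ⟨by linarith [le_max_left (-1) (min p.2 (T + 1))],
      max_le (by linarith) ((min_le_right _ _).trans (by linarith))⟩
  · have h1 : Continuous fun s => h' (x, s) := by fun_prop
    exact ((h1.integral_hasStrictDerivAt 0 t).hasDerivAt).const_add (g (e (x, 0)))
  · rintro ⟨x, t⟩ ⟨hx, ht⟩
    have h1 : ∫ s in (0 : ℝ)..t, h' (x, s) = g (x, t) - g (x, 0) := by
      have h2 : ∀ s ∈ Icc 0 T, h' (x, s) = rectDt X T g (x, s) := fun s hs => by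
        simp [hh', he, hd, clamp_eq hx, clamp_eq hs]
      refine intervalIntegral.integral_eq_sub_of_hasDerivAt_of_le ht.1 (f := fun t => g (x, t))
        (fun s hs => ?_) (fun s hs => ?_) (Continuous.intervalIntegrable (by fun_prop) _ _)
      · exact ((hasDerivWithinAt_rectDt (hdg (x, s) ⟨hx, hs.1, hs.2.trans ht.2⟩)
          hx).continuousWithinAt).mono (Icc_subset_Icc_right ht.2)
      · have h3 : s ∈ Icc 0 T := ⟨hs.1.le, hs.2.le.trans ht.2⟩
        rw [h2 s h3]
        exact (hasDerivWithinAt_rectDt (hdg (x, s) ⟨hx, h3⟩) hx).hasDerivAt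
          (Icc_mem_nhds hs.1 (hs.2.trans_le ht.2))
    simp only [hh, h1, he, clamp_eq hx, clamp_eq (show (0 : ℝ) ∈ Icc 0 T from ⟨le_rfl, hT.le⟩)]
    abel
  · intro hflat p hp
    have hneg : ∀ x s, s ≤ 0 → h' (x, s) = 0 := fun x s hs => by
      have h3 : clamp T s = 0 := by
        rw [clamp]
        exact max_eq_left ((min_le_left _ _).trans hs)
      simp only [hh', he, h3, (hflat _ (clamp_mem hX.le x)).2, smul_zero]
    have h0 : clamp T 0 = 0 := clamp_eq ⟨le_rfl, hT.le⟩
    refine ⟨?_, hneg _ _ hp⟩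
    simp only [hh, he, h0, (hflat _ (clamp_mem hX.le p.1)).1, zero_add]
    rw [intervalIntegral.integral_congr (g := fun _ => (0 : E)) (fun s hs => ?_)]
    · simp
    · rw [uIcc_of_ge hp] at hs
      exact hneg _ _ hs.2

end Rect

/-! ### Volterra operators and continuously differentiable solutions -/

/-- The primitive in `t` that vanishes for `t = 0`. -/
noncomputable def timePrimitive (u : ℝ × ℝ → ℂ) (p : ℝ × ℝ) : ℂ :=
  ∫ s in (0 : ℝ)..p.2, u (p.1, s)

section TimePrimitive

variable {u v : ℝ × ℝ → ℂ}

theorem continuous_timePrimitive (hu : Continuous u) : Continuous (timePrimitive u) := by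
  refine intervalIntegral.continuous_parametric_intervalIntegral_of_continuous
    (f := fun (p : ℝ × ℝ) s => u (p.1, s)) ?_ continuous_snd
  exact hu.comp (by fun_prop : Continuous fun r : (ℝ × ℝ) × ℝ => (r.1.1, r.2))

theorem timePrimitive_eq_zero (hu : ∀ p : ℝ × ℝ, p.2 ≤ 0 → u p = 0) {p : ℝ × ℝ} (hp : p.2 ≤ 0) :
    timePrimitive u p = 0 := by
  rw [timePrimitive, intervalIntegral.integral_congr (g := fun _ => (0 : ℂ)) (fun s hs => ?_)]
  · simp
  · rw [uIcc_of_ge hp] at hs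
    exact hu _ hs.2

theorem hasDerivAt_timePrimitive (hu : Continuous u) (x t : ℝ) :
    HasDerivAt (fun t => timePrimitive u (x, t)) (u (x, t)) t :=
  ((hu.comp (by fun_prop : Continuous fun s : ℝ => (x, s))).integral_hasStrictDerivAt 0 t).hasDerivAt

theorem timePrimitive_sub (hu : Continuous u) (hv : Continuous v) :
    timePrimitive (u - v) = timePrimitive u - timePrimitive v := by
  funext p
  exact intervalIntegral.integral_sub (Continuous.intervalIntegrable (by fun_prop) _ _)
    (Continuous.intervalIntegrable (by fun_prop) _ _)

theorem norm_timePrimitive_le (h0 : ∀ p : ℝ × ℝ, p.2 ≤ 0 → u p = 0)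
    {A B : ℝ} (hA : 0 ≤ A) (hB : 0 < B) (h : ∀ p, ‖u p‖ ≤ A * Real.exp (B * p.2)) (p : ℝ × ℝ) :
    ‖timePrimitive u p‖ ≤ A / B * Real.exp (B * p.2) := by
  rcases le_or_gt p.2 0 with hp | hp
  · rw [timePrimitive_eq_zero h0 hp, norm_zero]
    positivity
  · have h1 : ‖timePrimitive u p‖ ≤ ∫ s in (0 : ℝ)..p.2, A * Real.exp (B * s) :=
      intervalIntegral.norm_integral_le_of_norm_le hp.le
        (Eventually.of_forall fun s _ => h (p.1, s))
        (Continuous.intervalIntegrable (by fun_prop) _ _)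
    have h2 := intervalIntegral.integral_eq_sub_of_hasDerivAt (a := 0) (b := p.2)
      (f := fun s => A / B * Real.exp (B * s)) (f' := fun s => A * Real.exp (B * s))
      (fun s _ => by
        have := (((hasDerivAt_id s).const_mul B).exp).const_mul (A / B)
        refine this.congr_deriv ?_
        field_simp
        simp) (Continuous.intervalIntegrable (by fun_prop) _ _)
    rw [h2] at h1
    have : 0 ≤ A / B * Real.exp (B * 0) := by positivity
    linarith

theorem continuous_iterate_timePrimitive (hu : Continuous u) (j : ℕ) :
    Continuous (timePrimitive^[j] u) := by
  induction j with
  | zero => exact hu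
  | succ j ih => rw [Function.iterate_succ_apply']; exact continuous_timePrimitive ih

theorem iterate_timePrimitive_eq_zero (hu : ∀ p : ℝ × ℝ, p.2 ≤ 0 → u p = 0) (j : ℕ) :
    ∀ p : ℝ × ℝ, p.2 ≤ 0 → timePrimitive^[j] u p = 0 := by
  induction j with
  | zero => exact hu
  | succ j ih => rw [Function.iterate_succ_apply']; exact fun p hp => timePrimitive_eq_zero ih hp

theorem iterate_timePrimitive_sub (hu : Continuous u) (hv : Continuous v) (j : ℕ) :
    timePrimitive^[j] (u - v) = timePrimitive^[j] u - timePrimitive^[j] v := by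
  induction j with
  | zero => rfl
  | succ j ih =>
    rw [Function.iterate_succ_apply', Function.iterate_succ_apply', Function.iterate_succ_apply',
      ih, timePrimitive_sub (continuous_iterate_timePrimitive hu j)
        (continuous_iterate_timePrimitive hv j)]

theorem norm_iterate_timePrimitive_le
    (h0 : ∀ p : ℝ × ℝ, p.2 ≤ 0 → u p = 0) {A B : ℝ} (hA : 0 ≤ A) (hB : 1 ≤ B)
    (h : ∀ p, ‖u p‖ ≤ A * Real.exp (B * p.2)) (j : ℕ) (p : ℝ × ℝ) :
    ‖timePrimitive^[j] u p‖ ≤ A * Real.exp (B * p.2) := by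
  induction j generalizing p with
  | zero => exact h p
  | succ j ih =>
    rw [Function.iterate_succ_apply']
    refine (norm_timePrimitive_le (iterate_timePrimitive_eq_zero h0 j) hA (by linarith) ih
      p).trans ?_
    gcongr
    exact div_le_self hA hB

theorem norm_iterate_succ_timePrimitive_le
    (h0 : ∀ p : ℝ × ℝ, p.2 ≤ 0 → u p = 0) {A B : ℝ} (hA : 0 ≤ A) (hB : 1 ≤ B)
    (h : ∀ p, ‖u p‖ ≤ A * Real.exp (B * p.2)) (j : ℕ) (p : ℝ × ℝ) :
    ‖timePrimitive^[j + 1] u p‖ ≤ A / B * Real.exp (B * p.2) := by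
  rw [Function.iterate_succ_apply']
  exact norm_timePrimitive_le (iterate_timePrimitive_eq_zero h0 j) hA (by linarith)
    (norm_iterate_timePrimitive_le h0 hA hB h j) p

end TimePrimitive

/-- The inhomogeneous operator `u ↦ ∑ j < J, c_j I^j u + G`, where `I` is the primitive in `t`.
The term `j = 0` is a multiplication operator. The terms of higher order appear when the system
is rewritten as a system for the derivatives in `t`. -/
noncomputable def volterra {ι : Type*} [Fintype ι] (J : ℕ) (c : ℕ → ι → ι → ℝ × ℝ → ℂ)
    (G : ι → ℝ × ℝ → ℂ) (u : ι → ℝ × ℝ → ℂ) (i : ι) (p : ℝ × ℝ) : ℂ :=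
  ∑ j ∈ Finset.range J, ∑ k, c j i k p * timePrimitive^[j] (u k) p + G i p

/-- The derivative in `t` of `volterra J c G u` as a function of the derivative `w` of `u`, if
`c'` and `G'` are the derivatives of `c` and `G`. -/
noncomputable def volterraDeriv {ι : Type*} [Fintype ι] (J : ℕ) (c c' : ℕ → ι → ι → ℝ × ℝ → ℂ)
    (G' : ι → ℝ × ℝ → ℂ) (w : ι → ℝ × ℝ → ℂ) (i : ι) (p : ℝ × ℝ) : ℂ :=
  ∑ j ∈ Finset.range J, ∑ k, (c j i k p * timePrimitive^[j] (w k) p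
    + c' j i k p * timePrimitive^[j + 1] (w k) p) + G' i p

theorem isCausal_timePrimitive {ι : Type*} {w : ι → ℝ × ℝ → ℂ} (hw : IsCausal w) :
    IsCausal fun k => timePrimitive (w k) :=
  ⟨fun k => continuous_timePrimitive (hw.1 k), fun k _ hp => timePrimitive_eq_zero (hw.2 k) hp⟩

section Volterra

variable {ι : Type*} [Fintype ι] {J : ℕ} {c c' : ℕ → ι → ι → ℝ × ℝ → ℂ}
  {G G' : ι → ℝ × ℝ → ℂ} {w w' : ι → ℝ × ℝ → ℂ}

theorem hasDerivAt_volterra (hc : ∀ j i k, IsTimeDiff (c j i k) (c' j i k))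
    (hG : ∀ i, IsTimeDiff (G i) (G' i)) (hw : IsCausal w) (i : ι) (x t : ℝ) :
    HasDerivAt (fun t => volterra J c G (fun k => timePrimitive (w k)) i (x, t))
      (volterraDeriv J c c' G' w i (x, t)) t := by
  unfold volterra volterraDeriv
  refine HasDerivAt.add (HasDerivAt.fun_sum fun j _ => HasDerivAt.fun_sum fun k _ => ?_)
    ((hG i).deriv x t)
  have h1 := hasDerivAt_timePrimitive (continuous_iterate_timePrimitive (hw.1 k) j) x t
  have h2 := ((hc j i k).deriv x t).mul h1
  simp only [← Function.iterate_succ_apply' timePrimitive] at h2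
  refine h2.congr_deriv ?_
  rw [add_comm]

theorem isCausal_volterra (hc : ∀ j i k, Continuous (c j i k))
    (hG : IsCausal G) (hw : IsCausal w) : IsCausal (volterra J c G w) := by
  refine ⟨fun i => ?_, fun i p hp => ?_⟩
  · unfold volterra
    exact (continuous_finsetSum _ fun j _ => continuous_finsetSum _ fun k _ =>
      (hc j i k).mul (continuous_iterate_timePrimitive (hw.1 k) j)).add (hG.1 i)
  · simp [volterra, hG.2 i p hp, fun j k => iterate_timePrimitive_eq_zero (hw.2 k) j p hp]

theorem isCausal_volterraDeriv (hc : ∀ j i k, IsTimeDiff (c j i k) (c' j i k))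
    (hG' : IsCausal G') (hw : IsCausal w) : IsCausal (volterraDeriv J c c' G' w) := by
  refine ⟨fun i => ?_, fun i p hp => ?_⟩
  · unfold volterraDeriv
    exact (continuous_finsetSum _ fun j _ => continuous_finsetSum _ fun k _ =>
      ((hc j i k).cont.mul (continuous_iterate_timePrimitive (hw.1 k) j)).add
      ((hc j i k).cont'.mul (continuous_iterate_timePrimitive (hw.1 k) (j + 1)))).add (hG'.1 i)
  · simp only [volterraDeriv, hG'.2 i p hp,
      fun j k => iterate_timePrimitive_eq_zero (hw.2 k) j p hp, mul_zero, add_zero,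
      Finset.sum_const_zero]

theorem norm_volterraDeriv_sub_le {K A B M : ℝ} (hA : 0 ≤ A) (hB : 1 ≤ B)
    (hc : ∀ j < J, ∀ i k p, ‖c j i k p‖ ≤ K ∧ ‖c' j i k p‖ ≤ K)
    (hw : IsCausal w) (hw' : IsCausal w')
    (h : ∀ i p, ‖w i p - w' i p‖ ≤ A * Real.exp (B * p.2)) (i : ι) (p : ℝ × ℝ)
    (hAM : A / B * Real.exp (B * p.2) ≤ M)
    (h0 : ∀ k, c 0 i k p = 0 ∨ ‖w k p - w' k p‖ ≤ M) :
    ‖volterraDeriv J c c' G' w i p - volterraDeriv J c c' G' w' i p‖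
      ≤ 2 * K * J * Fintype.card ι * M := by
  have hM : 0 ≤ M := le_trans (by positivity) hAM
  have hsub : ∀ k j, timePrimitive^[j] (w k) p - timePrimitive^[j] (w' k) p
      = timePrimitive^[j] (w k - w' k) p := fun k j => by
    rw [iterate_timePrimitive_sub (hw.1 k) (hw'.1 k)]; rfl
  have hb : ∀ k j, ‖timePrimitive^[j + 1] (w k - w' k) p‖ ≤ M := fun k j =>
    (norm_iterate_succ_timePrimitive_le
      (fun p hp => by simp [hw.2 k p hp, hw'.2 k p hp]) hA hB (h k) j p).trans hAM
  have e : volterraDeriv J c c' G' w i p - volterraDeriv J c c' G' w' i p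
      = ∑ j ∈ Finset.range J, ∑ k, (c j i k p * timePrimitive^[j] (w k - w' k) p
        + c' j i k p * timePrimitive^[j + 1] (w k - w' k) p) := by
    simp only [volterraDeriv, add_sub_add_right_eq_sub, ← hsub, ← Finset.sum_sub_distrib]
    refine Finset.sum_congr rfl fun j _ => Finset.sum_congr rfl fun k _ => ?_
    ring
  rw [e]
  have hterm : ∀ j ∈ Finset.range J, ∀ k, ‖c j i k p * timePrimitive^[j] (w k - w' k) p
        + c' j i k p * timePrimitive^[j + 1] (w k - w' k) p‖ ≤ 2 * K * M := fun j hj k => by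
    have hj := Finset.mem_range.1 hj
    have h1 := hc j hj i k p
    have hK : 0 ≤ K := (norm_nonneg _).trans h1.1
    have h2 : ‖c' j i k p * timePrimitive^[j + 1] (w k - w' k) p‖ ≤ K * M := by
      rw [norm_mul]
      exact mul_le_mul h1.2 (hb k j) (norm_nonneg _) hK
    have h3 : ‖c j i k p * timePrimitive^[j] (w k - w' k) p‖ ≤ K * M := by
      rw [norm_mul]
      rcases j with _ | j
      · rcases h0 k with h4 | h4
        · rw [h4, norm_zero, zero_mul]; positivity
        · exact mul_le_mul h1.1 h4 (norm_nonneg _) hK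
      · exact mul_le_mul h1.1 (hb k j) (norm_nonneg _) hK
    linarith [norm_add_le (c j i k p * timePrimitive^[j] (w k - w' k) p)
      (c' j i k p * timePrimitive^[j + 1] (w k - w' k) p)]
  refine (norm_sum_le_of_le _ fun j hj => norm_sum_le_of_le _ fun k _ => hterm j hj k).trans
    (le_of_eq ?_)
  simp only [Finset.sum_const, Finset.card_range, Finset.card_univ, nsmul_eq_mul]
  ring

end Volterra

/-- A positive `C¹` function on a rectangle has an extension, differentiable in `t`,
that is bounded away from zero: the exponential of an extension of the logarithm. -/
theorem exists_extension_of_pos {X T : ℝ} (hX : 0 < X) (hT : 0 < T) {μ : ℝ × ℝ → ℝ}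
    (hμ : ContDiffOn ℝ 1 μ (rect X T)) (h : ∀ p ∈ rect X T, 0 < μ p) :
    ∃ (h h' : ℝ × ℝ → ℝ) (m : ℝ), IsTimeDiff h h' ∧ EqOn h μ (rect X T) ∧ 0 < m ∧
      ∀ p, m ≤ h p := by
  obtain ⟨g, g', hg, hgμ, -⟩ := exists_extension hX hT
    (hμ.log fun p hp => (h p hp).ne')
  obtain ⟨C, hC⟩ := hg.bdd
  obtain ⟨C', hC'⟩ := hg.bdd'
  have h1 : ∀ p, Real.exp (g p) ≤ Real.exp C := fun p =>
    Real.exp_le_exp.2 ((le_abs_self _).trans (hC p))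
  refine ⟨fun p => Real.exp (g p), fun p => Real.exp (g p) * g' p, Real.exp (-C),
    ⟨Real.continuous_exp.comp hg.cont, (Real.continuous_exp.comp hg.cont).mul hg.cont',
    ⟨Real.exp C, fun p => ?_⟩, ⟨Real.exp C * C', fun p => ?_⟩, fun x t => (hg.deriv x t).exp⟩,
    fun p hp => ?_, Real.exp_pos _, fun p => Real.exp_le_exp.2 ?_⟩
  · rw [Real.norm_of_nonneg (Real.exp_pos _).le]
    exact h1 p
  · rw [norm_mul, Real.norm_of_nonneg (Real.exp_pos _).le]
    exact mul_le_mul (h1 p) (hC' p) (norm_nonneg _) (Real.exp_pos _).le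
  · simp only [hgμ hp, Real.exp_log (h p hp)]
  · linarith [(abs_le.1 (hC p)).1]

theorem IsTimeDiff.neg {E : Type*} [NormedAddCommGroup E] [NormedSpace ℝ E] {g g' : ℝ × ℝ → E}
    (h : IsTimeDiff g g') : IsTimeDiff (-g) (-g') :=
  ⟨h.cont.neg, h.cont'.neg, by simpa using h.bdd, by simpa using h.bdd',
    fun x t => (h.deriv x t).neg⟩

theorem isTimeDiff_zero {E : Type*} [NormedAddCommGroup E] [NormedSpace ℝ E] :
    IsTimeDiff (0 : ℝ × ℝ → E) 0 :=
  ⟨continuous_zero, continuous_zero, ⟨0, by simp⟩, ⟨0, by simp⟩, fun _ _ => hasDerivAt_const _ _⟩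

theorem exists_common_bound {α : Type*} [Finite α] {β : Type*} {E : α → Type*}
    [∀ a, NormedAddCommGroup (E a)] (f : ∀ a, β → E a) (h : ∀ a, ∃ C, ∀ b, ‖f a b‖ ≤ C) :
    ∃ C, 0 ≤ C ∧ ∀ a b, ‖f a b‖ ≤ C := by
  choose C hC using h
  obtain ⟨M, hM⟩ := Finite.exists_le C
  exact ⟨max M 0, le_max_right _ _, fun a b => (hC a b).trans ((hM a).trans (le_max_left _ _))⟩

/-- Existence of continuously differentiable solutions in a strip, for data that vanish to second
order for `t = 0`. The components with `pos i` are prescribed for `x = 0`, the others vanish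
for `x = X`. The solution is given by its derivative `w` in `t`. -/
theorem exists_causal_solution {ι : Type*} [Fintype ι] {pos : ι → Prop} {X T : ℝ} (hX : 0 < X)
    (hT : 0 < T) {J : ℕ} {μ : ι → ℝ × ℝ → ℝ} {c d : ℕ → ι → ι → ℝ × ℝ → ℂ}
    {G H : ι → ℝ × ℝ → ℂ} (hμ : ∀ i, ContDiffOn ℝ 1 (μ i) (rect X T))
    (hpos : ∀ i, pos i → ∀ p ∈ rect X T, 0 < μ i p)
    (hneg : ∀ i, ¬ pos i → ∀ p ∈ rect X T, μ i p < 0)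
    (hc : ∀ j i k, ContDiffOn ℝ 1 (c j i k) (rect X T))
    (hd : ∀ j i k, ContDiffOn ℝ 1 (d j i k) (rect X T))
    (hd0 : ∀ i k, pos k → d 0 i k = 0)
    (hG : ∀ i, ContDiffOn ℝ 1 (G i) (rect X T)) (hH : ∀ i, ContDiffOn ℝ 1 (H i) (rect X T))
    (hG0 : ∀ i, ∀ x ∈ Icc 0 X, G i (x, 0) = 0 ∧ rectDt X T (G i) (x, 0) = 0)
    (hH0 : ∀ i, ∀ x ∈ Icc 0 X, H i (x, 0) = 0 ∧ rectDt X T (H i) (x, 0) = 0) :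
    ∃ w : ι → ℝ × ℝ → ℂ, IsCausal w ∧
      (∀ i, ∀ x ∈ Icc 0 X, ∀ t ∈ Icc 0 T,
        HasDerivWithinAt (fun x => timePrimitive (w i) (x, t))
        (volterra J c G (fun k => timePrimitive (w k)) i (x, t) - μ i (x, t) * w i (x, t))
        (Icc 0 X) x) ∧
      (∀ i, pos i → ∀ t ∈ Icc 0 T, timePrimitive (w i) (0, t)
        = volterra J d H (fun k => timePrimitive (w k)) i (0, t)) ∧
      ∀ i, ¬ pos i → ∀ t, timePrimitive (w i) (X, t) = 0 := by
  classical
  have hμe : ∀ i, ∃ (h h' : ℝ × ℝ → ℝ) (m : ℝ), IsTimeDiff h h' ∧ EqOn h (μ i) (rect X T) ∧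
      0 < m ∧ (pos i → ∀ p, m ≤ h p) ∧ (¬ pos i → ∀ p, h p ≤ -m) := fun i => by
    by_cases hi : pos i
    · obtain ⟨h, h', m, h1, h2, h3, h4⟩ := exists_extension_of_pos hX hT (hμ i) (hpos i hi)
      exact ⟨h, h', m, h1, h2, h3, fun _ => h4, fun h => absurd hi h⟩
    · obtain ⟨h, h', m, h1, h2, h3, h4⟩ := exists_extension_of_pos hX hT (hμ i).neg
        (fun p hp => neg_pos.2 (hneg i hi p hp))
      exact ⟨-h, -h', m, h1.neg, fun p hp => by simp [h2 hp], h3, fun h => absurd h hi,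
        fun _ p => neg_le_neg (h4 p)⟩
  choose μe μe' m₀ hμe hμeq hm₀ hmpos hmneg using hμe
  obtain ⟨m, hm, hm'⟩ : ∃ m : ℝ, 0 < m ∧ ∀ i, m ≤ m₀ i := by
    have h0 : ∀ i, 0 ≤ (m₀ i)⁻¹ := fun i => (inv_pos.2 (hm₀ i)).le
    have h1 : 0 < ∑ i, (m₀ i)⁻¹ + 1 := by
      have := Finset.sum_nonneg fun i (_ : i ∈ Finset.univ) => h0 i
      linarith
    refine ⟨(∑ i, (m₀ i)⁻¹ + 1)⁻¹, inv_pos.2 h1, fun i => ?_⟩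
    rw [inv_le_comm₀ h1 (hm₀ i)]
    have := Finset.single_le_sum (f := fun i => (m₀ i)⁻¹) (fun i _ => h0 i) (Finset.mem_univ i)
    linarith
  have hfl : ∀ i, Nonempty (Flow X (μe i)) := fun i => by
    obtain ⟨M, hM⟩ := (hμe i).bdd
    obtain ⟨K, hK⟩ := (hμe i).bdd'
    exact exists_flow hX (hμe i).cont (hμe i).cont' hM hK (hμe i).deriv
  let fl : ∀ i, Flow X (μe i) := fun i => (hfl i).some
  -- The coefficients are extended to the plane; `G` and `H` vanish to second order for `t = 0`, so
  -- that their extensions by zero to `t ≤ 0` are admissible.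
  choose ce ce' hce hceq hce0 using fun j i k => exists_extension hX hT (hc j i k)
  choose Ge Ge' hGe hGeq hGe0 using fun i => exists_extension hX hT (hG i)
  choose He He' hHe hHeq hHe0 using fun i => exists_extension hX hT (hH i)
  have hde : ∀ j i k, ∃ h h' : ℝ × ℝ → ℂ, IsTimeDiff h h' ∧ EqOn h (d j i k) (rect X T) ∧
      (j = 0 → pos k → h = 0) := fun j i k => by
    by_cases h : j = 0 ∧ pos k
    · refine ⟨0, 0, isTimeDiff_zero, fun p _ => ?_, fun _ _ => rfl⟩
      rw [h.1, hd0 i k h.2]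
    · obtain ⟨e, e', h1, h2, -⟩ := exists_extension hX hT (hd j i k)
      exact ⟨e, e', h1, h2, fun h3 h4 => absurd ⟨h3, h4⟩ h⟩
  choose de de' hde hdeq hde0 using hde
  have hGec : IsCausal Ge ∧ IsCausal Ge' :=
    ⟨⟨fun i => (hGe i).cont, fun i p hp => (hGe0 i (hG0 i) p hp).1⟩,
      ⟨fun i => (hGe i).cont', fun i p hp => (hGe0 i (hG0 i) p hp).2⟩⟩
  have hHec : IsCausal He ∧ IsCausal He' :=
    ⟨⟨fun i => (hHe i).cont, fun i p hp => (hHe0 i (hH0 i) p hp).1⟩,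
      ⟨fun i => (hHe i).cont', fun i p hp => (hHe0 i (hH0 i) p hp).2⟩⟩
  obtain ⟨K₁, hK₁0, hK₁⟩ := exists_common_bound (α := Fin J × ι × ι)
    (fun a p => (ce a.1 a.2.1 a.2.2 p, ce' a.1 a.2.1 a.2.2 p, de a.1 a.2.1 a.2.2 p,
      de' a.1 a.2.1 a.2.2 p)) (fun a => by
      obtain ⟨C1, h1⟩ := (hce a.1 a.2.1 a.2.2).bdd
      obtain ⟨C2, h2⟩ := (hce a.1 a.2.1 a.2.2).bdd'
      obtain ⟨C3, h3⟩ := (hde a.1 a.2.1 a.2.2).bdd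
      obtain ⟨C4, h4⟩ := (hde a.1 a.2.1 a.2.2).bdd'
      exact ⟨max C1 (max C2 (max C3 C4)), fun p => max_le_max (h1 p) (max_le_max (h2 p)
        (max_le_max (h3 p) (h4 p)))⟩)
  obtain ⟨K₂, hK₂0, hK₂⟩ := exists_common_bound (fun i p => (Ge' i p, He' i p)) (fun i => by
      obtain ⟨C1, h1⟩ := (hGe i).bdd'
      obtain ⟨C2, h2⟩ := (hHe i).bdd'
      exact ⟨max C1 C2, fun p => max_le_max (h1 p) (h2 p)⟩)
  have hKc : ∀ j < J, ∀ i k p, ‖ce j i k p‖ ≤ K₁ ∧ ‖ce' j i k p‖ ≤ K₁ := fun j hj i k p => by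
    have h1 := hK₁ (⟨j, hj⟩, i, k) p
    exact ⟨(norm_fst_le _).trans h1, (norm_fst_le _).trans ((norm_snd_le _).trans h1)⟩
  have hKd : ∀ j < J, ∀ i k p, ‖de j i k p‖ ≤ K₁ ∧ ‖de' j i k p‖ ≤ K₁ := fun j hj i k p => by
    have h1 := (norm_snd_le _).trans ((norm_snd_le _).trans (hK₁ (⟨j, hj⟩, i, k) p))
    exact ⟨(norm_fst_le _).trans h1, (norm_snd_le _).trans h1⟩
  set C : ℝ := 2 * K₁ * J * Fintype.card ι + K₂ with hC
  have hC0 : 0 ≤ 2 * K₁ * J * Fintype.card ι := by positivity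
  have hzero : ∀ c c' : ℕ → ι → ι → ℝ × ℝ → ℂ, ∀ F : ι → ℝ × ℝ → ℂ, ∀ i p,
      volterraDeriv J c c' F 0 i p = F i p := fun c c' F i p => by
    have hj : ∀ j q, timePrimitive^[j] (0 : ℝ × ℝ → ℂ) q = 0 := fun j => by
      induction j with
      | zero => exact fun q => rfl
      | succ j ih =>
        intro q
        rw [Function.iterate_succ_apply', timePrimitive]
        simp [ih]
    simp [volterraDeriv, -Function.iterate_succ, hj]
  obtain ⟨w, hw, hfix⟩ := exists_causal_fixed_point (pos := pos) (C := C) hX hm fl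
    (fun i hi p => (hm' i).trans (hmpos i hi p))
    (fun i hi p => (hmneg i hi p).trans (neg_le_neg (hm' i)))
    (D := volterraDeriv J ce ce' Ge') (N := fun w i t => volterraDeriv J de de' He' w i (0, t))
    (fun w hw => isCausal_volterraDeriv hce hGec.2 hw)
    (fun w hw i => ⟨((isCausal_volterraDeriv hde hHec.2 hw).1 i).comp
      (by fun_prop : Continuous fun t : ℝ => ((0 : ℝ), t)),
      fun t ht => (isCausal_volterraDeriv hde hHec.2 hw).2 i (0, t) ht⟩)
    (by positivity)
    (fun B hB w w' hw hw' A hA h i p => by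
      have hB0 : 0 < B := zero_lt_one.trans_le hB
      refine (norm_volterraDeriv_sub_le hA hB hKc hw hw' h i p (M := A * Real.exp (B * p.2))
        (by gcongr; exact div_le_self hA hB) fun k => Or.inr (h k p)).trans ?_
      rw [← mul_assoc]
      gcongr
      linarith)
    (fun B hB w w' hw hw' A A' hA hA' h h' i t => by
      have hB0 : 0 < B := zero_lt_one.trans_le hB
      refine (norm_volterraDeriv_sub_le hA hB hKd hw hw' h i (0, t)
        (M := (A' + A / B) * Real.exp (B * t))
        (by simp only; gcongr; linarith) fun k => ?_).trans ?_
      · by_cases hk : pos k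
        · left; rw [hde0 0 i k rfl hk]; rfl
        · right
          refine (h' k hk (0, t)).trans ?_
          have : 0 ≤ A / B := by positivity
          simp only
          gcongr
          linarith
      · rw [← mul_assoc]
        gcongr
        linarith)
    (fun i p => by
      rw [hzero]
      exact (norm_fst_le _).trans ((hK₂ i p).trans (by linarith)))
    (fun i t => by
      rw [hzero]
      exact (norm_snd_le _).trans ((hK₂ i (0, t)).trans (by linarith)))
  have hu := isCausal_timePrimitive hw
  set u : ι → ℝ × ℝ → ℂ := fun k => timePrimitive (w k) with hudef
  set F := volterra J ce Ge u with hF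
  set F' := volterraDeriv J ce ce' Ge' w with hF'
  set b : ι → ℝ → ℂ := fun i t => if pos i then volterra J de He u i (0, t) else 0 with hb
  set b' : ι → ℝ → ℂ := fun i t => if pos i then volterraDeriv J de de' He' w i (0, t) else 0
    with hb'
  set o : ι → ℝ := fun i => if pos i then 0 else X with ho
  have hw' : ∀ i, w i = (fl i).solveDeriv (o i) (b' i) (F' i) := fun i => by
    rw [hfix i]
    by_cases h : pos i
    · simp only [h, if_true, hb', ho, hF']
    · simp only [h, if_false, hb', ho, hF']; rfl
  have hFc : IsCausal F := isCausal_volterra (fun j i k => (hce j i k).cont) hGec.1 hu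
  have hF'c : IsCausal F' := isCausal_volterraDeriv hce hGec.2 hw
  have hFd : ∀ i x t, HasDerivAt (fun t => F i (x, t)) (F' i (x, t)) t :=
    hasDerivAt_volterra hce hGe hw
  have hbd : ∀ i t, HasDerivAt (b i) (b' i t) t := fun i t => by
    by_cases h : pos i
    · simp only [hb, hb', h, if_true]
      exact hasDerivAt_volterra hde hHe hw i 0 t
    · simp only [hb, hb', h, if_false]
      exact hasDerivAt_const _ _
  have hb'c : ∀ i, Continuous (b' i) := fun i => by
    by_cases h : pos i
    · simp only [hb', h, if_true]
      exact ((isCausal_volterraDeriv hde hHec.2 hw).1 i).comp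
        (by fun_prop : Continuous fun t : ℝ => ((0 : ℝ), t))
    · simp only [hb', h, if_false]
      exact continuous_const
  have hcausal : ∀ i, (fl i).Causal (o i) m := fun i => by
    by_cases h : pos i
    · simp only [ho, h, if_true]
      exact (fl i).causal_zero hX fun p => (hm' i).trans (hmpos i h p)
    · simp only [ho, h, if_false]
      exact (fl i).causal_right hX fun p => (hmneg i h p).trans (neg_le_neg (hm' i))
  -- The solution of the transport equation for `u i` has the time derivative `w i` and vanishes for
  -- `t = 0`, therefore it is the primitive `u i` of `w i`.
  have hsol : ∀ i, u i = (fl i).solve (o i) (b i) (F i) := fun i => by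
    funext p
    obtain ⟨x, t⟩ := p
    have h1 : (fl i).solve (o i) (b i) (F i) (x, 0) = 0 := by
      refine (hcausal i).solve_eq_zero hm.le (hFc.2 i) le_rfl ?_
      by_cases h : pos i
      · have h2 := hcausal i
        simp only [ho, h, if_true] at h2
        simp only [hb, h, if_true]
        exact (isCausal_volterra (fun j i k => (hde j i k).cont) hHec.1 hu).2 i (0, _)
          (h2.σ_le (fl i) hm.le (x, 0))
      · simp only [hb, h, if_false]
    have h2 := intervalIntegral.integral_eq_sub_of_hasDerivAt (a := 0) (b := t)
      (f := fun t => (fl i).solve (o i) (b i) (F i) (x, t)) (f' := fun t => w i (x, t))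
      (fun s _ => by
        rw [hw' i]
        exact (fl i).hasDerivAt_solve (hbd i) (hFc.1 i) (hF'c.1 i) (hFd i) x s)
      (Continuous.intervalIntegrable ((hw.1 i).comp (by fun_prop)) _ _)
    rw [h1, sub_zero] at h2
    exact h2
  have hvol : ∀ (c ce : ℕ → ι → ι → ℝ × ℝ → ℂ) (G Ge : ι → ℝ × ℝ → ℂ),
      (∀ j i k, EqOn (ce j i k) (c j i k) (rect X T)) → (∀ i, EqOn (Ge i) (G i) (rect X T)) →
      ∀ i, ∀ p ∈ rect X T, volterra J ce Ge u i p = volterra J c G u i p :=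
    fun c ce G Ge h1 h2 i p hp => by
    simp only [volterra, h2 i hp, fun j k => h1 j i k hp]
  refine ⟨w, hw, fun i x hx t ht => ?_, fun i hi t ht => ?_, fun i hi t => ?_⟩
  · have h1 := (fl i).hasDerivWithinAt_solve (o := o i) (hbd i) (hFc.1 i) (hb'c i) (hF'c.1 i)
      (hFd i) hx t
    have hp : (x, t) ∈ rect X T := ⟨hx, ht⟩
    rw [← hsol i, ← hw' i, hμeq i hp, hF, hvol c ce G Ge hceq hGeq i _ hp] at h1
    exact h1
  · have hp : ((0 : ℝ), t) ∈ rect X T := ⟨⟨le_rfl, hX.le⟩, ht⟩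
    have h1 : u i (0, t) = b i t := by
      have h2 := (fl i).solve_boundary (o := 0) (b := b i) (F := F i) ⟨le_rfl, hX.le⟩ t
      rw [(fl i).σ_zero] at h2
      rw [hsol i, ← h2]
      simp only [ho, hi, if_true]
    rw [← hvol d de H He hdeq hHeq i _ hp]
    simp only [hb, hi, if_true] at h1
    exact h1
  · have h2 := (fl i).solve_boundary (o := X) (b := b i) (F := F i) ⟨hX.le, le_rfl⟩ t
    change u i (X, t) = 0
    have h3 : o i = X := by simp only [ho, hi, if_false]
    rw [hsol i, h3, h2]
    simp only [hb, hi, if_false]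

/-! ### Regularity of the solutions on a rectangle -/

section Partial

variable {E : Type*} [NormedAddCommGroup E] [NormedSpace ℝ E] {X T : ℝ} {f fx ft : ℝ × ℝ → E}

/-- A function on a rectangle with continuous partial derivatives is differentiable, up to the
boundary. -/
theorem hasFDerivWithinAt_of_partial
    (hx : ∀ x ∈ Icc 0 X, ∀ t ∈ Icc 0 T,
      HasDerivWithinAt (fun x => f (x, t)) (fx (x, t)) (Icc 0 X) x)
    (ht : ∀ x ∈ Icc 0 X, ∀ t ∈ Icc 0 T,
      HasDerivWithinAt (fun t => f (x, t)) (ft (x, t)) (Icc 0 T) t)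
    (hfx : ContinuousOn fx (rect X T)) (hft : ContinuousOn ft (rect X T))
    {p : ℝ × ℝ} (hp : p ∈ rect X T) :
    HasFDerivWithinAt f ((ContinuousLinearMap.fst ℝ ℝ ℝ).smulRight (fx p)
      + (ContinuousLinearMap.snd ℝ ℝ ℝ).smulRight (ft p)) (rect X T) p := by
  obtain ⟨x, t⟩ := p
  rw [hasFDerivWithinAt_iff_isLittleO, Asymptotics.isLittleO_iff]
  intro ε hε
  obtain ⟨δ₁, hδ₁, h1⟩ := Metric.continuousWithinAt_iff.1 (hfx _ hp) (ε / 2) (by positivity)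
  obtain ⟨δ₂, hδ₂, h2⟩ := Metric.continuousWithinAt_iff.1 (hft _ hp) (ε / 2) (by positivity)
  set δ := min δ₁ δ₂ with hδ
  have hδ0 : 0 < δ := lt_min hδ₁ hδ₂
  filter_upwards [inter_mem_nhdsWithin _ (Metric.ball_mem_nhds (x, t) hδ0)] with q hq
  obtain ⟨y, s⟩ := q
  obtain ⟨⟨hy, hs⟩, hb⟩ := hq
  simp only [Metric.mem_ball, Prod.dist_eq, max_lt_iff] at hb hy hs
  -- Move from `(x, t)` to `(x, s)` and then to `(y, s)`.
  have e1 : ‖(f (y, s) - y • fx (x, t)) - (f (x, s) - x • fx (x, t))‖ ≤ ε / 2 * ‖y - x‖ := by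
    refine Convex.norm_image_sub_le_of_norm_hasDerivWithin_le (s := Icc 0 X ∩ Metric.ball x δ)
      (f := fun y => f (y, s) - y • fx (x, t)) (f' := fun y => fx (y, s) - fx (x, t))
      (fun z hz => ?_) (fun z hz => ?_) ((convex_Icc _ _).inter (convex_ball _ _))
      ⟨hp.1, Metric.mem_ball_self hδ0⟩ ⟨hy, hb.1⟩
    · have := (hx z hz.1 s hs).fun_sub ((hasDerivWithinAt_id z _).smul_const (fx (x, t)))
      simpa using this.mono inter_subset_left
    · rw [← dist_eq_norm]
      refine (h1 (x := (z, s)) ⟨hz.1, hs⟩ ?_).le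
      rw [Prod.dist_eq, max_lt_iff]
      exact ⟨(Metric.mem_ball.1 hz.2).trans_le (min_le_left _ _), hb.2.trans_le (min_le_left _ _)⟩
  have e2 : ‖(f (x, s) - s • ft (x, t)) - (f (x, t) - t • ft (x, t))‖ ≤ ε / 2 * ‖s - t‖ := by
    refine Convex.norm_image_sub_le_of_norm_hasDerivWithin_le (s := Icc 0 T ∩ Metric.ball t δ)
      (f := fun s => f (x, s) - s • ft (x, t)) (f' := fun s => ft (x, s) - ft (x, t))
      (fun z hz => ?_) (fun z hz => ?_) ((convex_Icc _ _).inter (convex_ball _ _))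
      ⟨hp.2, Metric.mem_ball_self hδ0⟩ ⟨hs, hb.2⟩
    · have := (ht x hp.1 z hz.1).fun_sub ((hasDerivWithinAt_id z _).smul_const (ft (x, t)))
      simpa using this.mono inter_subset_left
    · rw [← dist_eq_norm]
      refine (h2 (x := (x, z)) ⟨hp.1, hz.1⟩ ?_).le
      rw [Prod.dist_eq, max_lt_iff, dist_self]
      exact ⟨hδ₂, (Metric.mem_ball.1 hz.2).trans_le (min_le_right _ _)⟩
  have e3 : f (y, s) - f (x, t) - ((ContinuousLinearMap.fst ℝ ℝ ℝ).smulRight (fx (x, t))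
      + (ContinuousLinearMap.snd ℝ ℝ ℝ).smulRight (ft (x, t))) ((y, s) - (x, t))
      = ((f (y, s) - y • fx (x, t)) - (f (x, s) - x • fx (x, t)))
        + ((f (x, s) - s • ft (x, t)) - (f (x, t) - t • ft (x, t))) := by
    simp [sub_smul]
    abel
  rw [e3]
  have n1 : ‖y - x‖ ≤ ‖(y, s) - (x, t)‖ := norm_fst_le ((y, s) - (x, t))
  have n2 : ‖s - t‖ ≤ ‖(y, s) - (x, t)‖ := norm_snd_le ((y, s) - (x, t))
  refine (norm_add_le _ _).trans ((add_le_add e1 e2).trans ?_)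
  nlinarith

theorem rectDx_eq (hX : 0 < X) {x t : ℝ} (hf : DifferentiableWithinAt ℝ f (rect X T) (x, t))
    (hx : x ∈ Icc 0 X) (ht : t ∈ Icc 0 T) {a : E}
    (h : HasDerivWithinAt (fun x => f (x, t)) a (Icc 0 X) x) : rectDx X T f (x, t) = a :=
  (uniqueDiffOn_Icc hX x hx).eq_deriv _ (hasDerivWithinAt_rectDx hf ht) h

theorem rectDt_eq (hT : 0 < T) {x t : ℝ} (hf : DifferentiableWithinAt ℝ f (rect X T) (x, t))
    (hx : x ∈ Icc 0 X) (ht : t ∈ Icc 0 T) {a : E}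
    (h : HasDerivWithinAt (fun t => f (x, t)) a (Icc 0 T) t) : rectDt X T f (x, t) = a :=
  (uniqueDiffOn_Icc hT t ht).eq_deriv _ (hasDerivWithinAt_rectDt hf hx) h

theorem contDiffOn_of_partial (hX : 0 < X) (hT : 0 < T) {k : ℕ}
    (hx : ∀ x ∈ Icc 0 X, ∀ t ∈ Icc 0 T,
      HasDerivWithinAt (fun x => f (x, t)) (fx (x, t)) (Icc 0 X) x)
    (ht : ∀ x ∈ Icc 0 X, ∀ t ∈ Icc 0 T,
      HasDerivWithinAt (fun t => f (x, t)) (ft (x, t)) (Icc 0 T) t)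
    (hfx : ContDiffOn ℝ k fx (rect X T)) (hft : ContDiffOn ℝ k ft (rect X T)) :
    ContDiffOn ℝ (k + 1) f (rect X T) := by
  refine (contDiffOn_succ_iff_hasFDerivWithinAt_of_uniqueDiffOn (uniqueDiffOn_rect hX hT)).2
    ⟨by simp, _, ?_, fun p hp => hasFDerivWithinAt_of_partial hx ht hfx.continuousOn
      hft.continuousOn hp⟩
  exact (contDiffOn_const.smulRight hfx).add (contDiffOn_const.smulRight hft)

end Partial

section TimePrimitiveOn

variable {X T : ℝ} {u v ux : ℝ × ℝ → ℂ}

theorem timePrimitive_congr (h : EqOn u v (rect X T)) :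
    EqOn (timePrimitive u) (timePrimitive v) (rect X T) := fun p hp => by
  refine intervalIntegral.integral_congr fun s hs => h ⟨hp.1, ?_⟩
  rw [uIcc_of_le hp.2.1] at hs
  exact ⟨hs.1, hs.2.trans hp.2.2⟩

theorem timePrimitive_zero_right (u : ℝ × ℝ → ℂ) (x : ℝ) : timePrimitive u (x, 0) = 0 := by
  simp [timePrimitive]

theorem exists_continuous_eqOn_rect (hX : 0 < X) (hT : 0 < T) (hu : ContinuousOn u (rect X T)) :
    ∃ v : ℝ × ℝ → ℂ, Continuous v ∧ EqOn v u (rect X T) :=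
  ⟨fun p => u (clamp X p.1, clamp T p.2), hu.comp_continuous
    (((continuous_clamp X).comp continuous_fst).prodMk ((continuous_clamp T).comp continuous_snd))
    fun p => ⟨clamp_mem hX.le _, clamp_mem hT.le _⟩,
    fun p hp => by simp only [clamp_eq hp.1, clamp_eq hp.2]⟩

theorem continuousOn_timePrimitive (hX : 0 < X) (hT : 0 < T) (hu : ContinuousOn u (rect X T)) :
    ContinuousOn (timePrimitive u) (rect X T) := by
  obtain ⟨v, hv, hvu⟩ := exists_continuous_eqOn_rect hX hT hu
  exact (continuous_timePrimitive hv).continuousOn.congr (timePrimitive_congr hvu.symm)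

theorem hasDerivWithinAt_timePrimitive (hX : 0 < X) (hT : 0 < T)
    (hu : ContinuousOn u (rect X T)) {x t : ℝ} (hx : x ∈ Icc 0 X) (ht : t ∈ Icc 0 T) :
    HasDerivWithinAt (fun t => timePrimitive u (x, t)) (u (x, t)) (Icc 0 T) t := by
  obtain ⟨v, hv, hvu⟩ := exists_continuous_eqOn_rect hX hT hu
  rw [← hvu ⟨hx, ht⟩]
  exact (hasDerivAt_timePrimitive hv x t).hasDerivWithinAt.congr
    (fun s hs => timePrimitive_congr hvu.symm ⟨hx, hs⟩) (timePrimitive_congr hvu.symm ⟨hx, ht⟩)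

/-- Differentiation under the integral sign, by Fubini's theorem. -/
theorem hasDerivWithinAt_timePrimitive_fst (hX : 0 < X) (hT : 0 < T)
    (hu : ContinuousOn u (rect X T)) (hux : ContinuousOn ux (rect X T))
    (h : ∀ x ∈ Icc 0 X, ∀ t ∈ Icc 0 T,
      HasDerivWithinAt (fun x => u (x, t)) (ux (x, t)) (Icc 0 X) x)
    {x t : ℝ} (hx : x ∈ Icc 0 X) (ht : t ∈ Icc 0 T) :
    HasDerivWithinAt (fun x => timePrimitive u (x, t)) (timePrimitive ux (x, t)) (Icc 0 X) x := by
  obtain ⟨v, hv, hvu⟩ := exists_continuous_eqOn_rect hX hT hu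
  obtain ⟨w, hw, hwu⟩ := exists_continuous_eqOn_rect hX hT hux
  have hX0 : (0 : ℝ) ∈ Icc 0 X := ⟨le_rfl, hX.le⟩
  have key : ∀ y ∈ Icc 0 X, timePrimitive u (y, t)
      = timePrimitive u (0, t) + ∫ z in (0 : ℝ)..y, timePrimitive w (z, t) := fun y hy => by
    have h1 : ∀ s ∈ Icc 0 T, ∫ z in (0 : ℝ)..y, w (z, s) = v (y, s) - v (0, s) := fun s hs => by
      refine intervalIntegral.integral_eq_sub_of_hasDerivAt_of_le hy.1 (f := fun z => v (z, s))
        (Continuous.continuousOn (by fun_prop)) (fun z hz => ?_)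
        (Continuous.intervalIntegrable (by fun_prop) _ _)
      have hz' : z ∈ Icc 0 X := ⟨hz.1.le, hz.2.le.trans hy.2⟩
      rw [hwu ⟨hz', hs⟩]
      exact ((h z hz' s hs).congr (fun a ha => hvu ⟨ha, hs⟩) (hvu ⟨hz', hs⟩)).hasDerivAt
        (Icc_mem_nhds hz.1 (hz.2.trans_le hy.2))
    have h2 : ∫ z in (0 : ℝ)..y, timePrimitive w (z, t)
        = ∫ s in (0 : ℝ)..t, ∫ z in (0 : ℝ)..y, w (z, s) := by
      refine MeasureTheory.intervalIntegral_intervalIntegral_swap (F := fun z s => w (z, s)) ?_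
      exact (hw.continuousOn.integrableOn_compact
        (isCompact_uIcc.prod isCompact_uIcc)).mono_set
        (prod_mono uIoc_subset_uIcc uIoc_subset_uIcc)
    have h3 : ∫ s in (0 : ℝ)..t, ∫ z in (0 : ℝ)..y, w (z, s)
        = ∫ s in (0 : ℝ)..t, (v (y, s) - v (0, s)) := by
      refine intervalIntegral.integral_congr fun s hs => h1 s ?_
      rw [uIcc_of_le ht.1] at hs
      exact ⟨hs.1, hs.2.trans ht.2⟩
    rw [h2, h3, intervalIntegral.integral_sub (Continuous.intervalIntegrable (by fun_prop) _ _)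
      (Continuous.intervalIntegrable (by fun_prop) _ _),
      timePrimitive_congr hvu.symm ⟨hy, ht⟩, timePrimitive_congr hvu.symm ⟨hX0, ht⟩]
    simp only [timePrimitive]
    ring
  rw [timePrimitive_congr hwu.symm ⟨hx, ht⟩]
  have hc : Continuous fun z => timePrimitive w (z, t) :=
    (continuous_timePrimitive hw).comp (by fun_prop)
  exact ((hc.integral_hasStrictDerivAt 0 x).hasDerivAt.const_add _).hasDerivWithinAt.congr key
    (key x hx)

theorem contDiffOn_timePrimitive (hX : 0 < X) (hT : 0 < T) {k : ℕ}
    (hu : ContDiffOn ℝ k u (rect X T)) : ContDiffOn ℝ k (timePrimitive u) (rect X T) := by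
  induction k generalizing u with
  | zero =>
    exact contDiffOn_zero.2 (continuousOn_timePrimitive hX hT (contDiffOn_zero.1 hu))
  | succ k ih =>
    rw [Nat.cast_succ] at hu ⊢
    have hd := hu.differentiableOn (by simp)
    have hx : ContDiffOn ℝ k (rectDx X T u) (rect X T) := contDiffOn_rectDx hX hT hu le_rfl
    exact contDiffOn_of_partial hX hT
      (fun x hx' t ht => hasDerivWithinAt_timePrimitive_fst hX hT hu.continuousOn hx.continuousOn
        (fun x hx t ht => hasDerivWithinAt_rectDx (hd _ ⟨hx, ht⟩) ht) hx' ht)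
      (fun x hx t ht => hasDerivWithinAt_timePrimitive hX hT hu.continuousOn hx ht)
      (ih hx) (hu.of_le (by exact_mod_cast Nat.le_succ k))

theorem contDiffOn_iterate_timePrimitive (hX : 0 < X) (hT : 0 < T) {k : ℕ}
    (hu : ContDiffOn ℝ k u (rect X T)) (j : ℕ) :
    ContDiffOn ℝ k (timePrimitive^[j] u) (rect X T) := by
  induction j with
  | zero => exact hu
  | succ j ih => rw [Function.iterate_succ_apply']; exact contDiffOn_timePrimitive hX hT ih

end TimePrimitiveOn

/-- The coefficients of the derivative in `t` of `∑ j, c_j I^j u`, as a Volterra operator acting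
on the derivative of `u`. -/
noncomputable def derivCoeff {ι : Type*} (X T : ℝ) (c : ℕ → ι → ι → ℝ × ℝ → ℂ) :
    ℕ → ι → ι → ℝ × ℝ → ℂ
  | 0 => c 0
  | j + 1 => fun i k p => c (j + 1) i k p + rectDt X T (c j i k) p

theorem contDiffOn_derivCoeff {ι : Type*} {X T : ℝ} {c : ℕ → ι → ι → ℝ × ℝ → ℂ}
    (hX : 0 < X) (hT : 0 < T)
    (hc : ∀ j i k, ContDiffOn ℝ ∞ (c j i k) (rect X T)) (j : ℕ) (i k : ι) :
    ContDiffOn ℝ ∞ (derivCoeff X T c j i k) (rect X T) := by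
  rcases j with _ | j
  · exact hc 0 i k
  · exact (hc (j + 1) i k).add (contDiffOn_rectDt hX hT (hc j i k) (by simp))

theorem derivCoeff_eq_zero {ι : Type*} {X T : ℝ} {J : ℕ}
    {c : ℕ → ι → ι → ℝ × ℝ → ℂ} (hc : ∀ j, J ≤ j → c j = 0) (j : ℕ) (hj : J + 1 ≤ j) :
    derivCoeff X T c j = 0 := by
  obtain ⟨j, rfl⟩ := Nat.exists_eq_succ_of_ne_zero (by omega : j ≠ 0)
  funext i k p
  have h1 : rectDt X T (0 : ℝ × ℝ → ℂ) p = 0 := by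
    simp [rectDt]
  simp [derivCoeff, hc j (by omega), hc (j + 1) (by omega), h1]

section VolterraOn

variable {ι : Type*} [Fintype ι] {X T : ℝ} {J : ℕ} {c : ℕ → ι → ι → ℝ × ℝ → ℂ}
  {G w : ι → ℝ × ℝ → ℂ}

theorem contDiffOn_volterra (hX : 0 < X) (hT : 0 < T) {k : ℕ}
    (hc : ∀ j i l, ContDiffOn ℝ k (c j i l) (rect X T)) (hG : ∀ i, ContDiffOn ℝ k (G i) (rect X T))
    (hw : ∀ i, ContDiffOn ℝ k (w i) (rect X T)) (i : ι) :
    ContDiffOn ℝ k (volterra J c G w i) (rect X T) :=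
  (ContDiffOn.sum fun j _ => ContDiffOn.sum fun l _ =>
    (hc j i l).mul (contDiffOn_iterate_timePrimitive hX hT (hw l) j)).add (hG i)

theorem hasDerivWithinAt_volterra (hX : 0 < X) (hT : 0 < T)
    (hc : ∀ j i k, ContDiffOn ℝ 1 (c j i k) (rect X T)) (hcJ : ∀ j, J ≤ j → c j = 0)
    (hG : ∀ i, ContDiffOn ℝ 1 (G i) (rect X T)) (hw : ∀ i, ContinuousOn (w i) (rect X T))
    (i : ι) {x t : ℝ} (hx : x ∈ Icc 0 X) (ht : t ∈ Icc 0 T) :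
    HasDerivWithinAt (fun t => volterra J c G (fun k => timePrimitive (w k)) i (x, t))
      (volterra (J + 1) (derivCoeff X T c) (fun i => rectDt X T (G i)) w i (x, t)) (Icc 0 T) t := by
  have hdiff : ∀ {g : ℝ × ℝ → ℂ}, ContDiffOn ℝ 1 g (rect X T) →
      HasDerivWithinAt (fun t => g (x, t)) (rectDt X T g (x, t)) (Icc 0 T) t := fun hg =>
    hasDerivWithinAt_rectDt (hg.differentiableOn one_ne_zero _ ⟨hx, ht⟩) hx
  have hit : ∀ j k, ContinuousOn (timePrimitive^[j] (w k)) (rect X T) := fun j k =>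
    (contDiffOn_iterate_timePrimitive hX hT (k := 0) (contDiffOn_zero.2 (hw k)) j).continuousOn
  have h1 : HasDerivWithinAt (fun t => volterra J c G (fun k => timePrimitive (w k)) i (x, t))
      (∑ j ∈ Finset.range J, ∑ k, (rectDt X T (c j i k) (x, t) * timePrimitive^[j + 1] (w k) (x, t)
        + c j i k (x, t) * timePrimitive^[j] (w k) (x, t)) + rectDt X T (G i) (x, t))
      (Icc 0 T) t := by
    unfold volterra
    refine HasDerivWithinAt.add (HasDerivWithinAt.fun_sum fun j _ =>
      HasDerivWithinAt.fun_sum fun k _ => ?_) (hdiff (hG i))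
    have h2 := (hdiff (hc j i k)).mul (hasDerivWithinAt_timePrimitive hX hT (hit j k) hx ht)
    simp only [← Function.iterate_succ_apply' timePrimitive] at h2
    exact h2
  refine h1.congr_deriv ?_
  rw [volterra, Finset.sum_range_succ']
  simp only [derivCoeff, add_mul, Finset.sum_add_distrib]
  have h3 := Finset.sum_range_succ' (fun j => ∑ k, c j i k (x, t) * timePrimitive^[j] (w k) (x, t)) J
  rw [Finset.sum_range_succ] at h3
  simp only [hcJ J le_rfl, Pi.zero_apply, zero_mul, Finset.sum_const_zero, add_zero] at h3
  rw [h3]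
  ring

end VolterraOn

/-- A solution `u` of the system `∂_x u_i + μ_i ∂_t u_i = ∑ j < J, ∑ k, c_jik I^j u_k + G_i` on a
rectangle, with the boundary conditions `u_i = ∑ j < J, ∑ k, d_jik I^j u_k + H_i` at `x = 0` for the
components with `pos i` and `u_i = 0` at `x = X` for the others, and with `u = 0` for `t = 0`. -/
structure IsRectSolution {ι : Type*} [Fintype ι] (pos : ι → Prop) (X T : ℝ) (μ : ι → ℝ × ℝ → ℝ)
    (J : ℕ) (c d : ℕ → ι → ι → ℝ × ℝ → ℂ) (G H u : ι → ℝ × ℝ → ℂ) : Prop where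
  initial : ∀ i, ∀ x ∈ Icc 0 X, u i (x, 0) = 0
  equation : ∀ i, ∀ p ∈ rect X T,
    rectDx X T (u i) p + μ i p * rectDt X T (u i) p = volterra J c G u i p
  boundary : ∀ i, pos i → ∀ t ∈ Icc 0 T, u i (0, t) = volterra J d H u i (0, t)
  outer : ∀ i, ¬ pos i → ∀ t ∈ Icc 0 T, u i (X, t) = 0

theorem eq_of_hasDerivWithinAt_eq {T : ℝ} (hT : 0 < T) {f g f' : ℝ → ℂ}
    (hf : ∀ t ∈ Icc 0 T, HasDerivWithinAt f (f' t) (Icc 0 T) t)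
    (hg : ∀ t ∈ Icc 0 T, HasDerivWithinAt g (f' t) (Icc 0 T) t) (h0 : f 0 = g 0) :
    ∀ t ∈ Icc 0 T, f t = g t := fun t ht => by
  have h := Convex.norm_image_sub_le_of_norm_hasDerivWithin_le (s := Icc 0 T) (C := 0)
    (f := fun t => f t - g t) (f' := fun _ => 0)
    (fun s hs => by simpa using (hf s hs).fun_sub (hg s hs)) (fun s _ => by simp)
    (convex_Icc _ _) ⟨le_rfl, hT.le⟩ ht
  rw [h0, zero_mul, sub_self, sub_zero, norm_le_zero_iff] at h
  exact sub_eq_zero.1 h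

/-- Existence of solutions of class `C^(n+1)`, for smooth data that vanish to order `n + 2` for
`t = 0`. The solution of class `C^(n+2)` is the primitive in `t` of a solution of class `C^(n+1)`
of the system for the derivative in `t`. -/
theorem exists_isRectSolution {ι : Type*} [Fintype ι] {pos : ι → Prop} {X T : ℝ} (hX : 0 < X)
    (hT : 0 < T) {μ : ι → ℝ × ℝ → ℝ} (hμ : ∀ i, ContDiffOn ℝ ∞ (μ i) (rect X T))
    (hpos : ∀ i, pos i → ∀ p ∈ rect X T, 0 < μ i p)
    (hneg : ∀ i, ¬ pos i → ∀ p ∈ rect X T, μ i p < 0) (n : ℕ) :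
    ∀ {J : ℕ} {c d : ℕ → ι → ι → ℝ × ℝ → ℂ} {G H : ι → ℝ × ℝ → ℂ},
    (∀ j i k, ContDiffOn ℝ ∞ (c j i k) (rect X T)) →
    (∀ j i k, ContDiffOn ℝ ∞ (d j i k) (rect X T)) →
    (∀ j, J ≤ j → c j = 0) → (∀ j, J ≤ j → d j = 0) → (∀ i k, pos k → d 0 i k = 0) →
    (∀ i, ContDiffOn ℝ ∞ (G i) (rect X T)) → (∀ i, ContDiffOn ℝ ∞ (H i) (rect X T)) →
    (∀ i, ∀ m < n + 2, ∀ x ∈ Icc 0 X, (rectDt X T)^[m] (G i) (x, 0) = 0) →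
    (∀ i, ∀ m < n + 2, ∀ x ∈ Icc 0 X, (rectDt X T)^[m] (H i) (x, 0) = 0) →
    ∃ u : ι → ℝ × ℝ → ℂ, (∀ i, ContDiffOn ℝ (n + 1) (u i) (rect X T)) ∧
      IsRectSolution pos X T μ J c d G H u := by
  classical
  have hμc : ∀ i, ContDiffOn ℝ ∞ (fun p => (μ i p : ℂ)) (rect X T) := fun i =>
    Complex.ofRealCLM.contDiff.comp_contDiffOn (hμ i)
  have hle : ∀ m : ℕ, (m : WithTop ℕ∞) ≤ ∞ := fun m => by exact_mod_cast le_top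
  induction n with
  | zero =>
    intro J c d G H hc hd hcJ hdJ hd0 hG hH hG0 hH0
    obtain ⟨w, hw, h1, h2, h3⟩ := exists_causal_solution hX hT (fun i => (hμ i).of_le (hle 1)) hpos
      hneg (fun j i k => (hc j i k).of_le (hle 1)) (fun j i k => (hd j i k).of_le (hle 1)) hd0
      (fun i => (hG i).of_le (hle 1)) (fun i => (hH i).of_le (hle 1)) (J := J)
      (fun i x hx => ⟨hG0 i 0 (by omega) x hx, hG0 i 1 (by omega) x hx⟩)
      (fun i x hx => ⟨hH0 i 0 (by omega) x hx, hH0 i 1 (by omega) x hx⟩)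
    have hcont : ∀ i, ContinuousOn (timePrimitive (w i)) (rect X T) := fun i =>
      (continuous_timePrimitive (hw.1 i)).continuousOn
    have ht : ∀ i, ∀ x ∈ Icc 0 X, ∀ t ∈ Icc 0 T,
        HasDerivWithinAt (fun t => timePrimitive (w i) (x, t)) (w i (x, t)) (Icc 0 T) t :=
      fun i x _ t _ => (hasDerivAt_timePrimitive (hw.1 i) x t).hasDerivWithinAt
    have hV : ∀ i, ContDiffOn ℝ (0 : ℕ) (volterra J c G (fun k => timePrimitive (w k)) i)
        (rect X T) := contDiffOn_volterra hX hT (fun j i k => (hc j i k).of_le (hle 0))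
      (fun i => (hG i).of_le (hle 0)) (fun i => contDiffOn_zero.2 (hcont i))
    have hw0 : ∀ i, ContDiffOn ℝ (0 : ℕ) (w i) (rect X T) := fun i =>
      contDiffOn_zero.2 (hw.1 i).continuousOn
    have hs : ∀ i, ContDiffOn ℝ ((0 : ℕ) + 1) (timePrimitive (w i)) (rect X T) := fun i =>
      contDiffOn_of_partial hX hT (h1 i) (ht i)
        ((hV i).sub (((hμc i).of_le (hle 0)).mul (hw0 i))) (hw0 i)
    have hdf : ∀ i, ∀ p ∈ rect X T, DifferentiableWithinAt ℝ (timePrimitive (w i)) (rect X T) p :=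
      fun i => (hs i).differentiableOn (by simp)
    refine ⟨_, hs, fun i x _ => timePrimitive_zero_right _ _, fun i p hp => ?_, h2,
      fun i hi t _ => h3 i hi t⟩
    rw [rectDx_eq hX (hdf i p hp) hp.1 hp.2 (h1 i p.1 hp.1 p.2 hp.2),
      rectDt_eq hT (hdf i p hp) hp.1 hp.2 (ht i p.1 hp.1 p.2 hp.2)]
    ring
  | succ n ih =>
    intro J c d G H hc hd hcJ hdJ hd0 hG hH hG0 hH0
    set c' : ℕ → ι → ι → ℝ × ℝ → ℂ := fun j i k p => derivCoeff X T c j i k p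
      - if j = 0 ∧ i = k then rectDt X T (fun p => (μ i p : ℂ)) p else 0 with hc'
    have hc's : ∀ j i k, ContDiffOn ℝ ∞ (c' j i k) (rect X T) := fun j i k => by
      refine (contDiffOn_derivCoeff hX hT hc j i k).sub ?_
      by_cases h : j = 0 ∧ i = k
      · simp only [h, and_self, if_true]
        exact contDiffOn_rectDt hX hT (hμc k) (by simp)
      · simp only [h, if_false]
        exact contDiffOn_const
    obtain ⟨w, hws, hw⟩ := ih (J := J + 1) (c := c') (d := derivCoeff X T d)
      (G := fun i => rectDt X T (G i)) (H := fun i => rectDt X T (H i)) hc's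
      (contDiffOn_derivCoeff hX hT hd)
      (fun j hj => by
        funext i k p
        simp [hc', derivCoeff_eq_zero hcJ j hj, show j ≠ 0 by omega])
      (fun j hj => derivCoeff_eq_zero hdJ j hj) hd0
      (fun i => contDiffOn_rectDt hX hT (hG i) (by simp))
      (fun i => contDiffOn_rectDt hX hT (hH i) (by simp))
      (fun i m hm x hx => hG0 i (m + 1) (by omega) x hx)
      (fun i m hm x hx => hH0 i (m + 1) (by omega) x hx)
    have hwc : ∀ i, ContinuousOn (w i) (rect X T) := fun i => (hws i).continuousOn
    have hwd : ∀ i, ∀ p ∈ rect X T, DifferentiableWithinAt ℝ (w i) (rect X T) p := fun i =>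
      (hws i).differentiableOn (by simp)
    have hwx : ∀ i, ContDiffOn ℝ n (rectDx X T (w i)) (rect X T) := fun i =>
      contDiffOn_rectDx hX hT (hws i) le_rfl
    have hwt : ∀ i, ContDiffOn ℝ n (rectDt X T (w i)) (rect X T) := fun i =>
      contDiffOn_rectDt hX hT (hws i) le_rfl
    set u : ι → ℝ × ℝ → ℂ := fun i => timePrimitive (w i) with hu
    have hus : ∀ i, ContDiffOn ℝ (n + 1 : ℕ) (u i) (rect X T) := fun i =>
      contDiffOn_timePrimitive hX hT (by exact_mod_cast hws i)
    have hut : ∀ i, ∀ x ∈ Icc 0 X, ∀ t ∈ Icc 0 T,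
        HasDerivWithinAt (fun t => u i (x, t)) (w i (x, t)) (Icc 0 T) t :=
      fun i x hx t ht => hasDerivWithinAt_timePrimitive hX hT (hwc i) hx ht
    have hux : ∀ i, ∀ x ∈ Icc 0 X, ∀ t ∈ Icc 0 T, HasDerivWithinAt (fun x => u i (x, t))
        (timePrimitive (rectDx X T (w i)) (x, t)) (Icc 0 X) x := fun i x hx t ht =>
      hasDerivWithinAt_timePrimitive_fst hX hT (hwc i) (hwx i).continuousOn
        (fun x hx t ht => hasDerivWithinAt_rectDx (hwd i _ ⟨hx, ht⟩) ht) hx ht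
    have hvt : ∀ i, ∀ x ∈ Icc 0 X, ∀ t ∈ Icc 0 T,
        HasDerivWithinAt (fun t => volterra J c G u i (x, t))
        (volterra (J + 1) (derivCoeff X T c) (fun i => rectDt X T (G i)) w i (x, t))
        (Icc 0 T) t := fun i x hx t ht => hasDerivWithinAt_volterra hX hT
      (fun j i k => (hc j i k).of_le (hle 1)) hcJ (fun i => (hG i).of_le (hle 1)) hwc i hx ht
    have hv0 : ∀ (c : ℕ → ι → ι → ℝ × ℝ → ℂ) (G : ι → ℝ × ℝ → ℂ) i x, G i (x, 0) = 0 →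
        volterra J c G u i (x, 0) = 0 := fun c G i x hG => by
      have : ∀ j k, timePrimitive^[j] (u k) (x, 0) = 0 := fun j k => by
        simp only [hu, ← Function.iterate_succ_apply]
        rw [Function.iterate_succ_apply']
        exact timePrimitive_zero_right _ _
      simp [volterra, this, hG]
    -- The coefficient `c'` is chosen such that the derivative in `t` of the system for `u` is the
    -- system for `w`.
    have hcc : ∀ i p, volterra (J + 1) c' (fun i => rectDt X T (G i)) w i p
        = volterra (J + 1) (derivCoeff X T c) (fun i => rectDt X T (G i)) w i p
          - rectDt X T (fun p => (μ i p : ℂ)) p * w i p := fun i p => by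
      simp only [volterra, hc', sub_mul, Finset.sum_sub_distrib]
      have h1 : ∑ j ∈ Finset.range (J + 1), ∑ k,
          (if j = 0 ∧ i = k then rectDt X T (fun p => (μ i p : ℂ)) p else 0)
            * timePrimitive^[j] (w k) p = rectDt X T (fun p => (μ i p : ℂ)) p * w i p := by
        rw [Finset.sum_eq_single_of_mem 0 (by simp) (fun j _ hj => by simp [hj]),
          Finset.sum_eq_single_of_mem i (by simp) (fun k _ hk => by simp [hk.symm])]
        simp
      rw [h1]
      ring
    have heq : ∀ i, ∀ x ∈ Icc 0 X, ∀ t ∈ Icc 0 T,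
        timePrimitive (rectDx X T (w i)) (x, t) + μ i (x, t) * w i (x, t)
          = volterra J c G u i (x, t) := fun i x hx => by
      refine eq_of_hasDerivWithinAt_eq hT (f' := fun t =>
        volterra (J + 1) (derivCoeff X T c) (fun i => rectDt X T (G i)) w i (x, t))
        (fun t ht => ?_) (hvt i x hx) ?_
      · have hp : (x, t) ∈ rect X T := ⟨hx, ht⟩
        have h1 := (hasDerivWithinAt_timePrimitive hX hT (hwx i).continuousOn hx ht).add
          ((hasDerivWithinAt_rectDt ((hμc i).differentiableOn (by simp) _ hp) hx).mul
          (hasDerivWithinAt_rectDt (hwd i _ hp) hx))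
        refine h1.congr_deriv ?_
        have h2 := hw.equation i _ hp
        rw [hcc] at h2
        linear_combination h2
      · rw [timePrimitive_zero_right, hw.initial i x hx, hv0 c G i x (hG0 i 0 (by omega) x hx)]
        ring
    have hsmooth : ∀ i, ContDiffOn ℝ ((n + 1 : ℕ) + 1) (u i) (rect X T) := fun i => by
      have h1 : ContDiffOn ℝ (n + 1 : ℕ) (timePrimitive (rectDx X T (w i))) (rect X T) := by
        refine ContDiffOn.congr (f := fun p => volterra J c G u i p - μ i p * w i p) ?_
          fun p hp => eq_sub_of_add_eq (heq i p.1 hp.1 p.2 hp.2)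
        exact (contDiffOn_volterra hX hT (fun j i k => (hc j i k).of_le (hle _))
          (fun i => (hG i).of_le (hle _)) hus i).sub
          (((hμc i).of_le (hle _)).mul (by exact_mod_cast hws i))
      exact contDiffOn_of_partial hX hT (hux i) (hut i) h1 (by exact_mod_cast hws i)
    have hdf : ∀ i, ∀ p ∈ rect X T, DifferentiableWithinAt ℝ (u i) (rect X T) p :=
      fun i => (hsmooth i).differentiableOn (by simp)
    have hX0 : (0 : ℝ) ∈ Icc 0 X := ⟨le_rfl, hX.le⟩
    refine ⟨u, hsmooth, fun i x _ => timePrimitive_zero_right _ _, fun i p hp => ?_,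
      fun i hi => ?_, fun i hi t ht => ?_⟩
    · rw [rectDx_eq hX (hdf i p hp) hp.1 hp.2 (hux i p.1 hp.1 p.2 hp.2),
        rectDt_eq hT (hdf i p hp) hp.1 hp.2 (hut i p.1 hp.1 p.2 hp.2)]
      exact heq i p.1 hp.1 p.2 hp.2
    · refine eq_of_hasDerivWithinAt_eq hT (hut i 0 hX0) (fun t ht => ?_) ?_
      · rw [hw.boundary i hi t ht]
        exact hasDerivWithinAt_volterra hX hT (fun j i k => (hd j i k).of_le (hle 1)) hdJ
          (fun i => (hH i).of_le (hle 1)) hwc i hX0 ht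
      · rw [hv0 d H i 0 (hH0 i 0 (by omega) 0 hX0)]
        exact timePrimitive_zero_right _ _
    · simp only [hu, timePrimitive]
      rw [intervalIntegral.integral_congr (g := fun _ => (0 : ℂ)) (fun s hs => ?_)]
      · simp
      · rw [uIcc_of_le ht.1] at hs
        exact hw.outer i hi s ⟨hs.1, hs.2.trans ht.2⟩

/-! ### Taylor expansion in time -/

theorem natCast_le_infty (m : ℕ) : (m : WithTop ℕ∞) ≤ ∞ := by exact_mod_cast le_top

theorem iterate_fderivWithin_snd {A B : Set ℝ} (hA : UniqueDiffOn ℝ A) (hB : UniqueDiffOn ℝ B)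
    {g : ℝ × ℝ → ℂ} (hg : ContDiffOn ℝ ∞ g (A ×ˢ B)) (m : ℕ) :
    ContDiffOn ℝ ∞
      ((fun g (p : ℝ × ℝ) => (fderivWithin ℝ g (A ×ˢ B) p (0, 1) : ℂ))^[m] g) (A ×ˢ B) ∧
    ∀ x ∈ A, ∀ t ∈ B, (fun g (p : ℝ × ℝ) => (fderivWithin ℝ g (A ×ˢ B) p (0, 1) : ℂ))^[m] g (x, t)
      = iteratedDerivWithin m (fun t => g (x, t)) B t := by
  induction m generalizing g with
  | zero => exact ⟨hg, fun x _ t _ => by simp⟩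
  | succ m ih =>
    have h1 : ContDiffOn ℝ ∞ (fun p : ℝ × ℝ => (fderivWithin ℝ g (A ×ˢ B) p (0, 1) : ℂ))
        (A ×ˢ B) := (hg.fderivWithin (hA.prod hB) (by simp)).clm_apply contDiffOn_const
    refine ⟨(ih h1).1, fun x hx t ht => ?_⟩
    rw [Function.iterate_succ_apply, (ih h1).2 x hx t ht, iteratedDerivWithin_succ']
    refine iteratedDerivWithin_congr (fun s hs => ?_) ht
    have h2 : HasDerivWithinAt (fun s : ℝ => (x, s)) ((0 : ℝ), (1 : ℝ)) B s :=
      ((hasDerivAt_const s x).prodMk (hasDerivAt_id s)).hasDerivWithinAt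
    have h3 := (hg.differentiableOn (by simp) (x, s) ⟨hx, hs⟩).hasFDerivWithinAt
      |>.comp_hasDerivWithinAt s h2 fun s hs => ⟨hx, hs⟩
    exact (h3.derivWithin (hB s hs)).symm

theorem contDiffOn_slice {A B : Set ℝ} {g : ℝ × ℝ → ℂ} {n : WithTop ℕ∞}
    (hg : ContDiffOn ℝ n g (A ×ˢ B)) {x : ℝ} (hx : x ∈ A) :
    ContDiffOn ℝ n (fun t => g (x, t)) B :=
  hg.comp (f := fun t : ℝ => (x, t)) (contDiff_const.prodMk contDiff_id).contDiffOn
    fun _ ht => ⟨hx, ht⟩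

theorem contDiffOn_timeDerivAtZero {g : ℝ × ℝ → ℂ} (hg : ContDiffOn ℝ ∞ g quarterPlane) (j : ℕ) :
    ContDiffOn ℝ ∞ (timeDerivAtZero j g) (Ici 0) := by
  have h := iterate_fderivWithin_snd (uniqueDiffOn_Ici 0) (uniqueDiffOn_Ici 0) hg j
  have h1 := h.1.comp (f := fun x : ℝ => (x, (0 : ℝ))) (s := Ici 0)
    (contDiff_id.prodMk contDiff_const).contDiffOn fun x hx => ⟨hx, le_refl (0 : ℝ)⟩
  exact h1.congr fun x hx => (h.2 x hx 0 (le_refl (0 : ℝ))).symm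

section TimeDeriv

variable {g h : ℝ × ℝ → ℂ} {x : ℝ}

theorem contDiffWithinAt_slice (hg : ContDiffOn ℝ ∞ g quarterPlane) (hx : 0 ≤ x) (m : ℕ) :
    ContDiffWithinAt ℝ m (fun t => g (x, t)) (Ici 0) 0 :=
  ((contDiffOn_slice hg hx).of_le (natCast_le_infty m)) 0 (le_refl (0 : ℝ))

theorem timeDerivAtZero_add (hg : ContDiffOn ℝ ∞ g quarterPlane)
    (hh : ContDiffOn ℝ ∞ h quarterPlane) (hx : 0 ≤ x) (m : ℕ) :
    timeDerivAtZero m (fun p => g p + h p) x = timeDerivAtZero m g x + timeDerivAtZero m h x :=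
  iteratedDerivWithin_fun_add (le_refl (0 : ℝ)) (uniqueDiffOn_Ici 0)
    (contDiffWithinAt_slice hg hx m) (contDiffWithinAt_slice hh hx m)

theorem timeDerivAtZero_neg (m : ℕ) :
    timeDerivAtZero m (fun p => -g p) x = -timeDerivAtZero m g x :=
  iteratedDerivWithin_fun_neg _

theorem timeDerivAtZero_sub (hg : ContDiffOn ℝ ∞ g quarterPlane)
    (hh : ContDiffOn ℝ ∞ h quarterPlane) (hx : 0 ≤ x) (m : ℕ) :
    timeDerivAtZero m (fun p => g p - h p) x = timeDerivAtZero m g x - timeDerivAtZero m h x := by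
  simp only [sub_eq_add_neg]
  rw [timeDerivAtZero_add hg hh.neg hx, timeDerivAtZero_neg]

theorem timeDerivAtZero_mul (hg : ContDiffOn ℝ ∞ g quarterPlane)
    (hh : ContDiffOn ℝ ∞ h quarterPlane) (hx : 0 ≤ x) (m : ℕ) :
    timeDerivAtZero m (fun p => g p * h p) x = ∑ j ∈ Finset.range (m + 1),
      (m.choose j : ℂ) * timeDerivAtZero j g x * timeDerivAtZero (m - j) h x :=
  iteratedDerivWithin_mul (le_refl (0 : ℝ)) (uniqueDiffOn_Ici 0)
    (contDiffWithinAt_slice hg hx m) (contDiffWithinAt_slice hh hx m)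

theorem timeDerivAtZero_sum {α : Type*} (s : Finset α) {g : α → ℝ × ℝ → ℂ}
    (hg : ∀ k ∈ s, ContDiffOn ℝ ∞ (g k) quarterPlane) (hx : 0 ≤ x) (m : ℕ) :
    timeDerivAtZero m (fun p => ∑ k ∈ s, g k p) x = ∑ k ∈ s, timeDerivAtZero m (g k) x :=
  iteratedDerivWithin_fun_sum (le_refl (0 : ℝ)) (uniqueDiffOn_Ici 0)
    fun k hk => contDiffWithinAt_slice (hg k hk) hx m

theorem iteratedDerivWithin_Icc_zero {T : ℝ} (hT : 0 < T) (m : ℕ) (f : ℝ → ℂ) :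
    iteratedDerivWithin m f (Icc 0 T) 0 = iteratedDerivWithin m f (Ici 0) 0 := by
  have h : Icc 0 T =ᶠ[𝓝 0] Ici 0 := by
    filter_upwards [Iio_mem_nhds hT] with t ht
    exact propext ⟨fun h => h.1, fun h => ⟨h, (mem_Iio.1 ht).le⟩⟩
  rw [iteratedDerivWithin, iteratedDerivWithin,
    (iteratedFDerivWithin_eventually_congr_set h m).self_of_nhds]

theorem iterate_rectDt_zero {X T : ℝ} (hX : 0 < X) (hT : 0 < T)
    (hg : ContDiffOn ℝ ∞ g (rect X T)) (hx : x ∈ Icc 0 X) (m : ℕ) :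
    (rectDt X T)^[m] g (x, 0) = timeDerivAtZero m g x := by
  refine ((iterate_fderivWithin_snd (uniqueDiffOn_Icc hX) (uniqueDiffOn_Icc hT) hg m).2 x hx 0
    ⟨le_rfl, hT.le⟩).trans ?_
  exact iteratedDerivWithin_Icc_zero hT m _

/-- A function that vanishes to order `K` for `t = 0` keeps this property if it is multiplied by a
function that is smooth near the `x` axis. -/
theorem iterate_rectDt_mul_eq_zero {X T : ℝ} (hX : 0 < X) (hT : 0 < T)
    (hg : ContDiffOn ℝ ∞ g (rect X T)) (hh : ContDiffOn ℝ ∞ h (rect X T)) (hx : x ∈ Icc 0 X)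
    {K : ℕ} (h0 : ∀ m < K, timeDerivAtZero m h x = 0) {m : ℕ} (hm : m < K) :
    (rectDt X T)^[m] (fun p => g p * h p) (x, 0) = 0 := by
  have hs : ∀ {g : ℝ × ℝ → ℂ}, ContDiffOn ℝ ∞ g (rect X T) → ∀ m : ℕ,
      ContDiffWithinAt ℝ m (fun t => g (x, t)) (Icc 0 T) 0 := fun hg m =>
    ((contDiffOn_slice (A := Icc 0 X) (B := Icc 0 T) hg hx).of_le (natCast_le_infty m)) 0
      ⟨le_rfl, hT.le⟩
  rw [iterate_rectDt_zero hX hT (hg.mul hh) hx, timeDerivAtZero, ← iteratedDerivWithin_Icc_zero hT]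
  refine (iteratedDerivWithin_mul (left_mem_Icc.2 hT.le) (uniqueDiffOn_Icc hT) (hs hg m)
    (hs hh m)).trans (Finset.sum_eq_zero fun j _ => ?_)
  have h1 : iteratedDerivWithin (m - j) (fun t => h (x, t)) (Icc 0 T) 0 = 0 := by
    rw [iteratedDerivWithin_Icc_zero hT]
    exact h0 _ (by omega)
  rw [h1, mul_zero]

end TimeDeriv

/-- The polynomial `∑ m < K, w_m(x) t^m / m!` in `t`. -/
noncomputable def timeTaylor (K : ℕ) (w : ℕ → ℝ → ℂ) (p : ℝ × ℝ) : ℂ :=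
  ∑ m ∈ Finset.range K, w m p.1 * ((p.2 ^ m / m.factorial : ℝ) : ℂ)

section TimeTaylor

variable {w : ℕ → ℝ → ℂ}

theorem contDiffOn_timeTaylor (K : ℕ) (hw : ∀ m, ContDiffOn ℝ ∞ (w m) (Ici 0)) :
    ContDiffOn ℝ ∞ (timeTaylor K w) quarterPlane := by
  refine ContDiffOn.sum fun m _ => ((hw m).comp contDiffOn_fst fun p hp => hp.1).mul ?_
  exact Complex.ofRealCLM.contDiff.comp_contDiffOn
    ((contDiffOn_snd.pow m).div_const (m.factorial : ℝ))

theorem timeTaylor_succ (K : ℕ) (p : ℝ × ℝ) : timeTaylor (K + 1) w p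
    = ∑ m ∈ Finset.range K, w (m + 1) p.1 * ((p.2 ^ (m + 1) / (m + 1).factorial : ℝ) : ℂ)
      + w 0 p.1 := by
  rw [timeTaylor, Finset.sum_range_succ']
  simp

theorem hasDerivAt_timeTaylor (K : ℕ) (x t : ℝ) :
    HasDerivAt (fun t => timeTaylor (K + 1) w (x, t))
      (timeTaylor K (fun m => w (m + 1)) (x, t)) t := by
  simp only [timeTaylor_succ]
  refine (HasDerivAt.fun_sum fun m _ => ?_).add_const _
  have h1 := ((hasDerivAt_pow (m + 1) t).div_const ((m + 1).factorial : ℝ)).ofReal_comp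
  refine (h1.const_mul (w (m + 1) x)).congr_deriv ?_
  congr 2
  rw [Nat.factorial_succ]
  push_cast
  field_simp

theorem timeDerivAtZero_timeTaylor (x : ℝ) {j K : ℕ} (hj : j < K) :
    timeDerivAtZero j (timeTaylor K w) x = w j x := by
  induction j generalizing K w with
  | zero =>
    obtain ⟨K, rfl⟩ := Nat.exists_eq_succ_of_ne_zero (by omega : K ≠ 0)
    simp [timeDerivAtZero, timeTaylor_succ]
  | succ j ih =>
    obtain ⟨K, rfl⟩ := Nat.exists_eq_succ_of_ne_zero (by omega : K ≠ 0)
    rw [timeDerivAtZero, iteratedDerivWithin_succ']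
    rw [iteratedDerivWithin_congr (g := fun t => timeTaylor K (fun m => w (m + 1)) (x, t))
      (fun t ht => ?_) (mem_Ici.2 (le_refl (0 : ℝ)))]
    · exact ih (w := fun m => w (m + 1)) (by omega)
    · exact (hasDerivAt_timeTaylor K x t).hasDerivWithinAt.derivWithin (uniqueDiffOn_Ici 0 t ht)

theorem timeTaylor_zero_right (K : ℕ) (x : ℝ) : timeTaylor (K + 1) w (x, 0) = w 0 x := by
  simp [timeTaylor_succ]

theorem hasDerivWithinAt_timeTaylor (K : ℕ) (hw : ∀ m, ContDiffOn ℝ ∞ (w m) (Ici 0)) {x : ℝ}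
    (hx : 0 ≤ x) (t : ℝ) :
    HasDerivWithinAt (fun x => timeTaylor K w (x, t))
      (timeTaylor K (fun m => derivWithin (w m) (Ici 0)) (x, t)) (Ici 0) x :=
  HasDerivWithinAt.fun_sum fun m _ =>
    (((hw m).differentiableOn (by simp) x hx).hasDerivWithinAt).mul_const
      ((t ^ m / m.factorial : ℝ) : ℂ)

end TimeTaylor

/-! ### Smooth solutions of the classical mixed problem -/

section Classical

variable {n r : ℕ} {l : Fin n → ℝ × ℝ → ℂ} {f : Fin n → Fin n → ℝ × ℝ → ℂ}
  {a : Fin n → ℝ × ℝ → ℂ} {u₀ : Fin n → ℝ → ℂ} {v : Fin n → Fin n → ℝ → ℂ} {h : Fin n → ℝ → ℂ}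

theorem contDiffOn_formalTimeDeriv (hl : ∀ i, ContDiffOn ℝ ∞ (l i) quarterPlane)
    (hf : ∀ i k, ContDiffOn ℝ ∞ (f i k) quarterPlane)
    (ha : ∀ i, ContDiffOn ℝ ∞ (a i) quarterPlane) (hu₀ : ∀ i, ContDiffOn ℝ ∞ (u₀ i) (Ici 0))
    (m : ℕ) (i : Fin n) : ContDiffOn ℝ ∞ (formalTimeDeriv l f a u₀ m i) (Ici 0) := by
  induction m using Nat.strong_induction_on generalizing i with
  | _ m ih =>
    rcases m with _ | m
    · unfold formalTimeDeriv
      exact hu₀ i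
    · unfold formalTimeDeriv
      refine (ContDiffOn.sum fun j _ => contDiffOn_const.mul (ContDiffOn.add (ContDiffOn.neg ?_)
        (ContDiffOn.sum fun k _ => ?_))).add (contDiffOn_timeDerivAtZero (ha i) m)
      · exact (contDiffOn_timeDerivAtZero (hl i) _).mul
          ((ih _ (by omega) i).derivWithin (uniqueDiffOn_Ici 0) (by simp))
      · exact (contDiffOn_timeDerivAtZero (hf i k) _).mul (ih _ (by omega) k)

/-- `u` is differentiable on `S` and satisfies the mixed problem at the points of `S`. -/
structure IsClassicalSolution (r : ℕ) (l : Fin n → ℝ × ℝ → ℂ) (f : Fin n → Fin n → ℝ × ℝ → ℂ)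
    (a : Fin n → ℝ × ℝ → ℂ) (u₀ : Fin n → ℝ → ℂ) (v : Fin n → Fin n → ℝ → ℂ)
    (h : Fin n → ℝ → ℂ) (S : Set (ℝ × ℝ)) (u : Fin n → ℝ × ℝ → ℂ) : Prop where
  equation : ∀ i, ∀ p ∈ S, ∃ u' : ℝ × ℝ →L[ℝ] ℂ, HasFDerivWithinAt (u i) u' S p ∧
    u' (0, 1) + l i p * u' (1, 0) = ∑ k, f i k p * u k p + a i p
  initial : ∀ i x, (x, (0 : ℝ)) ∈ S → u i (x, 0) = u₀ i x
  boundary : ∀ i : Fin n, i.val < r → ∀ t, ((0 : ℝ), t) ∈ S →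
    u i (0, t) = ∑ k with r ≤ k.val, v i k t * u k (0, t) + h i t

theorem IsClassicalSolution.mono {S S' : Set (ℝ × ℝ)} {u : Fin n → ℝ × ℝ → ℂ}
    (hu : IsClassicalSolution r l f a u₀ v h S u) (hS : S' ⊆ S) :
    IsClassicalSolution r l f a u₀ v h S' u :=
  ⟨fun i p hp => (hu.equation i p (hS hp)).imp fun _ h => ⟨h.1.mono hS, h.2⟩,
    fun i x hx => hu.initial i x (hS hx), fun i hi t ht => hu.boundary i hi t (hS ht)⟩

/-- The formal Taylor polynomial of order `K` solves the equation and the boundary conditions up to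
terms that vanish to order `K` for `t = 0`. -/
theorem timeDerivAtZero_residual (hl : ∀ i, ContDiffOn ℝ ∞ (l i) quarterPlane)
    (hf : ∀ i k, ContDiffOn ℝ ∞ (f i k) quarterPlane)
    (ha : ∀ i, ContDiffOn ℝ ∞ (a i) quarterPlane) (hu₀ : ∀ i, ContDiffOn ℝ ∞ (u₀ i) (Ici 0))
    {K m : ℕ} (hm : m < K) (i : Fin n) {x : ℝ} (hx : 0 ≤ x) :
    timeDerivAtZero m (fun p =>
      timeTaylor K (fun m => formalTimeDeriv l f a u₀ (m + 1) i) p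
      + l i p * timeTaylor (K + 1)
          (fun m => derivWithin (formalTimeDeriv l f a u₀ m i) (Ici 0)) p
      - ∑ k, f i k p * timeTaylor (K + 1) (fun m => formalTimeDeriv l f a u₀ m k) p - a i p) x
      = 0 := by
  have hw := contDiffOn_formalTimeDeriv hl hf ha hu₀
  have hwx : ∀ m i, ContDiffOn ℝ ∞ (derivWithin (formalTimeDeriv l f a u₀ m i) (Ici 0)) (Ici 0) :=
    fun m i => (hw m i).derivWithin (uniqueDiffOn_Ici 0) (by simp)
  have s1 := contDiffOn_timeTaylor K fun m => hw (m + 1) i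
  have s2 := (hl i).mul (contDiffOn_timeTaylor (K + 1) fun m => hwx m i)
  have s3 : ∀ k, ContDiffOn ℝ ∞ (fun p => f i k p *
      timeTaylor (K + 1) (fun m => formalTimeDeriv l f a u₀ m k) p) quarterPlane := fun k =>
    (hf i k).mul (contDiffOn_timeTaylor (K + 1) fun m => hw m k)
  have s4 : ContDiffOn ℝ ∞ (fun p => ∑ k, f i k p *
      timeTaylor (K + 1) (fun m => formalTimeDeriv l f a u₀ m k) p) quarterPlane :=
    ContDiffOn.sum fun k _ => s3 k
  rw [timeDerivAtZero_sub ((s1.add s2).sub s4) (ha i) hx, timeDerivAtZero_sub (s1.add s2) s4 hx,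
    timeDerivAtZero_add s1 s2 hx, timeDerivAtZero_sum _ (fun k _ => s3 k) hx,
    timeDerivAtZero_timeTaylor x hm,
    timeDerivAtZero_mul (hl i) (contDiffOn_timeTaylor (K + 1) fun m => hwx m i) hx]
  have e0 := fun k => timeDerivAtZero_mul (hf i k)
    (contDiffOn_timeTaylor (K + 1) fun m => hw m k) hx m
  simp only [e0]
  rw [formalTimeDeriv]
  beta_reduce
  rw [← Finset.sum_range (fun j => (m.choose j : ℂ) *
        (-(timeDerivAtZero j (l i) x *
            derivWithin (formalTimeDeriv l f a u₀ (m - j) i) (Ici 0) x)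
          + ∑ k, timeDerivAtZero j (f i k) x * formalTimeDeriv l f a u₀ (m - j) k x))]
  have e1 : ∀ j, timeDerivAtZero (m - j) (timeTaylor (K + 1)
      (fun m => derivWithin (formalTimeDeriv l f a u₀ m i) (Ici 0))) x
      = derivWithin (formalTimeDeriv l f a u₀ (m - j) i) (Ici 0) x := fun j =>
    timeDerivAtZero_timeTaylor x (by omega)
  have e2 : ∀ k j, timeDerivAtZero (m - j) (timeTaylor (K + 1)
      (fun m => formalTimeDeriv l f a u₀ m k)) x = formalTimeDeriv l f a u₀ (m - j) k x :=
    fun k j => timeDerivAtZero_timeTaylor x (by omega)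
  simp only [e1, e2]
  rw [Finset.sum_comm (s := Finset.univ)]
  simp only [mul_add, Finset.sum_add_distrib, Finset.mul_sum, mul_neg, Finset.sum_neg_distrib,
    mul_assoc]
  ring

theorem timeDerivAtZero_boundary_residual
    (hv : ∀ i k, ContDiffOn ℝ ∞ (v i k) (Ici 0)) (hh : ∀ i, ContDiffOn ℝ ∞ (h i) (Ici 0))
    (hcomp : ClassicallyCompatible r l f a u₀ v h) {K m : ℕ} (hm : m < K) {i : Fin n}
    (hi : i.val < r) {x : ℝ} (hx : 0 ≤ x) :
    timeDerivAtZero m (fun p =>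
      timeTaylor K (fun m _ => formalTimeDeriv l f a u₀ m i 0) p
      - ∑ k with r ≤ k.val, v i k p.2 * timeTaylor K (fun m _ => formalTimeDeriv l f a u₀ m k 0) p
      - h i p.2) x = 0 := by
  have hsnd : ∀ {g : ℝ → ℂ}, ContDiffOn ℝ ∞ g (Ici 0) →
      ContDiffOn ℝ ∞ (fun p : ℝ × ℝ => g p.2) quarterPlane := fun hg =>
    hg.comp contDiffOn_snd fun p hp => hp.2
  have s1 : ∀ k : Fin n, ContDiffOn ℝ ∞
      (timeTaylor K (fun m _ => formalTimeDeriv l f a u₀ m k 0)) quarterPlane := fun k =>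
    contDiffOn_timeTaylor K fun m => contDiffOn_const
  have s3 : ∀ k, ContDiffOn ℝ ∞ (fun p => v i k p.2 *
      timeTaylor K (fun m _ => formalTimeDeriv l f a u₀ m k 0) p) quarterPlane := fun k =>
    (hsnd (hv i k)).mul (s1 k)
  have s4 : ContDiffOn ℝ ∞ (fun p => ∑ k with r ≤ k.val, v i k p.2 *
      timeTaylor K (fun m _ => formalTimeDeriv l f a u₀ m k 0) p) quarterPlane :=
    ContDiffOn.sum fun k _ => s3 k
  rw [timeDerivAtZero_sub ((s1 i).sub s4) (hsnd (hh i)) hx, timeDerivAtZero_sub (s1 i) s4 hx,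
    timeDerivAtZero_sum _ (fun k _ => s3 k) hx, timeDerivAtZero_timeTaylor x hm, hcomp m i hi]
  have e0 := fun k => timeDerivAtZero_mul (hsnd (hv i k)) (s1 k) hx m
  simp only [e0]
  have e2 : ∀ k j, timeDerivAtZero (m - j) (timeTaylor K
      (fun m _ => formalTimeDeriv l f a u₀ m k 0)) x = formalTimeDeriv l f a u₀ (m - j) k 0 :=
    fun k j => timeDerivAtZero_timeTaylor x (by omega)
  simp only [e2]
  simp only [timeDerivAtZero]
  ring

end Classical

section Classical

variable {n r : ℕ} {l : Fin n → ℝ × ℝ → ℂ} {f : Fin n → Fin n → ℝ × ℝ → ℂ}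
  {a : Fin n → ℝ × ℝ → ℂ} {u₀ : Fin n → ℝ → ℂ} {v : Fin n → Fin n → ℝ → ℂ} {h : Fin n → ℝ → ℂ}

theorem rect_subset_quarterPlane (X T : ℝ) : rect X T ⊆ quarterPlane :=
  prod_mono (fun _ h => h.1) fun _ h => h.1

/-- Solutions of class `C^(N+1)` on a rectangle: the sum of a formal Taylor polynomial and
of a solution with data that vanish to order `N + 2` for `t = 0`. -/
theorem exists_isClassicalSolution_rect {X T : ℝ} (hX : 0 < X) (hT : 0 < T)
    (hl : ∀ i, ContDiffOn ℝ ∞ (l i) quarterPlane)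
    (hf : ∀ i k, ContDiffOn ℝ ∞ (f i k) quarterPlane)
    (ha : ∀ i, ContDiffOn ℝ ∞ (a i) quarterPlane) (hu₀ : ∀ i, ContDiffOn ℝ ∞ (u₀ i) (Ici 0))
    (hv : ∀ i k, ContDiffOn ℝ ∞ (v i k) (Ici 0)) (hh : ∀ i, ContDiffOn ℝ ∞ (h i) (Ici 0))
    (hcomp : ClassicallyCompatible r l f a u₀ v h) (him : ∀ i, ∀ p ∈ rect X T, (l i p).im = 0)
    (hpos : ∀ i : Fin n, i.val < r → ∀ p ∈ rect X T, 0 < (l i p).re)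
    (hneg : ∀ i : Fin n, ¬ i.val < r → ∀ p ∈ rect X T, (l i p).re < 0) (N : ℕ) :
    ∃ u : Fin n → ℝ × ℝ → ℂ, (∀ i, ContDiffOn ℝ (N + 1) (u i) (rect X T)) ∧
      IsClassicalSolution r l f a u₀ v h (rect X T) u := by
  have hQ := rect_subset_quarterPlane X T
  have hlre : ∀ i, ∀ p ∈ rect X T, l i p = ((l i p).re : ℂ) := fun i p hp =>
    Complex.ext (by simp) (by simp [him i p hp])
  have hl0 : ∀ i, ∀ p ∈ rect X T, (l i p).re ≠ 0 := fun i p hp => by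
    by_cases hi : i.val < r
    · exact (hpos i hi p hp).ne'
    · exact (hneg i hi p hp).ne
  have hl0' : ∀ i, ∀ p ∈ rect X T, l i p ≠ 0 := fun i p hp h0 => hl0 i p hp (by simp [h0])
  set K := N + 2 with hK
  set W := formalTimeDeriv l f a u₀ with hW
  have hw := contDiffOn_formalTimeDeriv hl hf ha hu₀
  have hwx : ∀ m i, ContDiffOn ℝ ∞ (derivWithin (W m i) (Ici 0)) (Ici 0) :=
    fun m i => (hw m i).derivWithin (uniqueDiffOn_Ici 0) (by simp)
  set U : Fin n → ℝ × ℝ → ℂ := fun i => timeTaylor (K + 1) (fun m => W m i) with hU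
  -- `ρ` and `β` are the errors of the Taylor polynomial in the equation and the boundary condition.
  set ρ : Fin n → ℝ × ℝ → ℂ := fun i p =>
      timeTaylor K (fun m => W (m + 1) i) p
      + l i p * timeTaylor (K + 1) (fun m => derivWithin (W m i) (Ici 0)) p
      - ∑ k, f i k p * U k p - a i p with hρ
  set β : Fin n → ℝ × ℝ → ℂ := fun i p =>
      timeTaylor (K + 1) (fun m _ => W m i 0) p
      - ∑ k with r ≤ k.val, v i k p.2 * timeTaylor (K + 1) (fun m _ => W m k 0) p
      - h i p.2 with hβ
  have hUs : ∀ i, ContDiffOn ℝ ∞ (U i) quarterPlane := fun i =>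
    contDiffOn_timeTaylor (K + 1) fun m => hw m i
  have hsnd : ∀ {g : ℝ → ℂ}, ContDiffOn ℝ ∞ g (Ici 0) →
      ContDiffOn ℝ ∞ (fun p : ℝ × ℝ => g p.2) quarterPlane := fun hg =>
    hg.comp contDiffOn_snd fun p hp => hp.2
  have hρs : ∀ i, ContDiffOn ℝ ∞ (ρ i) quarterPlane := fun i =>
    (((contDiffOn_timeTaylor K fun m => hw (m + 1) i).add ((hl i).mul
      (contDiffOn_timeTaylor (K + 1) fun m => hwx m i))).sub
      (ContDiffOn.sum fun k _ => (hf i k).mul (hUs k))).sub (ha i)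
  have hβs : ∀ i, ContDiffOn ℝ ∞ (β i) quarterPlane := fun i =>
    ((contDiffOn_timeTaylor (K + 1) fun m => contDiffOn_const).sub
      (ContDiffOn.sum fun k _ => (hsnd (hv i k)).mul
        (contDiffOn_timeTaylor (K + 1) fun m => contDiffOn_const))).sub (hsnd (hh i))
  have hinv : ∀ i, ContDiffOn ℝ ∞ (fun p => (l i p)⁻¹) (rect X T) := fun i =>
    ((hl i).mono hQ).inv (hl0' i)
  have hrp : ∀ {x}, x ∈ Icc 0 X → (0 : ℝ) ≤ x := fun hx => hx.1
  -- Division by `l_i` gives `∂_x w_i + l_i⁻¹ ∂_t w_i = l_i⁻¹ (∑ k, f_ik w_k - ρ_i)`.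
  obtain ⟨w, hws, hwsol⟩ := exists_isRectSolution (pos := fun i : Fin n => i.val < r) hX hT
    (μ := fun i p => ((l i p).re)⁻¹)
    (fun i => (Complex.reCLM.contDiff.comp_contDiffOn ((hl i).mono hQ)).inv (hl0 i))
    (fun i hi p hp => inv_pos.2 (hpos i hi p hp)) (fun i hi p hp => inv_lt_zero.2 (hneg i hi p hp))
    N (J := 1) (c := fun j i k p => if j = 0 then (l i p)⁻¹ * f i k p else 0)
    (d := fun j i k p => if j = 0 ∧ r ≤ k.val then v i k p.2 else 0)
    (G := fun i p => -(l i p)⁻¹ * ρ i p)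
    (H := fun i p => if i.val < r then -1 * β i p else 0)
    (fun j i k => by
      by_cases hj : j = 0
      · simp only [hj, if_true]
        exact (hinv i).mul ((hf i k).mono hQ)
      · simp only [hj, if_false]
        exact contDiffOn_const)
    (fun j i k => by
      by_cases hj : j = 0 ∧ r ≤ k.val
      · simp only [hj, and_self, if_true]
        exact (hsnd (hv i k)).mono hQ
      · simp only [hj, if_false]
        exact contDiffOn_const)
    (fun j hj => by funext i k p; simp [show j ≠ 0 by omega])
    (fun j hj => by funext i k p; simp [show j ≠ 0 by omega])
    (fun i k hk => by funext p; simp only [not_le.2 hk, and_false, if_false]; rfl)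
    (fun i => (hinv i).neg.mul ((hρs i).mono hQ))
    (fun i => by
      by_cases hi : i.val < r
      · simp only [hi, if_true]
        exact contDiffOn_const.mul ((hβs i).mono hQ)
      · simp only [hi, if_false]
        exact contDiffOn_const)
    (fun i m hm x hx => iterate_rectDt_mul_eq_zero hX hT (hinv i).neg ((hρs i).mono hQ) hx
      (fun m hm => timeDerivAtZero_residual hl hf ha hu₀ hm i (hrp hx)) hm)
    (fun i m hm x hx => by
      by_cases hi : i.val < r
      · simp only [hi, if_true]
        exact iterate_rectDt_mul_eq_zero hX hT contDiffOn_const ((hβs i).mono hQ) hx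
          (fun m hm => timeDerivAtZero_boundary_residual hv hh hcomp hm hi (hrp hx))
          (hm.trans (Nat.lt_succ_self _))
      · simp only [hi, if_false]
        rw [iterate_rectDt_zero hX hT contDiffOn_const hx]
        simp [timeDerivAtZero])
  have hwd : ∀ i, ∀ p ∈ rect X T, DifferentiableWithinAt ℝ (w i) (rect X T) p := fun i =>
    (hws i).differentiableOn (by simp)
  have hUd : ∀ i, ∀ p ∈ rect X T, DifferentiableWithinAt ℝ (U i) (rect X T) p := fun i =>
    ((hUs i).mono hQ).differentiableOn (by simp)
  have hUx : ∀ i, ∀ p ∈ rect X T, rectDx X T (U i) p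
      = timeTaylor (K + 1) (fun m => derivWithin (W m i) (Ici 0)) p := fun i p hp =>
    rectDx_eq hX (hUd i p hp) hp.1 hp.2 ((hasDerivWithinAt_timeTaylor (K + 1) (fun m => hw m i)
      hp.1.1 p.2).mono fun x hx => hx.1)
  have hUt : ∀ i, ∀ p ∈ rect X T, rectDt X T (U i) p
      = timeTaylor K (fun m => W (m + 1) i) p := fun i p hp =>
    rectDt_eq hT (hUd i p hp) hp.1 hp.2 (hasDerivAt_timeTaylor K p.1 p.2).hasDerivWithinAt
  refine ⟨fun i p => U i p + w i p,
    fun i => (((hUs i).mono hQ).of_le (natCast_le_infty (N + 1))).add (hws i),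
    fun i p hp => ?_, fun i x hx => ?_, fun i hi t ht => ?_⟩
  · refine ⟨_, (hUd i p hp).hasFDerivWithinAt.add (hwd i p hp).hasFDerivWithinAt, ?_⟩
    have h1 := hwsol.equation i p hp
    have h2 := hUx i p hp
    have h3 := hUt i p hp
    have h5 : (((l i p).re)⁻¹ : ℝ) = (l i p)⁻¹ := by rw [Complex.ofReal_inv, ← hlre i p hp]
    have h4 : ∑ k, (l i p)⁻¹ * f i k p * w k p = (l i p)⁻¹ * ∑ k, f i k p * w k p := by
      rw [Finset.mul_sum]
      exact Finset.sum_congr rfl fun k _ => by ring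
    simp only [volterra, Finset.range_one, Finset.sum_singleton, if_true,
      Function.iterate_zero, id_eq, h4, h5, hρ, ← h2, ← h3] at h1
    change rectDt X T (U i) p + rectDt X T (w i) p
      + l i p * (rectDx X T (U i) p + rectDx X T (w i) p) = _
    simp only [mul_add, Finset.sum_add_distrib]
    have h6 := congrArg (fun z => l i p * z) h1
    field_simp [hl0' i p hp] at h6
    linear_combination h6
  · rw [hwsol.initial i x hx.1, add_zero]
    have h1 : W 0 i x = u₀ i x := by rw [hW, formalTimeDeriv]
    exact (timeTaylor_zero_right K x).trans h1
  · have h1 := hwsol.boundary i hi t ht.2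
    simp only [volterra, Finset.range_one, Finset.sum_singleton, true_and,
      Function.iterate_zero, id_eq, hi, if_true, ite_mul, zero_mul, hβ] at h1
    rw [← Finset.sum_filter] at h1
    change U i (0, t) + w i (0, t) = ∑ k with r ≤ k.val, v i k t * (U k (0, t) + w k (0, t)) + h i t
    simp only [mul_add, Finset.sum_add_distrib]
    rw [h1]
    change U i (0, t) + (_ + -1 * (U i (0, t) - ∑ k with r ≤ k.val, v i k t * U k (0, t) - h i t))
      = _
    ring

/-- Uniqueness of classical solutions on a trapezoid of determinacy. -/
theorem IsClassicalSolution.unique {R T c : ℝ} (hc : 0 ≤ c)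
    (hf : ∀ i k, ContinuousOn (f i k) quarterPlane) (hv : ∀ i k, ContinuousOn (v i k) (Ici 0))
    (him : ∀ i, ∀ p ∈ trapezoid R c T, (l i p).im = 0)
    (hle : ∀ i, ∀ p ∈ trapezoid R c T, |(l i p).re| ≤ c)
    (hneg : ∀ i : Fin n, ¬ i.val < r → ∀ p ∈ trapezoid R c T, (l i p).re < 0)
    {u w : Fin n → ℝ × ℝ → ℂ} (hu : IsClassicalSolution r l f a u₀ v h (trapezoid R c T) u)
    (hw : IsClassicalSolution r l f a u₀ v h (trapezoid R c T) w) (i : Fin n) :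
    EqOn (u i) (w i) (trapezoid R c T) := by
  set D := trapezoid R c T with hD
  have hDc : IsCompact D := isCompact_trapezoid hc
  have hDQ : D ⊆ quarterPlane := trapezoid_subset R c T
  choose! u' hu' hue using hu.equation
  choose! w' hw' hwe using hw.equation
  choose L hL using fun i k => hDc.exists_bound_of_continuousOn ((hf i k).mono hDQ)
  choose M hM using fun i k =>
    (isCompact_Icc (a := 0) (b := T)).exists_bound_of_continuousOn
      ((hv i k).mono fun t ht => ht.1)
  set L' := ∑ i, ∑ k, |L i k| with hL'
  set M' := 1 + ∑ i, ∑ k, |M i k| with hM'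
  have hL0 : 0 ≤ L' := Finset.sum_nonneg fun i _ => Finset.sum_nonneg fun k _ => abs_nonneg _
  have hM0 : 1 ≤ M' := by
    have : 0 ≤ ∑ i, ∑ k, |M i k| :=
      Finset.sum_nonneg fun i _ => Finset.sum_nonneg fun k _ => abs_nonneg _
    linarith
  have hLi : ∀ i, ∑ k, |L i k| ≤ L' := fun i =>
    Finset.single_le_sum (f := fun i => ∑ k, |L i k|)
      (fun i _ => Finset.sum_nonneg fun k _ => abs_nonneg _) (Finset.mem_univ i)
  have hMi : ∀ i, ∑ k, |M i k| ≤ M' := fun i => by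
    have := Finset.single_le_sum (f := fun i => ∑ k, |M i k|)
      (fun i _ => Finset.sum_nonneg fun k _ => abs_nonneg _) (Finset.mem_univ i)
    linarith
  have key := mixed_problem_estimate (pos := fun i : Fin n => i.val < r) (R := R) (T := T)
    (u := fun i p => u i p - w i p) (u' := fun i p => u' i p - w' i p)
    (l := fun i p => (l i p).re) hc hL0 hM0 le_rfl
    (fun i p hp => (hu' i p hp).sub (hw' i p hp)) hle (fun i hi p hp _ => (hneg i hi p hp).le)
    (fun i p hp B hB => by
      have e : (u' i p - w' i p) ((l i p).re, 1) = ∑ k, f i k p * (u k p - w k p) := by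
        have e1 : (((l i p).re, 1) : ℝ × ℝ) = (0, 1) + (l i p).re • (1, 0) := by simp
        have e2 : ((l i p).re : ℂ) = l i p := Complex.ext (by simp) (by simp [him i p hp])
        rw [e1, map_add, map_smul]
        simp only [sub_apply, Complex.real_smul, e2, mul_sub,
          Finset.sum_sub_distrib]
        linear_combination hue i p hp - hwe i p hp
      have hB0 : ∀ k : Fin n, 0 ≤ B := fun k => (norm_nonneg _).trans (hB k)
      rw [e, add_zero]
      refine (norm_sum_le_of_le _ fun k _ => (norm_mul_le _ _).trans
        (mul_le_mul ((hL i k p hp).trans (le_abs_self _)) (hB k) (norm_nonneg _)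
          (abs_nonneg _))).trans ?_
      rw [← Finset.sum_mul]
      exact mul_le_mul_of_nonneg_right (hLi i) (hB0 i))
    (fun i p hp hp0 => by
      obtain ⟨x, t⟩ := p
      obtain rfl : t = 0 := hp0
      rw [hu.initial i x hp, hw.initial i x hp, sub_self, norm_zero])
    (fun i hi p hp hp0 B hB hBk => by
      obtain ⟨x, t⟩ := p
      obtain rfl : x = 0 := hp0
      have e : u i (0, t) - w i (0, t)
          = ∑ k with r ≤ k.val, v i k t * (u k (0, t) - w k (0, t)) := by
        rw [hu.boundary i hi t hp, hw.boundary i hi t hp]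
        simp only [mul_sub, Finset.sum_sub_distrib]
        ring
      rw [e, add_zero]
      refine (norm_sum_le_of_le _ fun k hk => (norm_mul_le _ _).trans
        (mul_le_mul ((hM i k t ⟨hp.2.1, hp.2.2.1⟩).trans (le_abs_self _))
          (hBk k (not_lt.2 (Finset.mem_filter.1 hk).2)) (norm_nonneg _)
          (abs_nonneg _))).trans ?_
      rw [← Finset.sum_mul]
      refine mul_le_mul_of_nonneg_right ((Finset.sum_le_sum_of_subset_of_nonneg
        (Finset.filter_subset _ _) fun k _ _ => abs_nonneg _).trans (hMi i)) hB)
  intro p hp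
  have := key i p hp
  simp only [mul_zero, zero_mul, norm_le_zero_iff] at this
  exact sub_eq_zero.1 this

/-- A smooth function that maps `[0, ∞)` to `[0, R]` and is the identity on `(-∞, R - 1]`. -/
theorem exists_smooth_retraction {R : ℝ} (hR : 1 ≤ R) :
    ∃ θ : ℝ → ℝ, ContDiff ℝ ∞ θ ∧ (∀ x, 0 ≤ x → θ x ∈ Icc 0 R) ∧ ∀ x ≤ R - 1, θ x = x := by
  refine ⟨fun x => (1 - Real.smoothTransition (x - (R - 1))) * x
    + Real.smoothTransition (x - (R - 1)) * R, ?_, fun x hx => ?_, fun x hx => ?_⟩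
  · have h1 : ContDiff ℝ ∞ fun x : ℝ => Real.smoothTransition (x - (R - 1)) :=
      Real.smoothTransition.contDiff.comp (contDiff_id.sub contDiff_const)
    exact ((contDiff_const.sub h1).mul contDiff_id).add (h1.mul contDiff_const)
  · have h0 := Real.smoothTransition.nonneg (x - (R - 1))
    have h1 := Real.smoothTransition.le_one (x - (R - 1))
    simp only
    refine ⟨by nlinarith [mul_nonneg (sub_nonneg.2 h1) hx], ?_⟩
    rcases le_total x R with h2 | h2
    · nlinarith
    · rw [Real.smoothTransition.one_of_one_le (by linarith)]
      linarith
  · simp [Real.smoothTransition.zero_of_nonpos (show x - (R - 1) ≤ 0 by linarith)]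

/-- Existence of smooth functions on the quarter plane that solve the mixed problem at all points
with `x < R - 1` and `t < T - 1`. On the trapezoid of determinacy the solutions of the classes
`C^(N+1)` agree, so that they are smooth; they are extended to the quarter plane by composition with
a smooth map to `[0, R] × [0, T]`. -/
theorem exists_smooth_solution {R T c : ℝ} (hR : 1 ≤ R) (hT : 1 ≤ T) (hc : 0 ≤ c)
    (hl : ∀ i, ContDiffOn ℝ ∞ (l i) quarterPlane)
    (hf : ∀ i k, ContDiffOn ℝ ∞ (f i k) quarterPlane)
    (ha : ∀ i, ContDiffOn ℝ ∞ (a i) quarterPlane) (hu₀ : ∀ i, ContDiffOn ℝ ∞ (u₀ i) (Ici 0))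
    (hv : ∀ i k, ContDiffOn ℝ ∞ (v i k) (Ici 0)) (hh : ∀ i, ContDiffOn ℝ ∞ (h i) (Ici 0))
    (hcomp : ClassicallyCompatible r l f a u₀ v h)
    (him : ∀ i, ∀ p ∈ rect (R + c * T) T, (l i p).im = 0)
    (hle : ∀ i, ∀ p ∈ rect (R + c * T) T, |(l i p).re| ≤ c)
    (hpos : ∀ i : Fin n, i.val < r → ∀ p ∈ rect (R + c * T) T, 0 < (l i p).re)
    (hneg : ∀ i : Fin n, ¬ i.val < r → ∀ p ∈ rect (R + c * T) T, (l i p).re < 0) :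
    ∃ u : Fin n → ℝ × ℝ → ℂ, (∀ i, ContDiffOn ℝ ∞ (u i) quarterPlane) ∧
      (∀ i, ∀ p ∈ quarterPlane, p.1 < R - 1 → p.2 < T - 1 →
        fderivWithin ℝ (u i) quarterPlane p (0, 1)
          + l i p * fderivWithin ℝ (u i) quarterPlane p (1, 0) = ∑ k, f i k p * u k p + a i p) ∧
      (∀ i, ∀ x, 0 ≤ x → x < R - 1 → 0 < T - 1 → u i (x, 0) = u₀ i x) ∧
      ∀ i : Fin n, i.val < r → ∀ t, 0 ≤ t → t < T - 1 → 0 < R - 1 →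
        u i (0, t) = ∑ k with r ≤ k.val, v i k t * u k (0, t) + h i t := by
  have hT0 : 0 < T := by linarith
  have hcT : 0 ≤ c * T := by positivity
  have hX : 0 < R + c * T := by linarith
  have hsub : trapezoid R c T ⊆ rect (R + c * T) T := fun p hp =>
    ⟨⟨hp.1, hp.2.2.2.trans (by nlinarith [mul_nonneg hc hp.2.1])⟩, hp.2.1, hp.2.2.1⟩
  have hbox : rect R T ⊆ trapezoid R c T := box_subset_trapezoid hc
  choose w hws hw using exists_isClassicalSolution_rect hX hT0 hl hf ha hu₀ hv hh hcomp him hpos hneg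
  have huniq : ∀ N i, EqOn (w N i) (w 0 i) (trapezoid R c T) := fun N =>
    ((hw N).mono hsub).unique hc (fun i k => (hf i k).continuousOn) (fun i k => (hv i k).continuousOn)
      (fun i p hp => him i p (hsub hp)) (fun i p hp => hle i p (hsub hp))
      (fun i hi p hp => hneg i hi p (hsub hp)) ((hw 0).mono hsub)
  have hsm : ∀ i, ContDiffOn ℝ ∞ (w 0 i) (rect R T) := fun i => contDiffOn_infty.2 fun N =>
    (((hws N i).mono (hbox.trans hsub)).congr fun p hp => (huniq N i (hbox hp)).symm).of_le
      (by exact_mod_cast Nat.le_succ N)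
  obtain ⟨θ, hθ, hθm, hθe⟩ := exists_smooth_retraction hR
  obtain ⟨η, hη, hηm, hηe⟩ := exists_smooth_retraction hT
  have hΘ : ContDiff ℝ ∞ fun p : ℝ × ℝ => (θ p.1, η p.2) :=
    (hθ.comp contDiff_fst).prodMk (hη.comp contDiff_snd)
  have hsol := (hw 0).mono (hbox.trans hsub)
  have heq : ∀ i, ∀ p : ℝ × ℝ, p.1 ≤ R - 1 → p.2 ≤ T - 1 →
      w 0 i (θ p.1, η p.2) = w 0 i p := fun i p h1 h2 => by rw [hθe _ h1, hηe _ h2]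
  refine ⟨fun i p => w 0 i (θ p.1, η p.2), fun i => (hsm i).comp hΘ.contDiffOn
    fun p hp => ⟨hθm _ hp.1, hηm _ hp.2⟩, fun i p hp h1 h2 => ?_, fun i x hx h1 h2 => ?_,
    fun i hi t ht h1 h2 => ?_⟩
  · have hp' : p ∈ rect R T := ⟨⟨hp.1, by linarith⟩, hp.2, by linarith⟩
    obtain ⟨u', hu', he⟩ := hsol.equation i p hp'
    have hnb : ∀ᶠ q in 𝓝 p, q.1 < R - 1 ∧ q.2 < T - 1 :=
      (continuous_fst.continuousAt.eventually_lt_const h1).and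
        (continuous_snd.continuousAt.eventually_lt_const h2)
    have hmem : rect R T ∈ 𝓝[quarterPlane] p := by
      filter_upwards [self_mem_nhdsWithin, mem_nhdsWithin_of_mem_nhds hnb] with q hq h
      exact ⟨⟨hq.1, by linarith [h.1]⟩, hq.2, by linarith [h.2]⟩
    have h3 : HasFDerivWithinAt (fun p => w 0 i (θ p.1, η p.2)) u' quarterPlane p := by
      refine (hu'.mono_of_mem_nhdsWithin hmem).congr_of_eventuallyEq ?_ (heq i p h1.le h2.le)
      filter_upwards [mem_nhdsWithin_of_mem_nhds hnb] with q hq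
      exact heq i q hq.1.le hq.2.le
    rw [h3.fderivWithin (Fact.out (p := UniqueDiffOn ℝ quarterPlane) p hp), he]
    simp only [heq _ p h1.le h2.le]
  · simp only [heq i (x, 0) h1.le h2.le]
    exact hsol.initial i x ⟨⟨hx, by linarith⟩, le_rfl, by linarith⟩
  · simp only [heq _ (0, t) h2.le h1.le]
    exact hsol.boundary i hi t ⟨⟨le_rfl, by linarith⟩, ht, by linarith⟩

end Classical

/-! ### Scales -/

/-- A scale is a way to quantify over mollifiers and over exponents of `ε`. -/
structure Scale where
  /-- The mollifiers `χ` and exponents `a` such that an estimate with loss `ε^(-N)` has to hold with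
  the bound `ε^(a-N)`. -/
  set : ℕ → Set (Mollifier × ℤ)
  anti : Antitone set
  mem : ∀ {N χ a}, (χ, a) ∈ set N → χ.1 ∈ mollifiers N

/-- The scale that defines moderate families. -/
def Scale.moderate : Scale where
  set N := {p | p.1.1 ∈ mollifiers N ∧ p.2 = 0}
  anti _ _ h _ hp := ⟨mollifiers_anti h hp.1, hp.2⟩
  mem h := h.1

/-- The scale that defines negligible families. -/
def Scale.negligible : Scale where
  set N := {p | ∃ q : ℕ, N ≤ q ∧ p.1.1 ∈ mollifiers q ∧ p.2 = q}
  anti _ _ h := by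
    rintro p ⟨q, hq, hp⟩
    exact ⟨q, h.trans hq, hp⟩
  mem := by
    rintro N χ a ⟨q, hq, hp, -⟩
    exact mollifiers_anti hq hp

/-! ### Smooth families as a differential algebra -/

section Families

variable {V W : Type} [NormedAddCommGroup V] [NormedSpace ℝ V]
  [NormedAddCommGroup W] [NormedSpace ℝ W]

/-- The algebra of all families of smooth functions on `Ω`, without growth conditions. -/
def smoothFamilies (Ω : Set V) : Subalgebra ℂ (Mollifier → V → ℂ) where
  carrier := {u | IsSmooth Ω u}
  mul_mem' hu hv χ := (hu χ).mul (hv χ)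
  add_mem' hu hv χ := (hu χ).add (hv χ)
  algebraMap_mem' _ _ := contDiffOn_const

/-- The derivatives of order at most `k` of the family `u` satisfy the estimates prescribed by the
scale `s`. For the scales `Scale.moderate` and `Scale.negligible` and for all `k` these are the
conditions for moderate and for negligible families. -/
def IsControlled {Ω : Set V} (s : Scale) (k : ℕ) (u : smoothFamilies Ω) : Prop :=
  ∀ K ⊆ Ω, IsCompact K → ∃ N : ℕ, ∀ χ a, (χ, a) ∈ s.set N → ∀ i ≤ k,
    DerivBound Ω u.1 K i χ (a - N)

/-- On every compact set the family vanishes near each point of this set, if `ε` is small. -/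
def IsNull {Ω : Set V} (u : smoothFamilies Ω) : Prop :=
  ∀ K ⊆ Ω, IsCompact K → ∃ N : ℕ, ∀ χ : Mollifier, χ.1 ∈ mollifiers N →
    ∀ᶠ ε in 𝓝[>] (0 : ℝ), ∀ x ∈ K, u.1 (χ.scale ε) =ᶠ[𝓝[Ω] x] 0

theorem IsControlled.mono_order {Ω : Set V} {s : Scale} {k : ℕ} {u : smoothFamilies Ω}
    (hu : IsControlled s k u) {j : ℕ} (hj : j ≤ k) : IsControlled s j u := fun K hK hc => by
  obtain ⟨N, hN⟩ := hu K hK hc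
  exact ⟨N, fun χ a h i hi => hN χ a h i (hi.trans hj)⟩

variable (Ω : Set V) [hΩ : Fact (UniqueDiffOn ℝ Ω)]

/-- The derivative of smooth families in the direction `e`. It is set to zero outside `Ω`, so that
the rules of calculus hold without restricting to points of `Ω`. -/
noncomputable def familyDeriv (e : V) : Derivation ℂ (smoothFamilies Ω) (smoothFamilies Ω) :=
  Derivation.mk'
    { toFun u := ⟨fun χ => Ω.indicator fun x => fderivWithin ℝ (u.1 χ) Ω x e, fun χ =>
        (((u.2 χ).fderivWithin hΩ.out (by simp)).clm_apply contDiffOn_const).congr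
          fun x hx => indicator_of_mem hx _⟩
      map_add' u v := by
        refine Subtype.ext (funext fun χ => funext fun x => ?_)
        change Ω.indicator (fun x => fderivWithin ℝ (u.1 χ + v.1 χ) Ω x e) x
            = Ω.indicator (fun x => fderivWithin ℝ (u.1 χ) Ω x e) x
              + Ω.indicator (fun x => fderivWithin ℝ (v.1 χ) Ω x e) x
        by_cases hx : x ∈ Ω
        · have h := fderivWithin_add (hΩ.out x hx) ((u.2 χ).differentiableOn (by simp) x hx)
            ((v.2 χ).differentiableOn (by simp) x hx)
          simp only [indicator_of_mem hx, h, add_apply]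
        · simp only [indicator_of_notMem hx, add_zero]
      map_smul' c u := by
        refine Subtype.ext (funext fun χ => funext fun x => ?_)
        change Ω.indicator (fun x => fderivWithin ℝ (c • u.1 χ) Ω x e) x
            = c • Ω.indicator (fun x => fderivWithin ℝ (u.1 χ) Ω x e) x
        by_cases hx : x ∈ Ω
        · have h := fderivWithin_const_smul (hΩ.out x hx)
            ((u.2 χ).differentiableOn (by simp) x hx) c
          simp only [indicator_of_mem hx, h, smul_apply]
        · simp only [indicator_of_notMem hx, smul_zero] }
    fun u v => by
      refine Subtype.ext (funext fun χ => funext fun x => ?_)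
      change Ω.indicator (fun x => fderivWithin ℝ (u.1 χ * v.1 χ) Ω x e) x
            = u.1 χ x * Ω.indicator (fun x => fderivWithin ℝ (v.1 χ) Ω x e) x
              + v.1 χ x * Ω.indicator (fun x => fderivWithin ℝ (u.1 χ) Ω x e) x
      by_cases hx : x ∈ Ω
      · have h := fderivWithin_mul (hΩ.out x hx) ((u.2 χ).differentiableOn (by simp) x hx)
            ((v.2 χ).differentiableOn (by simp) x hx)
        simp only [indicator_of_mem hx, h, add_apply, smul_apply, smul_eq_mul]
      · simp only [indicator_of_notMem hx, mul_zero, add_zero]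

variable {Ω}

theorem familyDeriv_apply (e : V) (u : smoothFamilies Ω) (χ : Mollifier) {x : V} (hx : x ∈ Ω) :
    (familyDeriv Ω e u).1 χ x = fderivWithin ℝ (u.1 χ) Ω x e :=
  indicator_of_mem (f := fun x => fderivWithin ℝ (u.1 χ) Ω x e) hx

theorem familyDeriv_apply_of_notMem (e : V) (u : smoothFamilies Ω) (χ : Mollifier) {x : V}
    (hx : x ∉ Ω) : (familyDeriv Ω e u).1 χ x = 0 :=
  indicator_of_notMem (f := fun x => fderivWithin ℝ (u.1 χ) Ω x e) hx

theorem familyDeriv_comm (hcl : Ω ⊆ closure (interior Ω)) (e e' : V) (u : smoothFamilies Ω) :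
    familyDeriv Ω e (familyDeriv Ω e' u) = familyDeriv Ω e' (familyDeriv Ω e u) := by
  have key : ∀ (e e' : V) χ, ∀ x ∈ Ω, (familyDeriv Ω e (familyDeriv Ω e' u)).1 χ x
      = fderivWithin ℝ (fderivWithin ℝ (u.1 χ) Ω) Ω x e e' := fun e e' χ x hx => by
    have h1 : ContDiffOn ℝ ∞ (fderivWithin ℝ (u.1 χ) Ω) Ω :=
      (u.2 χ).fderivWithin hΩ.out (by simp)
    have h2 : ((familyDeriv Ω e' u).1 χ) = Ω.indicator fun x => fderivWithin ℝ (u.1 χ) Ω x e' := rfl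
    rw [familyDeriv_apply e _ χ hx, h2,
      fderivWithin_congr (fun y hy => indicator_of_mem hy _) (indicator_of_mem hx _),
      fderivWithin_clm_apply (hΩ.out x hx) (h1.differentiableOn (by simp) x hx)
        (differentiableWithinAt_const _)]
    simp [fderivWithin_const_apply]
  refine Subtype.ext (funext fun χ => funext fun x => ?_)
  by_cases hx : x ∈ Ω
  · rw [key e e' χ x hx, key e' e χ x hx]
    exact ((u.2 χ) x hx).isSymmSndFDerivWithinAt
      (by simpa using natCast_le_infty 2) hΩ.out (hcl hx) hx e e'
  · rw [familyDeriv_apply_of_notMem _ _ _ hx, familyDeriv_apply_of_notMem _ _ _ hx]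

variable {Ω' : Set W} [hΩ' : Fact (UniqueDiffOn ℝ Ω')]

/-- Pull-back of smooth families along a linear map `g` with `g⁻¹(Ω) = Ω'`. -/
def familyPullback (g : W →L[ℝ] V) (hg : g ⁻¹' Ω = Ω') :
    smoothFamilies Ω →ₐ[ℂ] smoothFamilies Ω' where
  toFun u := ⟨fun χ x => u.1 χ (g x), fun χ =>
    (u.2 χ).comp g.contDiff.contDiffOn fun x hx => by rw [← hg] at hx; exact hx⟩
  map_one' := rfl
  map_zero' := rfl
  map_mul' _ _ := rfl
  map_add' _ _ := rfl
  commutes' _ := rfl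

theorem familyPullback_deriv (g : W →L[ℝ] V) (hg : g ⁻¹' Ω = Ω') (e : W) (u : smoothFamilies Ω) :
    familyPullback g hg (familyDeriv Ω (g e) u) = familyDeriv Ω' e (familyPullback g hg u) := by
  refine Subtype.ext (funext fun χ => funext fun x => ?_)
  change (familyDeriv Ω (g e) u).1 χ (g x) = _
  by_cases hx : x ∈ Ω'
  · have hx' : g x ∈ Ω := by rw [← hg] at hx; exact hx
    rw [familyDeriv_apply _ _ _ hx', familyDeriv_apply _ _ _ hx]
    have h := ((u.2 χ).differentiableOn (by simp) (g x) hx').hasFDerivWithinAt.comp x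
      g.hasFDerivWithinAt (fun y (hy : y ∈ Ω') => by rw [← hg] at hy; exact hy)
    change _ = fderivWithin ℝ (u.1 χ ∘ g) Ω' x e
    rw [h.fderivWithin (hΩ'.out x hx)]
    rfl
  · have hx' : g x ∉ Ω := fun h => hx (by rw [← hg]; exact h)
    rw [familyDeriv_apply_of_notMem _ _ _ hx', familyDeriv_apply_of_notMem _ _ _ hx]

end Families

/-! ### Calculus of controlled and null families -/

section Calculus

variable {V W : Type} [NormedAddCommGroup V] [NormedSpace ℝ V]
  [NormedAddCommGroup W] [NormedSpace ℝ W] {Ω : Set V} {s : Scale} {k : ℕ}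
  {u v m : smoothFamilies Ω}

theorem isModerate_iff : IsModerate Ω u.1 ↔ ∀ k, IsControlled Scale.moderate k u := by
  refine ⟨fun h k K hK hc => ?_, fun h K hK hc k => ?_⟩
  · obtain ⟨N, hN⟩ := h.uniform hK hc k
    refine ⟨N, fun χ a ha i hi => ?_⟩
    obtain ⟨h1, h2⟩ : χ.1 ∈ mollifiers N ∧ a = 0 := ha
    rw [h2, zero_sub]
    exact hN χ h1 i hi
  · obtain ⟨N, hN⟩ := h k K hK hc
    refine ⟨N, fun χ hχ => ?_⟩
    rw [← zero_sub]
    exact hN χ 0 ⟨hχ, rfl⟩ k le_rfl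

theorem isNegligible_iff : IsNegligible Ω u.1 ↔ ∀ k, IsControlled Scale.negligible k u := by
  refine ⟨fun h k K hK hc => ?_, fun h K hK hc k => ?_⟩
  · obtain ⟨N, hN⟩ := h.uniform hK hc k
    refine ⟨N, fun χ a ha i hi => ?_⟩
    obtain ⟨q, hq, h1, rfl⟩ := ha
    exact hN q hq χ h1 i hi
  · obtain ⟨N, hN⟩ := h k K hK hc
    exact ⟨N, fun q hq χ hχ => hN χ q ⟨q, hq, hχ, rfl⟩ k le_rfl⟩

theorem IsNull.isControlled (hu : IsNull u) (s : Scale) (k : ℕ) : IsControlled s k u :=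
  fun K hK hc => by
    obtain ⟨N, hN⟩ := hu K hK hc
    refine ⟨N, fun χ a ha i _ => ⟨0, ?_⟩⟩
    filter_upwards [hN χ (s.mem ha)] with ε hε x hx
    have h1 := (hε x hx).iteratedFDerivWithin_eq (𝕜 := ℝ)
      ((hε x hx).self_of_nhdsWithin (hK hx)) i
    rw [h1, zero_mul]
    simp

theorem IsNull.add (hu : IsNull u) (hv : IsNull v) : IsNull (u + v) := fun K hK hc => by
  obtain ⟨N, hN⟩ := hu K hK hc
  obtain ⟨M, hM⟩ := hv K hK hc
  refine ⟨N + M, fun χ hχ => ?_⟩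
  filter_upwards [hN χ (mollifiers_anti (by omega) hχ), hM χ (mollifiers_anti (by omega) hχ)]
    with ε h1 h2 x hx
  filter_upwards [h1 x hx, h2 x hx] with y h3 h4
  change u.1 _ y + v.1 _ y = 0
  simp [h3, h4]

theorem IsNull.mul_right (hu : IsNull u) (v : smoothFamilies Ω) : IsNull (u * v) :=
  fun K hK hc => by
    obtain ⟨N, hN⟩ := hu K hK hc
    refine ⟨N, fun χ hχ => ?_⟩
    filter_upwards [hN χ hχ] with ε h1 x hx
    filter_upwards [h1 x hx] with y h3
    change u.1 _ y * v.1 _ y = 0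
    simp [h3]

theorem IsNull.mul_left (hu : IsNull u) (v : smoothFamilies Ω) : IsNull (v * u) := by
  rw [mul_comm]
  exact hu.mul_right v

theorem IsNull.neg (hu : IsNull u) : IsNull (-u) := fun K hK hc => by
  obtain ⟨N, hN⟩ := hu K hK hc
  refine ⟨N, fun χ hχ => ?_⟩
  filter_upwards [hN χ hχ] with ε h1 x hx
  filter_upwards [h1 x hx] with y h3
  change -u.1 _ y = 0
  simp [h3]

theorem IsNull.sub (hu : IsNull u) (hv : IsNull v) : IsNull (u - v) := by
  rw [sub_eq_add_neg]
  exact hu.add hv.neg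

theorem isNull_zero : IsNull (0 : smoothFamilies Ω) := fun _ _ _ =>
  ⟨0, fun _ _ => Eventually.of_forall fun _ _ _ => EventuallyEq.rfl⟩

theorem isControlled_zero : IsControlled s k (0 : smoothFamilies Ω) := isNull_zero.isControlled s k

variable [hΩ : Fact (UniqueDiffOn ℝ Ω)]

theorem IsNull.deriv (hu : IsNull u) (e : V) : IsNull (familyDeriv Ω e u) := fun K hK hc => by
  obtain ⟨N, hN⟩ := hu K hK hc
  refine ⟨N, fun χ hχ => ?_⟩
  filter_upwards [hN χ hχ] with ε h1 x hx
  filter_upwards [eventually_eventually_nhdsWithin.2 (h1 x hx), self_mem_nhdsWithin] with y h3 hy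
  rw [familyDeriv_apply _ _ _ hy]
  have h4 : u.1 (χ.scale ε) =ᶠ[𝓝[Ω] y] fun _ => 0 := h3
  rw [h4.fderivWithin_eq (h4.self_of_nhdsWithin hy)]
  simp

theorem IsControlled.add (hu : IsControlled s k u) (hv : IsControlled s k v) :
    IsControlled s k (u + v) := fun K hK hc => by
  obtain ⟨N, hN⟩ := hu K hK hc
  obtain ⟨M, hM⟩ := hv K hK hc
  refine ⟨N + M, fun χ a ha i hi => ?_⟩
  exact DerivBound.add hΩ.out hK u.2 v.2
    ((hN χ a (s.anti (by omega) ha) i hi).mono (by push_cast; omega))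
    ((hM χ a (s.anti (by omega) ha) i hi).mono (by push_cast; omega))

/-- A product is controlled if one factor is controlled and the other one is moderate. -/
theorem IsControlled.mul (hm : IsControlled Scale.moderate k m) (hu : IsControlled s k u) :
    IsControlled s k (m * u) := fun K hK hc => by
  obtain ⟨N, hN⟩ := hm K hK hc
  obtain ⟨M, hM⟩ := hu K hK hc
  refine ⟨N + M, fun χ a ha i hi => ?_⟩
  have h1 := s.anti (show M ≤ N + M by omega) ha
  have h2 := mollifiers_anti (show N ≤ N + M by omega) (s.mem ha)
  exact (DerivBound.mul hΩ.out hK m.2 u.2 (fun j hj => hN χ 0 ⟨h2, rfl⟩ j (hj.trans hi))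
    (fun j hj => hM χ a h1 j (hj.trans hi))).mono (by push_cast; omega)

theorem IsControlled.neg (hu : IsControlled s k u) : IsControlled s k (-u) := fun K hK hc => by
  obtain ⟨N, hN⟩ := hu K hK hc
  exact ⟨N, fun χ a ha i hi => (hN χ a ha i hi).neg hΩ.out hK⟩

theorem IsControlled.sub (hu : IsControlled s k u) (hv : IsControlled s k v) :
    IsControlled s k (u - v) := by
  rw [sub_eq_add_neg]
  exact hu.add hv.neg

theorem IsControlled.sum {ι : Type*} {t : Finset ι} {u : ι → smoothFamilies Ω}
    (hu : ∀ i ∈ t, IsControlled s k (u i)) : IsControlled s k (∑ i ∈ t, u i) :=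
  Finset.sum_induction u (IsControlled s k) (fun _ _ h h' => h.add h') isControlled_zero hu

theorem IsControlled.deriv (hu : IsControlled s (k + 1) u) (e : V) :
    IsControlled s k (familyDeriv Ω e u) := fun K hK hc => by
  obtain ⟨N, hN⟩ := hu K hK hc
  refine ⟨N, fun χ a ha i hi => ?_⟩
  refine ((hN χ a ha (i + 1) (by omega)).deriv hΩ.out hK u.2 e).congr hK fun ψ x hx => ?_
  exact (familyDeriv_apply e u ψ hx).symm

variable {Ω' : Set W} [hΩ' : Fact (UniqueDiffOn ℝ Ω')]

theorem IsControlled.pullback (hu : IsControlled s k u) (g : W →L[ℝ] V) (hg : g ⁻¹' Ω = Ω') :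
    IsControlled s k (familyPullback g hg u) := fun K hK hc => by
  obtain ⟨N, hN⟩ := hu (g '' K) (by rw [image_subset_iff, hg]; exact hK) (hc.image g.continuous)
  exact ⟨N, fun χ a ha i hi => (hN χ a ha i hi).pullback hΩ.out hΩ'.out u.2 g hg hK⟩

end Calculus

/-- Families on subsets of the plane are controlled to order `k + 1` if they and their two partial
derivatives are controlled to order `k`. -/
theorem isControlled_succ {Ω : Set (ℝ × ℝ)} [hΩ : Fact (UniqueDiffOn ℝ Ω)] {s : Scale} {k : ℕ}
    {u : smoothFamilies Ω} (hu : IsControlled s k u)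
    (hx : IsControlled s k (familyDeriv Ω (1, 0) u))
    (ht : IsControlled s k (familyDeriv Ω (0, 1) u)) : IsControlled s (k + 1) u :=
  fun K hK hc => by
    obtain ⟨N₀, h0⟩ := hu K hK hc
    obtain ⟨N₁, h1⟩ := hx K hK hc
    obtain ⟨N₂, h2⟩ := ht K hK hc
    refine ⟨N₀ + N₁ + N₂, fun χ a ha i hi => ?_⟩
    rcases i with _ | i
    · exact (h0 χ a (s.anti (by omega) ha) 0 (by omega)).mono (by push_cast; omega)
    have hi' : i ≤ k := by omega
    obtain ⟨C₁, h1⟩ := (h1 χ a (s.anti (show N₁ ≤ N₀ + N₁ + N₂ by omega) ha) i hi').mono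
      (show a - ((N₀ + N₁ + N₂ : ℕ) : ℤ) ≤ a - N₁ by push_cast; omega)
    obtain ⟨C₂, h2⟩ := (h2 χ a (s.anti (show N₂ ≤ N₀ + N₁ + N₂ by omega) ha) i hi').mono
      (show a - ((N₀ + N₁ + N₂ : ℕ) : ℤ) ≤ a - N₂ by push_cast; omega)
    set L₁ : ℂ →L[ℝ] (ℝ × ℝ →L[ℝ] ℂ) :=
      ContinuousLinearMap.smulRightL ℝ (ℝ × ℝ) ℂ (ContinuousLinearMap.fst ℝ ℝ ℝ) with hL₁
    set L₂ : ℂ →L[ℝ] (ℝ × ℝ →L[ℝ] ℂ) :=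
      ContinuousLinearMap.smulRightL ℝ (ℝ × ℝ) ℂ (ContinuousLinearMap.snd ℝ ℝ ℝ) with hL₂
    refine ⟨‖L₁‖ * C₁ + ‖L₂‖ * C₂, ?_⟩
    filter_upwards [h1, h2] with ε h1 h2 x hx
    set ψ := χ.scale ε with hψ
    have e1 : EqOn (fderivWithin ℝ (u.1 ψ) Ω)
        ((L₁ ∘ (familyDeriv Ω (1, 0) u).1 ψ) + (L₂ ∘ (familyDeriv Ω (0, 1) u).1 ψ)) Ω := by
      intro y hy
      refine ContinuousLinearMap.ext fun z => ?_
      obtain ⟨z1, z2⟩ := z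
      have e : ((z1, z2) : ℝ × ℝ) = z1 • (1, 0) + z2 • (0, 1) := by simp
      simp only [Pi.add_apply, Function.comp_apply, familyDeriv_apply _ _ _ hy]
      rw [e, map_add, map_smul, map_smul]
      simp [hL₁, hL₂]
    have s1 := (((familyDeriv Ω (1, 0) u).2 ψ) x (hK hx)).of_le (natCast_le_infty i)
    have s2 := (((familyDeriv Ω (0, 1) u).2 ψ) x (hK hx)).of_le (natCast_le_infty i)
    have b1 : ∀ (L : ℂ →L[ℝ] (ℝ × ℝ →L[ℝ] ℂ)) {g : ℝ × ℝ → ℂ}, ContDiffWithinAt ℝ i g Ω x →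
        ‖iteratedFDerivWithin ℝ i (L ∘ g) Ω x‖ ≤ ‖L‖ * ‖iteratedFDerivWithin ℝ i g Ω x‖ :=
      fun L g hg => by
        rw [L.iteratedFDerivWithin_comp_left hg hΩ.out (hK hx) le_rfl]
        exact L.norm_compContinuousMultilinearMap_le _
    rw [← norm_iteratedFDerivWithin_fderivWithin hΩ.out (hK hx),
      iteratedFDerivWithin_congr e1 (hK hx), iteratedFDerivWithin_add_apply
        (L₁.contDiff.contDiffAt.comp_contDiffWithinAt x s1)
        (L₂.contDiff.contDiffAt.comp_contDiffWithinAt x s2) hΩ.out (hK hx), add_mul, mul_assoc,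
      mul_assoc]
    refine (norm_add_le _ _).trans (add_le_add ((b1 L₁ s1).trans ?_) ((b1 L₂ s2).trans ?_))
    · exact mul_le_mul_of_nonneg_left (h1 x hx) L₁.opNorm_nonneg
    · exact mul_le_mul_of_nonneg_left (h2 x hx) L₂.opNorm_nonneg

/-! ### Gluing and inverse families -/

theorem Mollifier.scale_apply (χ : Mollifier) {ε : ℝ} (hε : 0 < ε) (x : ℝ) :
    (χ.scale ε).1 x = ε⁻¹ * χ.1 (x / ε) := by
  simp [Mollifier.scale, hε, rescale]

/-- The supremum of a mollifier distinguishes small values of `ε`: the supremum of `χ_ε` tends to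
infinity for `ε → 0`. -/
theorem eventually_le_floor_iSup (χ : Mollifier) (j : ℕ) :
    ∀ᶠ ε in 𝓝[>] (0 : ℝ), j ≤ ⌊⨆ x, |(χ.scale ε).1 x|⌋₊ := by
  obtain ⟨x₀, hx₀⟩ : ∃ x, χ.1 x ≠ 0 := by
    by_contra! h
    have h1 := χ.2.2.2.1
    simp [h] at h1
  have h1 : Tendsto (fun ε : ℝ => ε⁻¹ * |χ.1 x₀|) (𝓝[>] 0) atTop :=
    tendsto_inv_nhdsGT_zero.atTop_mul_const (abs_pos.2 hx₀)
  filter_upwards [h1.eventually_ge_atTop (j : ℝ), self_mem_nhdsWithin] with ε hε h0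
  have h0 : 0 < ε := h0
  refine Nat.le_floor (hε.trans ?_)
  have h2 : BddAbove (range fun x => |(χ.scale ε).1 x|) := by
    obtain ⟨C, hC⟩ := (χ.scale ε).2.2.1.exists_bound_of_continuous (χ.scale ε).2.1.continuous
    exact ⟨C, by rintro _ ⟨x, rfl⟩; exact hC x⟩
  refine le_trans (le_of_eq ?_) (le_ciSup h2 (ε * x₀))
  rw [Mollifier.scale_apply χ h0, mul_div_cancel_left₀ _ h0.ne', abs_mul,
    abs_of_pos (inv_pos.2 h0)]

/-- Objects with the property `P j` that exist for small `ε`, depending on `j`, can be combined to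
a single family. -/
theorem exists_glued_family {β : Type*} [Nonempty β] {P : ℕ → Mollifier → β → Prop}
    (hP : ∀ {i j φ b}, i ≤ j → P j φ b → P i φ b)
    (h : ∀ j, ∃ N : ℕ, ∀ χ : Mollifier, χ.1 ∈ mollifiers N → ∀ᶠ ε in 𝓝[>] (0 : ℝ),
      ∃ b, P j (χ.scale ε) b) :
    ∃ B : Mollifier → β, ∀ j, ∃ N : ℕ, ∀ χ : Mollifier, χ.1 ∈ mollifiers N →
      ∀ᶠ ε in 𝓝[>] (0 : ℝ), P j (χ.scale ε) (B (χ.scale ε)) := by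
  classical
  let J : Mollifier → ℕ := fun φ => Nat.findGreatest (fun j => ∃ b, P j φ b) ⌊⨆ x, |φ.1 x|⌋₊
  refine ⟨fun φ => Classical.epsilon (P (J φ) φ), fun j => ?_⟩
  obtain ⟨N, hN⟩ := h j
  refine ⟨N, fun χ hχ => ?_⟩
  filter_upwards [hN χ hχ, eventually_le_floor_iSup χ j] with ε h1 h2
  have h3 : ∃ b, P (J (χ.scale ε)) (χ.scale ε) b :=
    Nat.findGreatest_spec (P := fun j => ∃ b, P j (χ.scale ε) b) h2 h1
  exact hP (Nat.le_findGreatest h2 h1) (Classical.epsilon_spec h3)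

theorem exists_nat_box {K : Set (ℝ × ℝ)} (hK : IsCompact K) :
    ∃ j : ℕ, ∀ p ∈ K, p.1 < j ∧ p.2 < j := by
  obtain ⟨C, hC⟩ := hK.isBounded.exists_norm_le
  obtain ⟨j, hj⟩ := exists_nat_gt C
  refine ⟨j, fun p hp => ⟨?_, ?_⟩⟩
  · exact (((le_abs_self p.1).trans (norm_fst_le p)).trans (hC p hp)).trans_lt hj
  · exact (((le_abs_self p.2).trans (norm_snd_le p)).trans (hC p hp)).trans_lt hj

/-- On every compact set, the family is bounded below by a power of `ε`. -/
def IsBoundedBelow {V : Type} [NormedAddCommGroup V] [NormedSpace ℝ V] {Ω : Set V}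
    (u : smoothFamilies Ω) : Prop :=
  ∀ K ⊆ Ω, IsCompact K → ∃ N : ℕ, ∀ χ : Mollifier, χ.1 ∈ mollifiers N →
    ∀ᶠ ε in 𝓝[>] (0 : ℝ), ∀ x ∈ K, ε ^ N ≤ ‖u.1 (χ.scale ε) x‖

theorem isNull_of_box {u : smoothFamilies quarterPlane}
    (h : ∀ j : ℕ, ∃ N : ℕ, ∀ χ : Mollifier, χ.1 ∈ mollifiers N → ∀ᶠ ε in 𝓝[>] (0 : ℝ),
      ∀ p ∈ quarterPlane, p.1 < j → p.2 < j → u.1 (χ.scale ε) p = 0) : IsNull u :=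
  fun K _ hc => by
    obtain ⟨j, hj⟩ := exists_nat_box hc
    obtain ⟨N, hN⟩ := h j
    refine ⟨N, fun χ hχ => ?_⟩
    filter_upwards [hN χ hχ] with ε hε p hp
    filter_upwards [self_mem_nhdsWithin, mem_nhdsWithin_of_mem_nhds
      (continuous_fst.continuousAt.eventually_lt_const (hj p hp).1), mem_nhdsWithin_of_mem_nhds
      (continuous_snd.continuousAt.eventually_lt_const (hj p hp).2)] with q h1 h2 h3
    exact hε q h1 h2 h3

/-- The inverse of a family that is bounded below, up to a null family. -/
theorem exists_inverse {g : smoothFamilies quarterPlane}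
    (hg : ∀ k, IsControlled Scale.moderate k g) (hb : IsBoundedBelow g) :
    ∃ b : smoothFamilies quarterPlane, (∀ k, IsControlled Scale.moderate k b) ∧
      IsNull (b * g - 1) := by
  let β := {b : ℝ × ℝ → ℂ // ContDiffOn ℝ ∞ b quarterPlane}
  have : Nonempty β := ⟨⟨fun _ => 0, contDiffOn_const⟩⟩
  obtain ⟨B, hB⟩ := exists_glued_family (β := β)
    (P := fun j φ b => ∀ p ∈ quarterPlane, p.1 < j → p.2 < j → b.1 p * g.1 φ p = 1)
    (fun hij h p hp h1 h2 => h p hp (h1.trans_le (by exact_mod_cast hij))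
      (h2.trans_le (by exact_mod_cast hij)))
    (fun j => by
      obtain ⟨N, hN⟩ := hb (rect (j + 1) (j + 1)) (rect_subset_quarterPlane _ _)
        (isCompact_rect _ _)
      refine ⟨N, fun χ hχ => ?_⟩
      filter_upwards [hN χ hχ, self_mem_nhdsWithin] with ε hε h0
      have h0 : 0 < ε := h0
      have hne : ∀ p ∈ rect (j + 1) (j + 1), g.1 (χ.scale ε) p ≠ 0 := fun p hp =>
        norm_pos_iff.1 ((pow_pos h0 N).trans_le (hε p hp))
      obtain ⟨θ, hθ, hθm, hθe⟩ := exists_smooth_retraction (R := (j : ℝ) + 1) (by simp)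
      have hΘ : ContDiff ℝ ∞ fun p : ℝ × ℝ => (θ p.1, θ p.2) :=
        (hθ.comp contDiff_fst).prodMk (hθ.comp contDiff_snd)
      have hm : ∀ p ∈ quarterPlane, (θ p.1, θ p.2) ∈ rect ((j : ℝ) + 1) ((j : ℝ) + 1) :=
        fun p hp => ⟨hθm _ hp.1, hθm _ hp.2⟩
      refine ⟨⟨fun p => (g.1 (χ.scale ε) (θ p.1, θ p.2))⁻¹,
        ((g.2 (χ.scale ε)).comp hΘ.contDiffOn fun p hp =>
          rect_subset_quarterPlane _ _ (hm p hp)).inv fun p hp => hne _ (hm p hp)⟩,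
        fun p hp h1 h2 => ?_⟩
      have h3 := hne _ (hm p hp)
      have h4 : (θ p.1, θ p.2) = p := by rw [hθe _ (by linarith), hθe _ (by linarith)]
      simp only
      rw [h4] at h3 ⊢
      exact inv_mul_cancel₀ h3)
  let b : smoothFamilies quarterPlane := ⟨fun φ => (B φ).1, fun φ => (B φ).2⟩
  have hnull : IsNull (b * g - 1) := isNull_of_box fun j => by
    obtain ⟨N, hN⟩ := hB j
    refine ⟨N, fun χ hχ => ?_⟩
    filter_upwards [hN χ hχ] with ε hε p hp h1 h2
    change (B (χ.scale ε)).1 p * g.1 (χ.scale ε) p - 1 = 0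
    rw [hε p hp h1 h2, sub_self]
  have hzero : IsControlled Scale.moderate 0 b := fun K hK hc => by
    obtain ⟨N, hN⟩ := hb K hK hc
    obtain ⟨M, hM⟩ := hnull K hK hc
    refine ⟨N + M, fun χ a ha i hi => ⟨1, ?_⟩⟩
    obtain ⟨ha, rfl⟩ : χ.1 ∈ mollifiers (N + M) ∧ a = 0 := ha
    obtain rfl : i = 0 := by omega
    filter_upwards [hN χ (mollifiers_anti (by omega) ha), hM χ (mollifiers_anti (by omega) ha),
      eventually_lt_one] with ε h1 h2 h3 p hp
    have h4 : b.1 (χ.scale ε) p * g.1 (χ.scale ε) p - 1 = 0 :=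
      (h2 p hp).self_of_nhdsWithin (hK hp)
    rw [norm_iteratedFDerivWithin_zero, one_mul, zero_sub, zpow_neg, zpow_natCast]
    have h5 : ‖b.1 (χ.scale ε) p‖ * ‖g.1 (χ.scale ε) p‖ = 1 := by
      rw [← norm_mul, sub_eq_zero.1 h4, norm_one]
    have h6 : 0 < ε ^ N := pow_pos h3.1 N
    have h7 : ‖b.1 (χ.scale ε) p‖ ≤ (ε ^ N)⁻¹ := by
      rw [eq_inv_of_mul_eq_one_left h5]
      exact inv_anti₀ h6 (h1 p hp)
    refine h7.trans ?_
    rw [inv_le_inv₀ h6 (pow_pos h3.1 _)]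
    exact pow_le_pow_of_le_one h3.1.le h3.2.le (by omega)
  refine ⟨b, fun k => ?_, hnull⟩
  induction k with
  | zero => exact hzero
  | succ k ih =>
    have hD : ∀ e, IsControlled Scale.moderate k (familyDeriv quarterPlane e b) := fun e => by
      have h1 : familyDeriv quarterPlane e b
          = -(b * (b * familyDeriv quarterPlane e g))
            + (b * familyDeriv quarterPlane e (b * g - 1)
              - (b * g - 1) * familyDeriv quarterPlane e b) := by
        rw [map_sub, Derivation.leibniz, Derivation.map_one_eq_zero]
        simp only [smul_eq_mul]
        ring
      rw [h1]
      exact (ih.mul (ih.mul ((hg (k + 1)).deriv e))).neg.add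
        ((((hnull.deriv e).mul_left b).sub (hnull.mul_right _)).isControlled _ _)
    exact isControlled_succ ih (hD _) (hD _)

/-! ### Pointwise bounds of families -/

section Bounds

variable {V : Type} [NormedAddCommGroup V] {Ω : Set V}

/-- On every compact set and for all sufficiently small `ε` the property `P` holds for `χ_ε`, if `χ`
has sufficiently many vanishing moments. -/
def EventuallyOn (Ω : Set V) (P : Mollifier → V → Prop) : Prop :=
  ∀ K ⊆ Ω, IsCompact K → ∃ N : ℕ, ∀ χ : Mollifier, χ.1 ∈ mollifiers N →
    ∀ᶠ ε in 𝓝[>] (0 : ℝ), ∀ x ∈ K, P (χ.scale ε) x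

theorem EventuallyOn.mono {P P' : Mollifier → V → Prop} (h : EventuallyOn Ω P)
    (hP : ∀ φ, ∀ x ∈ Ω, P φ x → P' φ x) : EventuallyOn Ω P' := fun K hK hc => by
  obtain ⟨N, hN⟩ := h K hK hc
  exact ⟨N, fun χ hχ => (hN χ hχ).mono fun ε hε x hx => hP _ x (hK hx) (hε x hx)⟩

theorem EventuallyOn.and {P P' : Mollifier → V → Prop} (h : EventuallyOn Ω P)
    (h' : EventuallyOn Ω P') : EventuallyOn Ω fun φ x => P φ x ∧ P' φ x := fun K hK hc => by
  obtain ⟨N, hN⟩ := h K hK hc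
  obtain ⟨M, hM⟩ := h' K hK hc
  refine ⟨N + M, fun χ hχ => ?_⟩
  filter_upwards [hN χ (mollifiers_anti (by omega) hχ), hM χ (mollifiers_anti (by omega) hχ)]
    with ε h1 h2 x hx
  exact ⟨h1 x hx, h2 x hx⟩

theorem EventuallyOn.all {ι : Type*} [Fintype ι] {P : ι → Mollifier → V → Prop}
    (h : ∀ i, EventuallyOn Ω (P i)) : EventuallyOn Ω fun φ x => ∀ i, P i φ x := fun K hK hc => by
  choose N hN using fun i => h i K hK hc
  refine ⟨∑ i, N i, fun χ hχ => ?_⟩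
  filter_upwards [eventually_all.2 fun i => hN i χ (mollifiers_anti
    (Finset.single_le_sum (f := N) (fun _ _ => Nat.zero_le _) (Finset.mem_univ i)) hχ)]
    with ε h1 x hx i
  exact h1 i x hx

variable [NormedSpace ℝ V]

/-- The family is of locally logarithmic growth. -/
def HasLogGrowth (u : smoothFamilies Ω) : Prop :=
  ∀ K ⊆ Ω, IsCompact K → ∃ N : ℕ, ∀ χ : Mollifier, χ.1 ∈ mollifiers N → ∃ c : ℝ, 0 < c ∧
    ∀ᶠ ε in 𝓝[>] (0 : ℝ), ∀ x ∈ K, ‖u.1 (χ.scale ε) x‖ ≤ N * Real.log (c / ε)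

theorem HasLogGrowth.uniform {ι : Type*} [Fintype ι] {u : ι → smoothFamilies Ω}
    (h : ∀ i, HasLogGrowth (u i)) {K : Set V} (hK : K ⊆ Ω) (hc : IsCompact K) :
    ∃ N : ℕ, ∀ χ : Mollifier, χ.1 ∈ mollifiers N → ∃ c : ℝ, 1 ≤ c ∧
      ∀ᶠ ε in 𝓝[>] (0 : ℝ), ∀ i, ∀ x ∈ K,
        ‖(u i).1 (χ.scale ε) x‖ ≤ N * Real.log (c / ε) := by
  choose N hN using fun i => h i K hK hc
  have hle : ∀ i, N i ≤ ∑ i, N i := fun i =>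
    Finset.single_le_sum (f := N) (fun _ _ => Nat.zero_le _) (Finset.mem_univ i)
  refine ⟨∑ i, N i, fun χ hχ => ?_⟩
  choose c hc0 hc using fun i => hN i χ (mollifiers_anti (hle i) hχ)
  have hc1 : ∀ i, c i ≤ 1 + ∑ i, c i := fun i => by
    have := Finset.single_le_sum (f := c) (fun i _ => (hc0 i).le) (Finset.mem_univ i)
    linarith
  have h0 : 0 ≤ ∑ i, c i := Finset.sum_nonneg fun i _ => (hc0 i).le
  refine ⟨1 + ∑ i, c i, by linarith, ?_⟩
  filter_upwards [eventually_all.2 hc, eventually_lt_one] with ε h1 h2 i x hx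
  refine (h1 i x hx).trans ?_
  have h3 : Real.log (c i / ε) ≤ Real.log ((1 + ∑ i, c i) / ε) :=
    Real.log_le_log (div_pos (hc0 i) h2.1) (by gcongr; exacts [h2.1.le, hc1 i])
  have h4 : 0 ≤ Real.log ((1 + ∑ i, c i) / ε) :=
    Real.log_nonneg ((one_le_div h2.1).2 (by linarith [h2.2]))
  exact (mul_le_mul_of_nonneg_left h3 (Nat.cast_nonneg _)).trans
    (mul_le_mul_of_nonneg_right (by exact_mod_cast hle i) h4)

theorem HasLogGrowth.sub {u v : smoothFamilies Ω} (hu : HasLogGrowth u) (hv : HasLogGrowth v) :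
    HasLogGrowth (u - v) := fun K hK hc => by
  obtain ⟨N, hN⟩ := HasLogGrowth.uniform (ι := Bool) (u := fun b => bif b then u else v)
    (fun b => by cases b; exacts [hv, hu]) hK hc
  refine ⟨N + N, fun χ hχ => ?_⟩
  obtain ⟨c, hc, h⟩ := hN χ (mollifiers_anti (by omega) hχ)
  refine ⟨c, by linarith, ?_⟩
  filter_upwards [h] with ε h1 x hx
  have h2 := h1 true x hx
  have h3 := h1 false x hx
  change ‖u.1 _ x - v.1 _ x‖ ≤ _
  refine (norm_sub_le _ _).trans ((add_le_add h2 h3).trans (le_of_eq ?_))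
  push_cast
  ring

/-- Pointwise bounds for finitely many controlled families, with common constants. -/
theorem IsControlled.uniform_bound {ι : Type*} [Fintype ι] {s : Scale} {u : ι → smoothFamilies Ω}
    (h : ∀ i, IsControlled s 0 (u i)) {K : Set V} (hK : K ⊆ Ω) (hc : IsCompact K) :
    ∃ N : ℕ, ∀ N' ≥ N, ∀ χ a, (χ, a) ∈ s.set N' → ∃ C : ℝ, 0 ≤ C ∧
      ∀ᶠ ε in 𝓝[>] (0 : ℝ), ∀ i, ∀ x ∈ K,
        ‖(u i).1 (χ.scale ε) x‖ ≤ C * ε ^ (a - N' : ℤ) := by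
  choose N hN using fun i => h i K hK hc
  have hle : ∀ i, N i ≤ ∑ i, N i := fun i =>
    Finset.single_le_sum (f := N) (fun _ _ => Nat.zero_le _) (Finset.mem_univ i)
  refine ⟨∑ i, N i, fun N' hN' χ a ha => ?_⟩
  choose C hC0 hC using fun i => ((hN i χ a (s.anti ((hle i).trans hN') ha) 0 le_rfl).mono
    (show a - (N' : ℤ) ≤ a - N i by have := (hle i).trans hN'; omega)).nonneg
  refine ⟨∑ i, C i, Finset.sum_nonneg fun i _ => hC0 i, ?_⟩
  filter_upwards [eventually_all.2 hC, eventually_lt_one] with ε h1 h2 i x hx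
  have h3 := h1 i x hx
  rw [norm_iteratedFDerivWithin_zero] at h3
  refine h3.trans (mul_le_mul_of_nonneg_right ?_ (zpow_pos h2.1 _).le)
  exact Finset.single_le_sum (f := C) (fun i _ => hC0 i) (Finset.mem_univ i)

end Bounds

/-! ### A priori estimates in the Colombeau algebra -/

/-- The restriction of families to `t = 0`. -/
noncomputable def familyAtTimeZero : smoothFamilies quarterPlane →ₐ[ℂ] smoothFamilies halfLine :=
  familyPullback (ContinuousLinearMap.inl ℝ ℝ ℝ) (by ext x; simp [quarterPlane, halfLine])

/-- The restriction of families to `x = 0`. -/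
noncomputable def familyAtBoundary : smoothFamilies quarterPlane →ₐ[ℂ] smoothFamilies halfLine :=
  familyPullback (ContinuousLinearMap.inr ℝ ℝ ℝ) (by ext x; simp [quarterPlane, halfLine])

/-- The derivative `∂_x` of families. -/
noncomputable abbrev famDx :
    Derivation ℂ (smoothFamilies quarterPlane) (smoothFamilies quarterPlane) :=
  familyDeriv quarterPlane (1, 0)

/-- The derivative `∂_t` of families. -/
noncomputable abbrev famDt :
    Derivation ℂ (smoothFamilies quarterPlane) (smoothFamilies quarterPlane) :=
  familyDeriv quarterPlane (0, 1)

theorem familyAtTimeZero_dx (u : smoothFamilies quarterPlane) :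
    familyAtTimeZero (famDx u) = familyDeriv halfLine 1 (familyAtTimeZero u) :=
  familyPullback_deriv (ContinuousLinearMap.inl ℝ ℝ ℝ) _ 1 u

theorem familyAtBoundary_dt (u : smoothFamilies quarterPlane) :
    familyAtBoundary (famDt u) = familyDeriv halfLine 1 (familyAtBoundary u) :=
  familyPullback_deriv (ContinuousLinearMap.inr ℝ ℝ ℝ) _ 1 u

theorem famDt_famDx (u : smoothFamilies quarterPlane) : famDt (famDx u) = famDx (famDt u) := by
  refine familyDeriv_comm ?_ _ _ u
  rw [quarterPlane, interior_prod_eq, closure_prod_eq, interior_Ici, closure_Ioi]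

theorem exp_mul_log_le {κ y : ℝ} {P : ℕ} (hy : 1 ≤ y) (hκ : κ ≤ P) :
    Real.exp (κ * Real.log y) ≤ y ^ P := by
  have h0 : 0 < y := by linarith
  calc Real.exp (κ * Real.log y) ≤ Real.exp (P * Real.log y) :=
        Real.exp_le_exp.2 (mul_le_mul_of_nonneg_right hκ (Real.log_nonneg hy))
    _ = y ^ P := by rw [← Real.log_pow, Real.exp_log (pow_pos h0 P)]

/-- The estimate of order zero: Gronwall's factor `exp (C log (c / ε))` is a power of `ε`. -/
theorem isControlled_zero_of_residual {ι : Type*} [Fintype ι] {pos : ι → Prop} {s : Scale}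
    {l u : ι → smoothFamilies quarterPlane} {f : ι → ι → smoothFamilies quarterPlane}
    {v : ι → ι → smoothFamilies halfLine} {M : ℝ}
    (hl : ∀ i, ∃ c : ℝ, EventuallyOn quarterPlane fun φ p =>
      ((l i).1 φ p).im = 0 ∧ ‖(l i).1 φ p‖ ≤ c)
    (hneg : ∀ i, ¬ pos i → EventuallyOn quarterPlane fun φ p => ((l i).1 φ p).re ≤ 0)
    (hf : ∀ i k, HasLogGrowth (f i k))
    (hv : ∀ i k, EventuallyOn halfLine fun φ t => ‖(v i k).1 φ t‖ ≤ M)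
    (hv0 : ∀ i k, pos k → v i k = 0)
    (hR : ∀ i, IsControlled s 0 (famDt (u i) + l i * famDx (u i) - ∑ k, f i k * u k))
    (hinit : ∀ i, IsControlled s 0 (familyAtTimeZero (u i)))
    (hbd : ∀ i, pos i → IsControlled s 0
      (familyAtBoundary (u i) - ∑ k, v i k * familyAtBoundary (u k))) (i : ι) :
    IsControlled s 0 (u i) := by
  classical
  intro K hK hKc
  obtain ⟨j, hj⟩ := exists_nat_box hKc
  choose c hc using hl
  set c' : ℝ := ∑ i, |c i| with hc'
  have hc0 : 0 ≤ c' := Finset.sum_nonneg fun i _ => abs_nonneg _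
  have hci : ∀ i, c i ≤ c' := fun i => (le_abs_self _).trans
    (Finset.single_le_sum (f := fun i => |c i|) (fun i _ => abs_nonneg _) (Finset.mem_univ i))
  set D := trapezoid (j : ℝ) c' j with hD
  have hDQ : D ⊆ quarterPlane := trapezoid_subset _ _ _
  have hDc : IsCompact D := isCompact_trapezoid hc0
  have hKD : K ⊆ D := fun p hp => box_subset_trapezoid hc0
    ⟨⟨(hK hp).1, (hj p hp).1.le⟩, (hK hp).2, (hj p hp).2.le⟩
  have hI : ∀ y : ℝ, Icc 0 y ⊆ halfLine := fun y x hx => hx.1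
  have hneg' : EventuallyOn quarterPlane fun φ p => ∀ i, ¬ pos i → ((l i).1 φ p).re ≤ 0 :=
    EventuallyOn.all fun i => by
      by_cases hi : pos i
      · exact fun _ _ _ => ⟨0, fun _ _ => Eventually.of_forall fun _ _ _ h => absurd hi h⟩
      · exact (hneg i hi).mono fun _ _ _ h _ => h
  obtain ⟨N₁, h1⟩ := (EventuallyOn.all hc) D hDQ hDc
  obtain ⟨N₂, h2⟩ := hneg' D hDQ hDc
  obtain ⟨N₃, h3⟩ := HasLogGrowth.uniform (u := fun q : ι × ι => f q.1 q.2)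
    (fun q => hf q.1 q.2) hDQ hDc
  obtain ⟨N₄, h4⟩ := (EventuallyOn.all fun q : ι × ι => hv q.1 q.2) (Icc 0 j) (hI _) isCompact_Icc
  obtain ⟨N₅, h5⟩ := IsControlled.uniform_bound hR hDQ hDc
  obtain ⟨N₆, h6⟩ := IsControlled.uniform_bound hinit (hI (j + c' * j)) isCompact_Icc
  obtain ⟨N₇, h7⟩ := IsControlled.uniform_bound (s := s) (u := fun i => if pos i then
    familyAtBoundary (u i) - ∑ k, v i k * familyAtBoundary (u k) else 0)
    (fun i => by
      by_cases hi : pos i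
      · simpa only [hi, if_true] using hbd i hi
      · simpa only [hi, if_false] using isControlled_zero) (hI j) isCompact_Icc
  obtain ⟨n, hn⟩ : ∃ n : ℝ, n = (Fintype.card ι : ℝ) := ⟨_, rfl⟩
  set M' : ℝ := 1 + n * |M| with hM'
  have hn0 : 0 ≤ n := hn ▸ Nat.cast_nonneg _
  have hM1 : 1 ≤ M' := by have : 0 ≤ n * |M| := by positivity
                          linarith
  set P : ℕ := ⌈2 * M' * (n * N₃) * j⌉₊ with hP
  set N' := N₁ + N₂ + N₃ + N₄ + N₅ + N₆ + N₇ with hN'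
  refine ⟨N' + P, fun χ a ha i' hi' => ?_⟩
  obtain rfl : i' = 0 := by omega
  have ha' : (χ, a) ∈ s.set N' := s.anti (by omega) ha
  have hm : ∀ N ≤ N', χ.1 ∈ mollifiers N := fun N hN => mollifiers_anti hN (s.mem ha')
  obtain ⟨y, hy, h3⟩ := h3 χ (hm _ (by omega))
  obtain ⟨C₅, hC₅, h5⟩ := h5 N' (by omega) χ a ha'
  obtain ⟨C₆, hC₆, h6⟩ := h6 N' (by omega) χ a ha'
  obtain ⟨C₇, hC₇, h7⟩ := h7 N' (by omega) χ a ha'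
  set C := C₅ + C₆ + C₇ with hC
  refine ⟨4 * M' * C * (Real.exp j * y ^ P), ?_⟩
  filter_upwards [h1 χ (hm _ (by omega)), h2 χ (hm _ (by omega)), h3, h4 χ (hm _ (by omega)),
    h5, h6, h7, eventually_lt_one] with ε h1 h2 h3 h4 h5 h6 h7 hε p hp
  set φ := χ.scale ε with hφ
  set δ : ℝ := C * ε ^ (a - N' : ℤ) with hδ
  have hεa : 0 < ε ^ (a - N' : ℤ) := zpow_pos hε.1 _
  have hδ0 : 0 ≤ δ := by positivity
  have h5δ : C₅ * ε ^ (a - N' : ℤ) ≤ δ := mul_le_mul_of_nonneg_right (by linarith) hεa.le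
  have h6δ : C₆ * ε ^ (a - N' : ℤ) ≤ δ := mul_le_mul_of_nonneg_right (by linarith) hεa.le
  have h7δ : C₇ * ε ^ (a - N' : ℤ) ≤ δ := mul_le_mul_of_nonneg_right (by linarith) hεa.le
  have hy1 : 1 ≤ y / ε := (one_le_div hε.1).2 (by linarith [hε.2])
  have hlog : 0 ≤ Real.log (y / ε) := Real.log_nonneg hy1
  set L : ℝ := n * (N₃ * Real.log (y / ε)) with hL
  have hL0 : 0 ≤ L := by positivity
  have key := mixed_problem_estimate (pos := pos) (R := j) (T := j) (c := c') (L := L) (N := M')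
    (D := δ) (u := fun i => (u i).1 φ) (u' := fun i => fderivWithin ℝ ((u i).1 φ) quarterPlane)
    (l := fun i p => ((l i).1 φ p).re) hc0 hL0 hM1 hδ0
    (fun i p hp => (((u i).2 φ).differentiableOn (by simp) p (hDQ hp)).hasFDerivWithinAt.mono hDQ)
    (fun i p hp => (Complex.abs_re_le_norm _).trans ((h1 p hp i).2.trans (hci i)))
    (fun i hi p hp _ => h2 p hp i hi)
    (fun i p hp B hB => by
      have hpQ := hDQ hp
      have e1 : ((((l i).1 φ p).re, 1) : ℝ × ℝ) = (0, 1) + ((l i).1 φ p).re • (1, 0) := by simp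
      have e2 : (((l i).1 φ p).re : ℂ) = (l i).1 φ p :=
        Complex.ext (by simp) (by simp [(h1 p hp i).1])
      have e3 : (famDt (u i) + l i * famDx (u i) - ∑ k, f i k * u k).1 φ p
          = (famDt (u i)).1 φ p + (l i).1 φ p * (famDx (u i)).1 φ p
            - ∑ k, (f i k).1 φ p * (u k).1 φ p := by
        simp
      have e4 : fderivWithin ℝ ((u i).1 φ) quarterPlane p (((l i).1 φ p).re, 1)
          = (famDt (u i) + l i * famDx (u i) - ∑ k, f i k * u k).1 φ p
            + ∑ k, (f i k).1 φ p * (u k).1 φ p := by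
        rw [e3, e1, map_add, map_smul, Complex.real_smul, e2,
          familyDeriv_apply _ _ _ hpQ, familyDeriv_apply _ _ _ hpQ]
        ring
      rw [e4, add_comm]
      refine (norm_add_le _ _).trans (add_le_add ?_ ((h5 i p hp).trans h5δ))
      refine (norm_sum_le_of_le _ fun k _ => (norm_mul_le _ _).trans
        (mul_le_mul (h3 (i, k) p hp) (hB k) (norm_nonneg _) (by positivity))).trans ?_
      rw [Finset.sum_const, Finset.card_univ, nsmul_eq_mul, ← hn, hL]
      exact le_of_eq (by ring))
    (fun i p hp hp0 => by
      obtain ⟨x, t⟩ := p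
      obtain rfl : t = 0 := hp0
      refine (h6 i x ⟨hp.1, ?_⟩).trans h6δ
      have := hp.2.2.2
      simpa using this)
    (fun i hi p hp hp0 B hB hBk => by
      obtain ⟨x, t⟩ := p
      obtain rfl : x = 0 := hp0
      have ht : t ∈ Icc (0 : ℝ) j := ⟨hp.2.1, hp.2.2.1⟩
      have h8 := h7 i t ht
      simp only [hi, if_true] at h8
      have e3 : (familyAtBoundary (u i) - ∑ k, v i k * familyAtBoundary (u k)).1 φ t
          = (u i).1 φ (0, t) - ∑ k, (v i k).1 φ t * (u k).1 φ (0, t) := by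
        simp [familyAtBoundary, familyPullback]
      rw [e3] at h8
      have e4 : (u i).1 φ (0, t) = ∑ k, (v i k).1 φ t * (u k).1 φ (0, t)
          + ((u i).1 φ (0, t) - ∑ k, (v i k).1 φ t * (u k).1 φ (0, t)) := by ring
      rw [e4]
      refine (norm_add_le _ _).trans (add_le_add ?_ (h8.trans h7δ))
      have h9 : ∀ k, ‖(v i k).1 φ t * (u k).1 φ (0, t)‖ ≤ |M| * B := fun k => by
        by_cases hk : pos k
        · have : (v i k).1 φ t = 0 := by rw [hv0 i k hk]; rfl
          rw [this, zero_mul, norm_zero]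
          positivity
        · rw [norm_mul]
          exact mul_le_mul ((h4 t ht (i, k)).trans (le_abs_self _)) (hBk k hk) (norm_nonneg _)
            (abs_nonneg _)
      refine (norm_sum_le_of_le _ fun k _ => h9 k).trans ?_
      rw [Finset.sum_const, Finset.card_univ, nsmul_eq_mul, ← hn, hM']
      nlinarith)
    i p (hKD hp)
  rw [norm_iteratedFDerivWithin_zero]
  refine key.trans ?_
  have e5 : Real.exp ((2 * M' * L + 1) * j) ≤ Real.exp j * (y / ε) ^ P := by
    have : (2 * M' * L + 1) * j = j + (2 * M' * (n * N₃) * j) * Real.log (y / ε) := by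
      rw [hL]; ring
    rw [this, Real.exp_add]
    exact mul_le_mul_of_nonneg_left (exp_mul_log_le hy1 (Nat.le_ceil _)) (Real.exp_pos _).le
  calc 4 * M' * δ * Real.exp ((2 * M' * L + 1) * j)
      ≤ 4 * M' * δ * (Real.exp j * (y / ε) ^ P) := by gcongr
    _ = 4 * M' * C * (Real.exp j * y ^ P) * ε ^ (a - (N' + P : ℕ) : ℤ) := by
        have : ε ^ (a - (N' + P : ℕ) : ℤ) = ε ^ (a - N' : ℤ) * (ε ^ P)⁻¹ := by
          rw [← zpow_natCast, ← zpow_neg, ← zpow_add₀ hε.1.ne']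
          congr 1
          push_cast
          ring
        rw [this, hδ, div_pow]
        ring

variable {s : Scale}

theorem IsControlled.atTimeZero {k : ℕ} {u : smoothFamilies quarterPlane}
    (hu : IsControlled s k u) : IsControlled s k (familyAtTimeZero u) :=
  hu.pullback _ _

theorem IsControlled.atBoundary {k : ℕ} {u : smoothFamilies quarterPlane}
    (hu : IsControlled s k u) : IsControlled s k (familyAtBoundary u) :=
  hu.pullback _ _

/-- The boundary is non-characteristic: there `∂_x z` is determined by `∂_t z` and by the
derivative `∂_t z + l ∂_x z` along the characteristics. -/
theorem isControlled_atBoundary_famDx {k : ℕ} {l z : smoothFamilies quarterPlane}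
    (hl : ∀ k, IsControlled Scale.moderate k l) (hb : IsBoundedBelow l)
    (hR : IsControlled s k (familyAtBoundary (famDt z + l * famDx z)))
    (hz : IsControlled s (k + 1) (familyAtBoundary z)) :
    IsControlled s k (familyAtBoundary (famDx z)) := by
  obtain ⟨b, hbm, hbn⟩ := exists_inverse hl hb
  have e : famDx z = b * (famDt z + l * famDx z - famDt z) - (b * l - 1) * famDx z := by ring
  rw [e, map_sub, map_mul, map_sub, familyAtBoundary_dt]
  exact (((hbm k).atBoundary).mul (hR.sub (hz.deriv 1))).sub
    ((hbn.mul_right _).isControlled s k).atBoundary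

/-- The family `l` consists, on compact sets and for small `ε`, of real functions that are bounded,
have a modulus of at least a power of `ε` and a derivative `∂_x l` of logarithmic growth, and are
not positive unless `pos` holds. If `pos` holds, boundary values at `x = 0` are prescribed for a
transport equation with the speed `l`. -/
structure IsCharacteristicSpeed (pos : Prop) (l : smoothFamilies quarterPlane) : Prop where
  moderate : ∀ k, IsControlled Scale.moderate k l
  bounded : ∃ c : ℝ, EventuallyOn quarterPlane fun φ p => (l.1 φ p).im = 0 ∧ ‖l.1 φ p‖ ≤ c
  sign : ¬ pos → EventuallyOn quarterPlane fun φ p => (l.1 φ p).re ≤ 0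
  below : IsBoundedBelow l
  log : HasLogGrowth (famDx l)

/-- The estimate for a scalar transport equation. The derivative `∂_x z` solves a transport equation
of the same kind, so that the order of the estimate can be raised by induction. -/
theorem isControlled_of_transport {pos : Prop} {l : smoothFamilies quarterPlane}
    (hl : IsCharacteristicSpeed pos l) (k : ℕ) {g z : smoothFamilies quarterPlane}
    (hg : ∀ k, IsControlled Scale.moderate k g) (hlog : HasLogGrowth g)
    (hR : IsControlled s k (famDt z + l * famDx z - g * z))
    (hinit : IsControlled s k (familyAtTimeZero z))
    (hbd : pos → IsControlled s k (familyAtBoundary z)) : IsControlled s k z := by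
  induction k generalizing g z with
  | zero =>
    exact isControlled_zero_of_residual (ι := Unit) (pos := fun _ => pos) (l := fun _ => l)
      (u := fun _ => z) (f := fun _ _ => g) (v := fun _ _ => 0) (M := 0)
      (fun _ => hl.bounded) (fun _ => hl.sign) (fun _ _ => hlog)
      (fun _ _ _ _ _ => ⟨0, fun _ _ => Eventually.of_forall fun _ _ _ => norm_zero.le⟩)
      (fun _ _ _ => rfl) (fun _ => by simpa using hR) (fun _ => hinit)
      (fun _ h => by simpa using hbd h) ()
  | succ k ih =>
    have hz : IsControlled s k z := ih hg hlog (hR.mono_order (by omega))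
      (hinit.mono_order (by omega)) fun h => (hbd h).mono_order (by omega)
    set ρ := famDt z + l * famDx z - g * z with hρ
    have e1 : famDt (famDx z) + l * famDx (famDx z) - (g - famDx l) * famDx z
        = famDx ρ + famDx g * z := by
      rw [hρ, map_sub, map_add, Derivation.leibniz, Derivation.leibniz, famDt_famDx]
      simp only [smul_eq_mul]
      ring
    have e2 : famDt z + l * famDx z = ρ + g * z := by rw [hρ]; ring
    have hx : IsControlled s k (famDx z) := by
      refine ih (g := g - famDx l) (fun k => (hg k).sub ((hl.moderate (k + 1)).deriv _))
        (hlog.sub hl.log) ?_ ?_ fun h => ?_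
      · rw [e1]
        exact (hR.deriv _).add (((hg (k + 1)).deriv _).mul hz)
      · rw [familyAtTimeZero_dx]
        exact hinit.deriv 1
      · refine isControlled_atBoundary_famDx hl.moderate hl.below ?_ (hbd h)
        rw [e2]
        exact ((hR.mono_order (by omega)).add ((hg k).mul hz)).atBoundary
    have ht : IsControlled s k (famDt z) := by
      have e3 : famDt z = ρ + g * z - l * famDx z := by rw [hρ]; ring
      rw [e3]
      exact ((hR.mono_order (by omega)).add ((hg k).mul hz)).sub ((hl.moderate k).mul hx)
    exact isControlled_succ hz hx ht

/-- The assumptions on the coefficients of the mixed problem that the estimates of all orders use.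
Here `pos i` says that the component `i` enters through the boundary `x = 0`. -/
structure IsHyperbolic {ι : Type*} (pos : ι → Prop) (l : ι → smoothFamilies quarterPlane)
    (f : ι → ι → smoothFamilies quarterPlane) (v : ι → ι → smoothFamilies halfLine) : Prop where
  speed : ∀ i, IsCharacteristicSpeed (pos i) (l i)
  separated : ∀ i j, i ≠ j → IsBoundedBelow (l i - l j)
  f_moderate : ∀ i j k, IsControlled Scale.moderate k (f i j)
  f_log : ∀ i j, HasLogGrowth (f i j)
  v_moderate : ∀ i j k, IsControlled Scale.moderate k (v i j)
  v_bounded : ∃ M : ℝ, ∀ i j, EventuallyOn halfLine fun φ t => ‖(v i j).1 φ t‖ ≤ M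
  v_zero : ∀ i j, pos j → v i j = 0

/-- The combination `∂_x u_i - ∑ j, a_ij u_j` with `a_ij = f_ij / (l_i - l_j)` for `i ≠ j` solves a
scalar transport equation, up to terms without derivatives of `u`. The families
`a` are arbitrary here; the last sum is the error if the `a_ij` are not the exact quotients. -/
theorem transport_diagonalized {ι : Type*} [Fintype ι] [DecidableEq ι]
    (l u : ι → smoothFamilies quarterPlane) (f a : ι → ι → smoothFamilies quarterPlane) (i : ι) :
    famDt (famDx (u i) - ∑ j, a i j * u j) + l i * famDx (famDx (u i) - ∑ j, a i j * u j)
        - (f i i - famDx (l i)) * (famDx (u i) - ∑ j, a i j * u j)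
      = famDx (famDt (u i) + l i * famDx (u i) - ∑ j, f i j * u j) + ∑ j, famDx (f i j) * u j
        + (f i i - famDx (l i)) * ∑ j, a i j * u j
        - ∑ j, ((famDt (a i j) + l i * famDx (a i j)) * u j
          + a i j * (∑ k, f j k * u k + (famDt (u j) + l j * famDx (u j) - ∑ k, f j k * u k)))
        - ∑ j, (a i j * (l i - l j) - if i = j then 0 else f i j) * famDx (u j) := by
  have e1 : ∀ j, (famDt (a i j) + l i * famDx (a i j)) * u j
        + a i j * (∑ k, f j k * u k + (famDt (u j) + l j * famDx (u j) - ∑ k, f j k * u k))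
        + (a i j * (l i - l j) - if i = j then 0 else f i j) * famDx (u j)
      = famDt (a i j * u j) + l i * famDx (a i j * u j) - f i j * famDx (u j)
        + if i = j then f i i * famDx (u i) else 0 := fun j => by
    rw [Derivation.leibniz, Derivation.leibniz]
    simp only [smul_eq_mul]
    split_ifs with h
    · subst h; ring
    · ring
  have e2 : ∑ j, ((famDt (a i j) + l i * famDx (a i j)) * u j
        + a i j * (∑ k, f j k * u k + (famDt (u j) + l j * famDx (u j) - ∑ k, f j k * u k)))
        + ∑ j, (a i j * (l i - l j) - if i = j then 0 else f i j) * famDx (u j)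
      = famDt (∑ j, a i j * u j) + l i * famDx (∑ j, a i j * u j) - ∑ j, f i j * famDx (u j)
        + f i i * famDx (u i) := by
    rw [← Finset.sum_add_distrib, Finset.sum_congr rfl fun j _ => e1 j, Finset.sum_add_distrib,
      Finset.sum_sub_distrib, Finset.sum_add_distrib, Finset.sum_ite_eq,
      if_pos (Finset.mem_univ i), ← Finset.mul_sum, ← map_sum, ← map_sum]
  have e3 : famDx (∑ j, f i j * u j) = ∑ j, famDx (f i j) * u j + ∑ j, f i j * famDx (u j) := by
    rw [map_sum, ← Finset.sum_add_distrib]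
    refine Finset.sum_congr rfl fun j _ => ?_
    rw [Derivation.leibniz]
    simp only [smul_eq_mul]
    ring
  have e4 : famDx (l i * famDx (u i)) = l i * famDx (famDx (u i)) + famDx (u i) * famDx (l i) := by
    rw [Derivation.leibniz, smul_eq_mul, smul_eq_mul]
  rw [map_sub, map_sub, map_sub, map_add, e3, e4, famDt_famDx]
  linear_combination e2

/-- The estimate for the system, for derivatives of all orders. -/
theorem isControlled_of_system {ι : Type*} [Fintype ι] {pos : ι → Prop}
    {l : ι → smoothFamilies quarterPlane} {f : ι → ι → smoothFamilies quarterPlane}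
    {v : ι → ι → smoothFamilies halfLine} (H : IsHyperbolic pos l f v)
    {u : ι → smoothFamilies quarterPlane} (k : ℕ)
    (hR : ∀ i, IsControlled s k (famDt (u i) + l i * famDx (u i) - ∑ j, f i j * u j))
    (hinit : ∀ i, IsControlled s k (familyAtTimeZero (u i)))
    (hbd : ∀ i, pos i → IsControlled s k
      (familyAtBoundary (u i) - ∑ j, v i j * familyAtBoundary (u j))) (i : ι) :
    IsControlled s k (u i) := by
  classical
  induction k generalizing i with
  | zero =>
    obtain ⟨M, hM⟩ := H.v_bounded
    exact isControlled_zero_of_residual (fun i => (H.speed i).bounded) (fun i => (H.speed i).sign)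
      H.f_log hM H.v_zero hR hinit hbd i
  | succ k ih =>
    have hu : ∀ i, IsControlled s k (u i) := ih (fun i => (hR i).mono_order (by omega))
      (fun i => (hinit i).mono_order (by omega)) fun i hi => (hbd i hi).mono_order (by omega)
    have ha : ∀ i j, ∃ a : smoothFamilies quarterPlane,
        (∀ k, IsControlled Scale.moderate k a) ∧
        IsNull (a * (l i - l j) - if i = j then 0 else f i j) := fun i j => by
      by_cases hij : i = j
      · exact ⟨0, fun k => isControlled_zero, by simpa [hij] using isNull_zero⟩
      · obtain ⟨b, hb, hb'⟩ := exists_inverse (fun k => ((H.speed i).moderate k).sub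
          ((H.speed j).moderate k)) (H.separated i j hij)
        refine ⟨f i j * b, fun k => (H.f_moderate i j k).mul (hb k), ?_⟩
        have := hb'.mul_left (f i j)
        rwa [show f i j * (b * (l i - l j) - 1) = f i j * b * (l i - l j)
          - if i = j then 0 else f i j by rw [if_neg hij]; ring] at this
    choose a ham han using ha
    have hfu : ∀ i, IsControlled s k (∑ j, f i j * u j) := fun i =>
      IsControlled.sum fun j _ => (H.f_moderate i j k).mul (hu j)
    have hau : ∀ i, IsControlled s k (∑ j, a i j * u j) := fun i =>
      IsControlled.sum fun j _ => (ham i j k).mul (hu j)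
    have hRk : ∀ i, IsControlled s k (famDt (u i) + l i * famDx (u i)) := fun i => by
      simpa using ((hR i).mono_order (Nat.le_succ k)).add (hfu i)
    have hD : ∀ {w : smoothFamilies quarterPlane} (e : ℝ × ℝ),
        (∀ k, IsControlled Scale.moderate k w) → ∀ k, IsControlled Scale.moderate k
          (familyDeriv quarterPlane e w) := fun e hw k => (hw (k + 1)).deriv e
    have hw : ∀ i k, IsControlled Scale.moderate k (f i i - famDx (l i)) := fun i k =>
      (H.f_moderate i i k).sub (hD _ (H.speed i).moderate k)
    have step : ∀ i, (pos i → IsControlled s (k + 1) (familyAtBoundary (u i))) →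
        IsControlled s (k + 1) (u i) := fun i hi => by
      have hz : IsControlled s k (famDx (u i) - ∑ j, a i j * u j) := by
        refine isControlled_of_transport (H.speed i) k (hw i)
          ((H.f_log i i).sub (H.speed i).log) ?_ ?_ fun h => ?_
        · rw [transport_diagonalized]
          refine (((((hR i).deriv _).add (IsControlled.sum fun j _ =>
            (hD _ (H.f_moderate i j) k).mul (hu j))).add ((hw i k).mul (hau i))).sub
            (IsControlled.sum fun j _ => ?_)).sub
            (IsControlled.sum fun j _ => ((han i j).mul_right _).isControlled s k)
          refine ((((hD _ (ham i j) k).add (((H.speed i).moderate k).mul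
            (hD _ (ham i j) k))).mul (hu j))).add ((ham i j k).mul ?_)
          simpa using hRk j
        · rw [map_sub, familyAtTimeZero_dx]
          exact ((hinit i).deriv 1).sub (hau i).atTimeZero
        · rw [map_sub]
          exact (isControlled_atBoundary_famDx (H.speed i).moderate (H.speed i).below
            (hRk i).atBoundary (hi h)).sub (hau i).atBoundary
      have hx : IsControlled s k (famDx (u i)) := by simpa using hz.add (hau i)
      have ht : IsControlled s k (famDt (u i)) := by
        simpa using (hRk i).sub (((H.speed i).moderate k).mul hx)
      exact isControlled_succ (hu i) hx ht
    refine step i fun hi => ?_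
    -- The components with `¬ pos j` need no boundary values and are estimated before the others.
    have hb := (hbd i hi).add (IsControlled.sum (t := Finset.univ)
      (u := fun j => v i j * familyAtBoundary (u j)) fun j _ => ?_)
    · simpa using hb
    · by_cases hj : pos j
      · rw [H.v_zero i j hj, zero_mul]
        exact isControlled_zero
      · exact (H.v_moderate i j _).mul (step j fun h => absurd h hj).atBoundary

/-! ### Representatives of generalized functions -/

section Representatives

variable {V : Type} [NormedAddCommGroup V] [NormedSpace ℝ V] {Ω : Set V}

theorem IsNegligible.congr {u v : Mollifier → V → ℂ} (h : IsNegligible Ω u)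
    (huv : ∀ ψ, EqOn (u ψ) (v ψ) Ω) : IsNegligible Ω v := fun K hK hc k => by
  obtain ⟨N, hN⟩ := h K hK hc k
  exact ⟨N, fun q hq χ hχ => (hN q hq χ hχ).congr hK huv⟩

theorem IsNegligible.le_pow {u : Mollifier → V → ℂ} (h : IsNegligible Ω u) (m : ℕ) {K : Set V}
    (hK : K ⊆ Ω) (hc : IsCompact K) : ∃ N : ℕ, ∀ χ : Mollifier, χ.1 ∈ mollifiers N →
      ∀ᶠ ε in 𝓝[>] (0 : ℝ), ∀ x ∈ K, ‖u (χ.scale ε) x‖ ≤ ε ^ m := by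
  obtain ⟨N, hN⟩ := h K hK hc 0
  refine ⟨N + (m + 1), fun χ hχ => ?_⟩
  obtain ⟨C, hC0, hC⟩ := (hN (N + (m + 1)) (by omega) χ hχ).nonneg
  have h1 : ∀ᶠ ε in 𝓝[>] (0 : ℝ), ε < 1 / (C + 1) :=
    mem_of_superset (Ioo_mem_nhdsGT (show (0 : ℝ) < 1 / (C + 1) by positivity)) fun ε hε => hε.2
  filter_upwards [hC, h1, eventually_lt_one] with ε h2 h3 h4 x hx
  have h5 := h2 x hx
  rw [norm_iteratedFDerivWithin_zero,
    show ((N + (m + 1) : ℕ) : ℤ) - N = ((m + 1 : ℕ) : ℤ) by push_cast; ring, zpow_natCast] at h5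
  refine h5.trans ?_
  rw [lt_div_iff₀ (by positivity)] at h3
  calc C * ε ^ (m + 1) = (ε * C) * ε ^ m := by ring
    _ ≤ 1 * ε ^ m := mul_le_mul_of_nonneg_right (by nlinarith [h4.1]) (pow_pos h4.1 m).le
    _ = ε ^ m := one_mul _

theorem IsBoundedBelow.neg {u : smoothFamilies Ω} (h : IsBoundedBelow u) : IsBoundedBelow (-u) :=
  fun K hK hc => by
    obtain ⟨N, hN⟩ := h K hK hc
    refine ⟨N, fun χ hχ => (hN χ hχ).mono fun ε hε x hx => ?_⟩
    change _ ≤ ‖-u.1 _ x‖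
    rw [norm_neg]
    exact hε x hx

variable [hΩ : Fact (UniqueDiffOn ℝ Ω)]

/-- A moderate family as a family of smooth functions. -/
def toFamily (Ω : Set V) [Fact (UniqueDiffOn ℝ Ω)] : moderate Ω →ₐ[ℂ] smoothFamilies Ω :=
  Subalgebra.inclusion fun _ h => h.1

theorem toFamily_val (u : moderate Ω) : (toFamily Ω u).1 = u.1 := rfl

theorem toFamily_moderate (u : moderate Ω) (k : ℕ) :
    IsControlled Scale.moderate k (toFamily Ω u) :=
  (isModerate_iff (u := toFamily Ω u)).1 u.2.2 k

theorem toGenFun_eq_iff {u v : moderate Ω} :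
    toGenFun Ω u = toGenFun Ω v ↔ IsNegligible Ω (u - v).1 :=
  Ideal.Quotient.eq

theorem toGenFun_eq_iff_isControlled {u v : moderate Ω} {ρ : smoothFamilies Ω}
    (h : ∀ ψ, ∀ x ∈ Ω, u.1 ψ x - v.1 ψ x = ρ.1 ψ x) :
    toGenFun Ω u = toGenFun Ω v ↔ ∀ k, IsControlled Scale.negligible k ρ := by
  rw [toGenFun_eq_iff, ← isNegligible_iff]
  exact ⟨fun H => H.congr h, fun H => H.congr fun ψ x hx => (h ψ x hx).symm⟩

/-- Two representatives of a generalized function differ by less than every power of `ε`. -/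
theorem norm_sub_le_pow_of_toGenFun_eq {u v : moderate Ω} (h : toGenFun Ω u = toGenFun Ω v)
    (m : ℕ) {K : Set V} (hK : K ⊆ Ω) (hc : IsCompact K) : ∃ N : ℕ, ∀ χ : Mollifier,
      χ.1 ∈ mollifiers N → ∀ᶠ ε in 𝓝[>] (0 : ℝ), ∀ x ∈ K,
        ‖u.1 (χ.scale ε) x - v.1 (χ.scale ε) x‖ ≤ ε ^ m :=
  (toGenFun_eq_iff.1 h).le_pow m hK hc

theorem GenFun.IsGloballyBounded.eventuallyOn {u : moderate Ω}
    (h : (toGenFun Ω u).IsGloballyBounded) :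
    ∃ c : ℝ, EventuallyOn Ω fun φ x => ‖u.1 φ x‖ ≤ c := by
  obtain ⟨w, hw, N, c, hc, hN⟩ := h
  refine ⟨1 + c, fun K hK hKc => ?_⟩
  obtain ⟨M, hM⟩ := norm_sub_le_pow_of_toGenFun_eq hw.symm 0 hK hKc
  refine ⟨N + M, fun χ hχ => ?_⟩
  filter_upwards [hN χ (mollifiers_anti (by omega) hχ), hM χ (mollifiers_anti (by omega) hχ)]
    with ε h1 h2 x hx
  have h3 := h2 x hx
  rw [pow_zero] at h3
  calc ‖u.1 (χ.scale ε) x‖ = ‖(u.1 (χ.scale ε) x - w.1 (χ.scale ε) x) + w.1 (χ.scale ε) x‖ := by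
        rw [sub_add_cancel]
    _ ≤ 1 + c := (norm_add_le _ _).trans (add_le_add h3 (h1 x (hK hx)))

theorem GenFun.IsLocallyLogGrowth.hasLogGrowth {u : moderate Ω} {ρ : smoothFamilies Ω}
    (h : (toGenFun Ω u).IsLocallyLogGrowth) (hρ : ∀ ψ, ∀ x ∈ Ω, u.1 ψ x = ρ.1 ψ x) :
    HasLogGrowth ρ := by
  obtain ⟨w, hw, h⟩ := h
  intro K hK hKc
  obtain ⟨N, hN⟩ := h K hK hKc
  obtain ⟨M, hM⟩ := norm_sub_le_pow_of_toGenFun_eq hw.symm 0 hK hKc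
  refine ⟨N + M + 1, fun χ hχ => ?_⟩
  obtain ⟨c, hc, hN⟩ := hN χ (mollifiers_anti (by omega) hχ)
  refine ⟨max c (Real.exp 1), lt_max_of_lt_left hc, ?_⟩
  filter_upwards [hN, hM χ (mollifiers_anti (by omega) hχ), eventually_lt_one] with ε h1 h2 h3 x hx
  have h4 := h2 x hx
  rw [pow_zero] at h4
  rw [← hρ _ _ (hK hx)]
  have h5 : Real.log (c / ε) ≤ Real.log (max c (Real.exp 1) / ε) :=
    Real.log_le_log (div_pos hc h3.1) (div_le_div_of_nonneg_right (le_max_left _ _) h3.1.le)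
  have h6 : 1 ≤ Real.log (max c (Real.exp 1) / ε) := by
    rw [Real.le_log_iff_exp_le (div_pos (lt_max_of_lt_left hc) h3.1), le_div_iff₀ h3.1]
    exact (mul_le_of_le_one_right (Real.exp_pos 1).le h3.2.le).trans (le_max_right _ _)
  calc ‖u.1 (χ.scale ε) x‖ = ‖(u.1 (χ.scale ε) x - w.1 (χ.scale ε) x) + w.1 (χ.scale ε) x‖ := by
        rw [sub_add_cancel]
    _ ≤ 1 + N * Real.log (c / ε) := (norm_add_le _ _).trans (add_le_add h4 (h1 x hx))
    _ ≤ 1 + N * Real.log (max c (Real.exp 1) / ε) := by gcongr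
    _ ≤ (N + M + 1 : ℕ) * Real.log (max c (Real.exp 1) / ε) := by
        push_cast
        nlinarith [mul_nonneg (Nat.cast_nonneg (α := ℝ) M) (zero_le_one.trans h6)]

theorem GenFun.IsStrictlyPositive.pow_le_re {u : moderate Ω}
    (h : (toGenFun Ω u).IsStrictlyPositive) {K : Set V} (hK : K ⊆ Ω) (hc : IsCompact K) :
    ∃ N : ℕ, ∀ χ : Mollifier, χ.1 ∈ mollifiers N → ∀ᶠ ε in 𝓝[>] (0 : ℝ), ∀ x ∈ K,
      ε ^ N ≤ (u.1 (χ.scale ε) x).re := by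
  obtain ⟨w, hw, h⟩ := h
  obtain ⟨N, hN⟩ := h K hK hc
  obtain ⟨M, hM⟩ := norm_sub_le_pow_of_toGenFun_eq hw.symm (N + 1) hK hc
  refine ⟨N + M + 1, fun χ hχ => ?_⟩
  filter_upwards [hN χ (mollifiers_anti (by omega) hχ), hM χ (mollifiers_anti (by omega) hχ),
    Ioo_mem_nhdsGT (show (0 : ℝ) < 1 / 2 by norm_num)] with ε h1 h2 h3 x hx
  have h4 := (Complex.abs_re_le_norm _).trans (h2 x hx)
  rw [Complex.sub_re] at h4
  have h5 := (abs_le.1 h4).1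
  have h6 := (h1 x hx).2
  have h7 : 0 < ε ^ N := pow_pos h3.1 N
  have h8 : ε ^ (N + M + 1) ≤ ε ^ (N + 1) :=
    pow_le_pow_of_le_one h3.1.le (by linarith [h3.2]) (by omega)
  have h9 : ε ^ (N + 1) ≤ ε ^ N / 2 := by
    rw [pow_succ]
    nlinarith [h3.2]
  linarith

theorem GenFun.IsStrictlyPositive.isBoundedBelow {u : moderate Ω}
    (h : (toGenFun Ω u).IsStrictlyPositive) : IsBoundedBelow (toFamily Ω u) := fun K hK hc => by
  obtain ⟨N, hN⟩ := h.pow_le_re hK hc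
  exact ⟨N, fun χ hχ => (hN χ hχ).mono fun ε hε x hx => (hε x hx).trans (Complex.re_le_norm _)⟩

theorem GenFun.IsStrictlyPositive.eventuallyOn {u : moderate Ω}
    (h : (toGenFun Ω u).IsStrictlyPositive) : EventuallyOn Ω fun φ x => 0 < (u.1 φ x).re :=
  fun K hK hc => by
    obtain ⟨N, hN⟩ := h.pow_le_re hK hc
    refine ⟨N, fun χ hχ => ?_⟩
    filter_upwards [hN χ hχ, eventually_lt_one] with ε h1 h2 x hx
    exact (pow_pos h2.1 N).trans_le (h1 x hx)

end Representatives

/-! ### The mixed problem for representatives -/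

section Problem

variable {n r : ℕ} {l a : Fin n → moderate quarterPlane} {f : Fin n → Fin n → moderate quarterPlane}
  {u₀ h : Fin n → moderate halfLine} {v : Fin n → Fin n → moderate halfLine}

/-- The coefficients of the boundary condition, extended by zero to all pairs of indices. -/
noncomputable def boundaryCoeff (r : ℕ) (v : Fin n → Fin n → moderate halfLine) (i k : Fin n) :
    smoothFamilies halfLine :=
  if i.val < r ∧ r ≤ k.val then toFamily halfLine (v i k) else 0

theorem sum_boundaryCoeff {i : Fin n} (hi : i.val < r) (w : Fin n → smoothFamilies halfLine) :
    ∑ k, boundaryCoeff r v i k * w k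
      = ∑ k with r ≤ k.val, toFamily halfLine (v i k) * w k := by
  rw [Finset.sum_filter]
  refine Finset.sum_congr rfl fun k _ => ?_
  simp only [boundaryCoeff, hi, true_and]
  split_ifs
  · rfl
  · rw [zero_mul]

/-- The mixed problem in the Colombeau algebra says that the residuals of the representatives are
negligible. -/
theorem isSolution_toGenFun_iff {w : Fin n → moderate quarterPlane} :
    IsSolution r (fun i => toGenFun _ (l i)) (fun i k => toGenFun _ (f i k))
        (fun i => toGenFun _ (a i)) (fun i => toGenFun _ (u₀ i)) (fun i k => toGenFun _ (v i k))
        (fun i => toGenFun _ (h i)) (fun i => toGenFun _ (w i)) ↔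
      (∀ i k, IsControlled Scale.negligible k (famDt (toFamily _ (w i))
        + toFamily _ (l i) * famDx (toFamily _ (w i))
        - ∑ j, toFamily _ (f i j) * toFamily _ (w j) - toFamily _ (a i))) ∧
      (∀ i k, IsControlled Scale.negligible k
        (familyAtTimeZero (toFamily _ (w i)) - toFamily _ (u₀ i))) ∧
      ∀ i : Fin n, i.val < r → ∀ k, IsControlled Scale.negligible k
        (familyAtBoundary (toFamily _ (w i))
          - ∑ j, boundaryCoeff r v i j * familyAtBoundary (toFamily _ (w j)) - toFamily _ (h i)) := by
  have e1 : ∀ i, dt (toGenFun _ (w i)) + toGenFun _ (l i) * dx (toGenFun _ (w i))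
      = ∑ k, toGenFun _ (f i k) * toGenFun _ (w k) + toGenFun _ (a i) ↔
      ∀ k, IsControlled Scale.negligible k (famDt (toFamily _ (w i))
        + toFamily _ (l i) * famDx (toFamily _ (w i))
        - ∑ j, toFamily _ (f i j) * toFamily _ (w j) - toFamily _ (a i)) := fun i => by
    simp only [dt, dx, GenFun.deriv_mk, ← map_mul, ← map_add, ← map_sum]
    refine toGenFun_eq_iff_isControlled fun ψ p hp => ?_
    simp [familyDeriv_apply _ _ _ hp, moderateDeriv, toFamily_val, sub_sub]
  have e2 : ∀ i, atTimeZero (toGenFun _ (w i)) = toGenFun _ (u₀ i) ↔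
      ∀ k, IsControlled Scale.negligible k
        (familyAtTimeZero (toFamily _ (w i)) - toFamily _ (u₀ i)) := fun i => by
    rw [atTimeZero, GenFun.pullback_mk]
    exact toGenFun_eq_iff_isControlled fun ψ p hp => rfl
  have e3 : ∀ i : Fin n, i.val < r → ((atBoundary (toGenFun _ (w i)) =
      ∑ k with r ≤ k.val, toGenFun _ (v i k) * atBoundary (toGenFun _ (w k)) + toGenFun _ (h i)) ↔
      ∀ k, IsControlled Scale.negligible k (familyAtBoundary (toFamily _ (w i))
          - ∑ j, boundaryCoeff r v i j * familyAtBoundary (toFamily _ (w j))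
          - toFamily _ (h i))) := fun i hi => by
    simp only [atBoundary, GenFun.pullback_mk, ← map_mul, ← map_add, ← map_sum]
    refine toGenFun_eq_iff_isControlled fun ψ p hp => ?_
    rw [sum_boundaryCoeff hi]
    simp [familyAtBoundary, familyPullback, moderatePullback, toFamily_val, sub_sub]
  exact ⟨fun H => ⟨fun i => (e1 i).1 (H.equation i), fun i => (e2 i).1 (H.initial i),
    fun i hi => (e3 i hi).1 (H.boundary i hi)⟩, fun H => ⟨fun i => (e1 i).2 (H.1 i),
    fun i => (e2 i).2 (H.2.1 i), fun i hi => (e3 i hi).2 (H.2.2 i hi)⟩⟩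

/-- The assumptions on the generalized functions give the corresponding bounds for each of their
representatives, as two representatives differ by less than every power of `ε` on compact sets. -/
theorem isHyperbolic_of_representatives
    (hord : ∀ i j, i < j → toGenFun _ (l j) < toGenFun _ (l i))
    (hpos : ∀ i : Fin n, i.val < r → 0 < toGenFun _ (l i))
    (hneg : ∀ i : Fin n, r ≤ i.val → toGenFun _ (l i) < 0)
    (hbdd : ∀ i, (toGenFun _ (l i)).IsGloballyBounded)
    (hlog : ∀ i, (dx (toGenFun _ (l i))).IsLocallyLogGrowth)
    (hf : ∀ i k, (toGenFun _ (f i k)).IsLocallyLogGrowth)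
    (hv : ∀ i k : Fin n, i.val < r → r ≤ k.val → (toGenFun _ (v i k)).IsGloballyBounded)
    (him : ∀ i, EventuallyOn quarterPlane fun φ p => ((l i).1 φ p).im = 0) :
    IsHyperbolic (fun i => i.val < r) (fun i => toFamily _ (l i))
      (fun i k => toFamily _ (f i k)) (boundaryCoeff r v) where
  speed i :=
    { moderate := toFamily_moderate (l i)
      bounded := by
        obtain ⟨c, hc⟩ := (hbdd i).eventuallyOn
        exact ⟨c, (him i).and hc⟩
      sign := fun hi => by
        have h1 : (0 - toGenFun _ (l i)).IsStrictlyPositive := hneg i (not_lt.1 hi)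
        rw [zero_sub, ← map_neg] at h1
        refine h1.eventuallyOn.mono fun φ p _ h2 => ?_
        have h3 : 0 < (-(l i).1 φ p).re := h2
        rw [Complex.neg_re] at h3
        change ((l i).1 φ p).re ≤ 0
        linarith
      below := by
        by_cases hi : i.val < r
        · have h1 : (toGenFun _ (l i) - 0).IsStrictlyPositive := hpos i hi
          rw [sub_zero] at h1
          exact h1.isBoundedBelow
        · have h1 : (0 - toGenFun _ (l i)).IsStrictlyPositive := hneg i (not_lt.1 hi)
          rw [zero_sub, ← map_neg] at h1
          simpa using h1.isBoundedBelow.neg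
      log := by
        refine (hlog i).hasLogGrowth (u := moderateDeriv (1, 0) (l i)) fun ψ p hp => ?_
        rw [familyDeriv_apply _ _ _ hp]
        rfl }
  separated i j hij := by
    rcases lt_or_gt_of_ne hij with h1 | h1
    · have h2 : (toGenFun _ (l i) - toGenFun _ (l j)).IsStrictlyPositive := hord i j h1
      rw [← map_sub] at h2
      simpa using h2.isBoundedBelow
    · have h2 : (toGenFun _ (l j) - toGenFun _ (l i)).IsStrictlyPositive := hord j i h1
      rw [← map_sub] at h2
      simpa using h2.isBoundedBelow.neg
  f_moderate i j := toFamily_moderate (f i j)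
  f_log i j := (hf i j).hasLogGrowth fun _ _ _ => rfl
  v_moderate i j k := by
    rw [boundaryCoeff]
    split_ifs
    exacts [toFamily_moderate _ k, isControlled_zero]
  v_bounded := by
    have h1 : ∀ i k : Fin n, ∃ c : ℝ, 0 ≤ c ∧
        EventuallyOn halfLine fun φ t => ‖(boundaryCoeff r v i k).1 φ t‖ ≤ c := fun i k => by
      by_cases hik : i.val < r ∧ r ≤ k.val
      · obtain ⟨c, hc⟩ := (hv i k hik.1 hik.2).eventuallyOn
        refine ⟨|c|, abs_nonneg c, hc.mono fun φ t _ h2 => ?_⟩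
        rw [boundaryCoeff, if_pos hik]
        exact h2.trans (le_abs_self c)
      · refine ⟨0, le_rfl, fun _ _ _ => ⟨0, fun _ _ => Eventually.of_forall fun _ _ _ => ?_⟩⟩
        rw [boundaryCoeff, if_neg hik]
        exact norm_zero.le
    choose c hc0 hc using h1
    refine ⟨∑ i, ∑ k, c i k, fun i k => (hc i k).mono fun φ t _ h2 => h2.trans ?_⟩
    exact (Finset.single_le_sum (f := c i) (fun k _ => hc0 i k) (Finset.mem_univ k)).trans
      (Finset.single_le_sum (f := fun i => ∑ k, c i k)
        (fun i _ => Finset.sum_nonneg fun k _ => hc0 i k) (Finset.mem_univ i))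
  v_zero i j hj := if_neg fun h => absurd hj (not_lt.2 h.2)

end Problem

/-! ### Existence and uniqueness of generalized solutions -/

section Existence

variable {n r : ℕ} {l a : Fin n → moderate quarterPlane} {f : Fin n → Fin n → moderate quarterPlane}
  {u₀ h : Fin n → moderate halfLine} {v : Fin n → Fin n → moderate halfLine}

theorem isNull_of_interval {u : smoothFamilies halfLine}
    (h : ∀ j : ℕ, ∃ N : ℕ, ∀ χ : Mollifier, χ.1 ∈ mollifiers N → ∀ᶠ ε in 𝓝[>] (0 : ℝ),
      ∀ x ∈ halfLine, x < j → u.1 (χ.scale ε) x = 0) : IsNull u :=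
  fun K _ hc => by
    obtain ⟨C, hC⟩ := hc.bddAbove
    obtain ⟨j, hj⟩ := exists_nat_gt C
    obtain ⟨N, hN⟩ := h j
    refine ⟨N, fun χ hχ => ?_⟩
    filter_upwards [hN χ hχ] with ε hε x hx
    filter_upwards [self_mem_nhdsWithin, mem_nhdsWithin_of_mem_nhds
      (Iio_mem_nhds ((hC hx).trans_lt hj))] with y h1 h2
    exact hε y h1 h2

/-- The classical solutions for the single mollifiers, on boxes that grow for `ε → 0`, form a
family that solves the mixed problem up to null families. -/
theorem exists_family_solution
    (H : IsHyperbolic (fun i => i.val < r) (fun i => toFamily _ (l i))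
      (fun i k => toFamily _ (f i k)) (boundaryCoeff r v))
    (hpos : ∀ i : Fin n, i.val < r → EventuallyOn quarterPlane fun φ p => 0 < ((l i).1 φ p).re)
    (hneg : ∀ i : Fin n, ¬ i.val < r → EventuallyOn quarterPlane fun φ p => ((l i).1 φ p).re < 0)
    {N₀ : ℕ} (hcomp : ∀ χ : Mollifier, χ.1 ∈ mollifiers N₀ → ∀ᶠ ε in 𝓝[>] (0 : ℝ),
      ClassicallyCompatible r (fun i => (l i).1 (χ.scale ε))
        (fun i k => (f i k).1 (χ.scale ε)) (fun i => (a i).1 (χ.scale ε))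
        (fun i => (u₀ i).1 (χ.scale ε)) (fun i k => (v i k).1 (χ.scale ε))
        (fun i => (h i).1 (χ.scale ε))) :
    ∃ u : Fin n → smoothFamilies quarterPlane,
      (∀ i, IsNull (famDt (u i) + toFamily _ (l i) * famDx (u i)
        - ∑ j, toFamily _ (f i j) * u j - toFamily _ (a i))) ∧
      (∀ i, IsNull (familyAtTimeZero (u i) - toFamily _ (u₀ i))) ∧
      ∀ i : Fin n, i.val < r → IsNull (familyAtBoundary (u i)
          - ∑ j, boundaryCoeff r v i j * familyAtBoundary (u j) - toFamily _ (h i)) := by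
  let β := {u : Fin n → ℝ × ℝ → ℂ // ∀ i, ContDiffOn ℝ ∞ (u i) quarterPlane}
  have : Nonempty β := ⟨⟨fun _ _ => 0, fun _ => contDiffOn_const⟩⟩
  let P : ℕ → Mollifier → β → Prop := fun j φ u =>
    (∀ i, ∀ p ∈ quarterPlane, p.1 < j → p.2 < j →
      fderivWithin ℝ (u.1 i) quarterPlane p (0, 1)
        + (l i).1 φ p * fderivWithin ℝ (u.1 i) quarterPlane p (1, 0)
        = ∑ k, (f i k).1 φ p * u.1 k p + (a i).1 φ p) ∧
    (∀ i, ∀ x ∈ halfLine, x < j → u.1 i (x, 0) = (u₀ i).1 φ x) ∧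
    ∀ i : Fin n, i.val < r → ∀ t ∈ halfLine, t < j →
      u.1 i (0, t) = ∑ k with r ≤ k.val, (v i k).1 φ t * u.1 k (0, t) + (h i).1 φ t
  have hP : ∀ {i j φ b}, i ≤ j → P j φ b → P i φ b := fun {i j φ b} hij h1 => by
    have hij' : (i : ℝ) ≤ j := by exact_mod_cast hij
    exact ⟨fun k p hp h2 h3 => h1.1 k p hp (h2.trans_le hij') (h3.trans_le hij'),
      fun k x hx h2 => h1.2.1 k x hx (h2.trans_le hij'),
      fun k hk x hx h2 => h1.2.2 k hk x hx (h2.trans_le hij')⟩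
  obtain ⟨B, hB⟩ := exists_glued_family (β := β) (P := P) hP fun j => by
    choose c hc using fun i => (H.speed i).bounded
    set c' : ℝ := ∑ i, |c i| with hc'
    have hc0 : 0 ≤ c' := Finset.sum_nonneg fun i _ => abs_nonneg _
    have hci : ∀ i, c i ≤ c' := fun i => (le_abs_self _).trans
      (Finset.single_le_sum (f := fun i => |c i|) (fun i _ => abs_nonneg _) (Finset.mem_univ i))
    set K := rect ((j : ℝ) + 1 + c' * (j + 1)) (j + 1) with hK
    have hKQ : K ⊆ quarterPlane := rect_subset_quarterPlane _ _
    have hKc : IsCompact K := isCompact_rect _ _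
    have hs : EventuallyOn quarterPlane fun φ p => ∀ i,
        (i.val < r → 0 < ((l i).1 φ p).re) ∧ (¬ i.val < r → ((l i).1 φ p).re < 0) :=
      EventuallyOn.all fun i => by
        by_cases hi : i.val < r
        · exact (hpos i hi).mono fun φ p _ h1 => ⟨fun _ => h1, fun h2 => absurd hi h2⟩
        · exact (hneg i hi).mono fun φ p _ h1 => ⟨fun h2 => absurd h2 hi, fun _ => h1⟩
    obtain ⟨N₁, h1⟩ := (EventuallyOn.all hc) K hKQ hKc
    obtain ⟨N₂, h2⟩ := hs K hKQ hKc
    refine ⟨N₀ + N₁ + N₂, fun χ hχ => ?_⟩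
    filter_upwards [hcomp χ (mollifiers_anti (by omega) hχ),
      h1 χ (mollifiers_anti (by omega) hχ), h2 χ (mollifiers_anti (by omega) hχ)] with ε h0 h1 h2
    obtain ⟨u, hu, e1, e2, e3⟩ := exists_smooth_solution (R := (j : ℝ) + 1) (T := (j : ℝ) + 1)
      (c := c') (by linarith [Nat.cast_nonneg (α := ℝ) j])
      (by linarith [Nat.cast_nonneg (α := ℝ) j]) hc0
      (fun i => (l i).2.1 _) (fun i k => (f i k).2.1 _) (fun i => (a i).2.1 _)
      (fun i => (u₀ i).2.1 _) (fun i k => (v i k).2.1 _) (fun i => (h i).2.1 _) h0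
      (fun i p hp => (h1 p hp i).1)
      (fun i p hp => (Complex.abs_re_le_norm _).trans ((h1 p hp i).2.trans (hci i)))
      (fun i hi p hp => (h2 p hp i).1 hi) (fun i hi p hp => (h2 p hp i).2 hi)
    simp only [add_sub_cancel_right] at e1 e2 e3
    exact ⟨(⟨u, hu⟩ : β), e1, fun i x hx h3 => e2 i x hx h3 (lt_of_le_of_lt hx h3),
      fun i hi t ht h3 => e3 i hi t ht h3 (lt_of_le_of_lt ht h3)⟩
  refine ⟨fun i => ⟨fun φ => (B φ).1 i, fun φ => (B φ).2 i⟩, fun i => isNull_of_box fun j => ?_,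
    fun i => isNull_of_interval fun j => ?_, fun i hi => isNull_of_interval fun j => ?_⟩
  all_goals
    obtain ⟨N, hN⟩ := hB j
    refine ⟨N, fun χ hχ => ?_⟩
    filter_upwards [hN χ hχ] with ε hε
  · intro p hp h1 h2
    have h3 := hε.1 i p hp h1 h2
    simp [familyDeriv_apply _ _ _ hp, toFamily_val, sub_sub, h3]
  · intro x hx h1
    exact sub_eq_zero.2 (hε.2.1 i x hx h1)
  · intro t ht h1
    have h3 := hε.2.2 i hi t ht h1
    rw [sum_boundaryCoeff hi]
    simp [familyAtBoundary, familyPullback, toFamily_val, sub_sub, h3]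

end Existence

end Colombeau

open Colombeau in
theorem theorem1 (n r : ℕ) (hr : r ≤ n)
    (Λ : Fin n → GenFun quarterPlane) (F : Fin n → Fin n → GenFun quarterPlane)
    (A : Fin n → GenFun quarterPlane) (U₀ : Fin n → GenFun halfLine)
    (ν : Fin n → Fin n → GenFun halfLine) (H : Fin n → GenFun halfLine)
    (hΛ_order : ∀ i j, i < j → Λ j < Λ i)
    (hΛ_pos : ∀ i : Fin n, i.val < r → 0 < Λ i)
    (hΛ_neg : ∀ i : Fin n, r ≤ i.val → Λ i < 0)
    (hΛ_bdd : ∀ i, (Λ i).IsGloballyBounded)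
    (hΛ_log : ∀ i, (dx (Λ i)).IsLocallyLogGrowth)
    (hF_log : ∀ i k, (F i k).IsLocallyLogGrowth)
    (hν_bdd : ∀ i k : Fin n, i.val < r → r ≤ k.val → (ν i k).IsGloballyBounded)
    (h_compat : IsCompatible r Λ F A U₀ ν H) :
    ∃! U : Fin n → GenFun quarterPlane, IsSolution r Λ F A U₀ ν H U := by
  obtain ⟨l, f, a, u₀, v, h, hl, hf, ha, hu, hv, hh, N, hN⟩ := h_compat
  obtain rfl : (fun i => toGenFun _ (l i)) = Λ := funext hl
  obtain rfl : (fun i k => toGenFun _ (f i k)) = F := funext fun i => funext (hf i)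
  obtain rfl : (fun i => toGenFun _ (a i)) = A := funext ha
  obtain rfl : (fun i => toGenFun _ (u₀ i)) = U₀ := funext hu
  obtain rfl : (fun i k => toGenFun _ (v i k)) = ν := funext fun i => funext (hv i)
  obtain rfl : (fun i => toGenFun _ (h i)) = H := funext hh
  have hyp := isHyperbolic_of_representatives hΛ_order hΛ_pos hΛ_neg hΛ_bdd hΛ_log hF_log hν_bdd
    fun i K hK _ => ⟨N, fun χ hχ => (hN χ hχ).mono fun ε hε p hp => hε.1 i p (hK hp)⟩
  obtain ⟨u, h1, h2, h3⟩ := exists_family_solution hyp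
    (fun i hi => by
      have h1 : (toGenFun _ (l i) - 0).IsStrictlyPositive := hΛ_pos i hi
      rw [sub_zero] at h1
      exact h1.eventuallyOn)
    (fun i hi => by
      have h1 : (0 - toGenFun _ (l i)).IsStrictlyPositive := hΛ_neg i (not_lt.1 hi)
      rw [zero_sub, ← map_neg] at h1
      exact h1.eventuallyOn.mono fun φ p _ h2 => by
        have h3 : 0 < (-(l i).1 φ p).re := h2
        rw [Complex.neg_re] at h3
        linarith)
    fun χ hχ => (hN χ hχ).mono fun ε hε => hε.2
  -- The residuals of `u` differ from the data by null families, so that `u` is moderate.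
  have hum : ∀ i k, IsControlled Scale.moderate k (u i) := fun i k =>
    isControlled_of_system hyp k
      (fun i => by simpa using ((h1 i).isControlled _ k).add (toFamily_moderate (a i) k))
      (fun i => by simpa using ((h2 i).isControlled _ k).add (toFamily_moderate (u₀ i) k))
      (fun i hi => by simpa using ((h3 i hi).isControlled _ k).add (toFamily_moderate (h i) k)) i
  refine ⟨fun i => toGenFun _ ⟨(u i).1, (u i).2, isModerate_iff.2 (hum i)⟩,
    isSolution_toGenFun_iff.2 ⟨fun i => (h1 i).isControlled _, fun i => (h2 i).isControlled _,
      fun i hi => (h3 i hi).isControlled _⟩, fun U hU => ?_⟩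
  -- The difference of two solutions has negligible residuals, so that it is negligible.
  choose w hw using fun i => Ideal.Quotient.mk_surjective (U i)
  obtain rfl : (fun i => toGenFun _ (w i)) = U := funext hw
  obtain ⟨g1, g2, g3⟩ := isSolution_toGenFun_iff.1 hU
  funext i
  refine (toGenFun_eq_iff_isControlled (ρ := toFamily _ (w i) - u i) fun _ _ _ => rfl).2 fun k =>
    isControlled_of_system (u := fun i => toFamily _ (w i) - u i) hyp k (fun i => ?_) (fun i => ?_)
      (fun i hi => ?_) i
  · convert (g1 i k).sub ((h1 i).isControlled _ k) using 1
    simp only [map_sub, mul_sub, Finset.sum_sub_distrib]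
    ring
  · convert (g2 i k).sub ((h2 i).isControlled _ k) using 1
    rw [map_sub]
    ring
  · convert (g3 i hi k).sub ((h3 i hi).isControlled _ k) using 1
    simp only [map_sub, mul_sub, Finset.sum_sub_distrib]
    ring
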